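/- Let $G$ be a locally compact Hausdorff étale groupoid (all operations continuous, range and source maps $r,s\colon G\to G^{(0)}$ local homeomorphisms) whose unit space $G^{(0)}$ is compact (possibly non-metrizable). For $V,W\subset G$ put $VW=\{vw : v\in V,\ w\in W,\ s(v)=r(w)\}$ and $Vx=V\{x\}$. A $G$-set is a subset of $G$ on which both $r$ and $s$ are injective. $G$ is called minimal if the only open subsets $U\subset G^{(0)}$ with $r(GU)=U$ are $\emptyset$ and $G^{(0)}$. A compact subgroupoid $K\subset G$ containing $G^{(0)}$ is called elementary if there are a partition $G^{(0)}=\bigsqcup_{i=1}^{n}\bigsqcup_{j=1}^{N_i}F^{(i)}_j$ into clopen subsets (with $N_i\ge 1$) and, for all $i$ and all $1\le j,k\le N_i$, a unique compact $K$-set $V^{(i)}_{j,k}\subset K$, open in $K$, with $r(V^{(i)}_{j,k})=F^{(i)}_j$ and $s(V^{(i)}_{j,k})=F^{(i)}_k$, such that $K=\bigsqcup_{i=1}^n\bigsqcup_{1\le j,k\le N_i}V^{(i)}_{j,k}$. (The clopen set $\bigsqcup_i F^{(i)}_1$ is called a fundamental domain of $K$.) For a compact $C\subset G$ and $\varepsilon>0$,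 $K$ is called $(C,\varepsilon)$-invariant if $$\frac{\#(CKx\setminus Kx)}{\#(Kx)}<\varepsilon\qquad\text{for all }x\in G^{(0)}.$$ $G$ is called almost finite if (1) the compact open $G$-sets cover $G$, and (2) for every compact $C\subset G$ and every $\varepsilon>0$ there is a $(C,\varepsilon)$-invariant elementary subgroupoid $K$ of $G$. The reduced groupoid C$^*$-algebra $\mathrm C^*_{\mathrm r}(G)$ is the norm closure of the image of the convolution $*$-algebra $C_{\mathrm c}(G)$ under the left regular representation on $\ell^2(G)=\bigoplus_{x\in G^{(0)}}\ell^2(s^{-1}(x))$, $(\lambda(f)\xi)(g)=\sum_{hk=g}f(h)\xi(k)$. The stable rank of a unital C$^*$-algebra $A$ is the least $n\ge 1$ such that $\{(a_1,\dots,a_n)\in A^n : Aa_1+\cdots+Aa_n=A\}$ is norm dense in $A^n$ (and $\infty$ if there is no such $n$). **Theorem.** If $G$ is minimal and almost finite, then $\mathrm C^*_{\mathrm r}(G)$ has stable rank one. -/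

import Mathlib

/-- A groupoid, given as its set `G` of arrows: unit space, range and source maps, multiplication
and inversion.  Multiplication is written as a total function, but its values are only meaningful
(and only ever used) on composable pairs, i.e. pairs `(g, h)` with `src g = rng h`. -/
class ArrowGroupoid (G : Type*) where
  /-- the unit space -/
  units : Set G
  /-- the range map -/
  rng : G → G
  /-- the source map -/
  src : G → G
  /-- the multiplication -/
  comp : G → G → G
  /-- the inversion -/
  inver : G → G
  rng_mem : ∀ g, rng g ∈ units
  src_mem : ∀ g, src g ∈ units
  rng_unit : ∀ g ∈ units, rng g = g
  src_unit : ∀ g ∈ units, src g = g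
  rng_comp : ∀ g h, src g = rng h → rng (comp g h) = rng g
  src_comp : ∀ g h, src g = rng h → src (comp g h) = src h
  rng_mul_self : ∀ g, comp (rng g) g = g
  mul_src_self : ∀ g, comp g (src g) = g
  assoc : ∀ g₁ g₂ g₃, src g₁ = rng g₂ → src g₂ = rng g₃ →
    comp (comp g₁ g₂) g₃ = comp g₁ (comp g₂ g₃)
  rng_inver : ∀ g, rng (inver g) = src g
  src_inver : ∀ g, src (inver g) = rng g
  mul_inver : ∀ g, comp g (inver g) = rng g
  inver_mul : ∀ g, comp (inver g) g = src g

open ArrowGroupoid in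
/-- An étale groupoid: a groupoid with a topology making all operations continuous, whose range and
source maps are local homeomorphisms onto the unit space (with its relative topology). -/
class EtaleGroupoid (G : Type*) [TopologicalSpace G] extends ArrowGroupoid G where
  continuous_rng : Continuous (rng : G → G)
  continuous_src : Continuous (src : G → G)
  continuousOn_comp :
    ContinuousOn (fun p : G × G => comp p.1 p.2) {p : G × G | src p.1 = rng p.2}
  continuous_inver : Continuous (inver : G → G)
  isLocalHomeomorph_rng :
    IsLocalHomeomorph (fun g : G => (⟨rng g, rng_mem g⟩ : (units : Set G)))
  isLocalHomeomorph_src :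
    IsLocalHomeomorph (fun g : G => (⟨src g, src_mem g⟩ : (units : Set G)))

namespace EtaleGroupoid

open ArrowGroupoid

section Basic

variable {G : Type*} [ArrowGroupoid G]

/-- `VW = {vw : v ∈ V, w ∈ W, s(v) = r(w)}`. -/
def setComp (V W : Set G) : Set G :=
  {x | ∃ v ∈ V, ∃ w ∈ W, src v = rng w ∧ comp v w = x}

/-- A `G`-set: a subset on which both the range and source maps are injective. -/
def IsGSet (V : Set G) : Prop :=
  Set.InjOn rng V ∧ Set.InjOn src V

/-- A subset `U` of the unit space is invariant if `r(GU) = U`. -/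
def IsInvariant (U : Set G) : Prop :=
  rng '' (setComp Set.univ U) = U

/-- A subgroupoid: a set of arrows closed under (composable) multiplication and inversion. -/
def IsSubgroupoid (K : Set G) : Prop :=
  (∀ g ∈ K, ∀ h ∈ K, src g = rng h → comp g h ∈ K) ∧ ∀ g ∈ K, inver g ∈ K

end Basic

section AlmostFinite

variable {G : Type*} [TopologicalSpace G] [EtaleGroupoid G]

variable (G) in
/-- `G` is minimal if the unit space has no open invariant subset apart from the empty set and the
whole unit space. -/
def IsMinimal : Prop :=
  ∀ U : Set G, U ⊆ units → IsOpen ((↑) ⁻¹' U : Set (units : Set G)) → IsInvariant U →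
    U = ∅ ∨ U = units

/-- `V` is a compact open `K`-set, where the subgroupoid `K` has the relative topology. -/
def IsCompactOpenSetOf (K V : Set G) : Prop :=
  V ⊆ K ∧ IsCompact V ∧ IsOpen ((↑) ⁻¹' V : Set K) ∧ IsGSet V

/-- `F` is a fundamental domain of the compact subgroupoid `K`, where `K` contains the unit space
of `G` (so that `K` and `G` have the same unit space).  The sets `P i j` form a partition of the
unit space by clopen sets, `F` is the union of the first members `P i 0`, for each `i, j, k` the set
`V i j k` is the unique compact open `K`-set with range `P i j` and source `P i k`, and `K` is the
disjoint union of all the `V i j k`. -/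
def IsFundamentalDomain (K F : Set G) : Prop :=
  ∃ (n : ℕ) (N : Fin n → ℕ) (hN : ∀ i, 0 < N i) (P : (i : Fin n) → Fin (N i) → Set G)
    (V : (i : Fin n) → Fin (N i) → Fin (N i) → Set G),
    (∀ i j, P i j ⊆ units ∧ IsClopen ((↑) ⁻¹' (P i j) : Set (units : Set G))) ∧
    (∀ p q : (i : Fin n) × Fin (N i), p ≠ q → Disjoint (P p.1 p.2) (P q.1 q.2)) ∧
    (⋃ i, ⋃ j, P i j) = units ∧
    F = ⋃ i, P i ⟨0, hN i⟩ ∧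
    (∀ i j k, IsCompactOpenSetOf K (V i j k) ∧ rng '' (V i j k) = P i j ∧
      src '' (V i j k) = P i k) ∧
    (∀ i j k, ∀ W : Set G, IsCompactOpenSetOf K W → rng '' W = P i j → src '' W = P i k →
      W = V i j k) ∧
    (∀ p q : (i : Fin n) × (Fin (N i) × Fin (N i)), p ≠ q →
      Disjoint (V p.1 p.2.1 p.2.2) (V q.1 q.2.1 q.2.2)) ∧
    K = ⋃ i, ⋃ j, ⋃ k, V i j k

/-- `K` is an elementary subgroupoid of `G`: a compact subgroupoid containing the unit space and
admitting a fundamental domain. -/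
def IsElementary (K : Set G) : Prop :=
  IsSubgroupoid K ∧ IsCompact K ∧ units ⊆ K ∧ ∃ F : Set G, IsFundamentalDomain K F

/-- `K` is `(C, ε)`-invariant: `#(CKs \ Ks) / #(Ks) < ε` for every unit `s`.  (For compact `C` and
`K` both sets are finite, because `G` is étale; and `s ∈ Ks` if `K` contains the unit space.) -/
def IsAlmostInvariant (C : Set G) (ε : ℝ) (K : Set G) : Prop :=
  ∀ x ∈ (units : Set G),
    ((setComp C (setComp K {x}) \ setComp K {x}).ncard : ℝ) / ((setComp K {x}).ncard : ℝ) < ε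

variable (G) in
/-- Almost finiteness: the compact open `G`-sets cover `G`, and for every compact `C ⊆ G` and every
`ε > 0` there is a `(C, ε)`-invariant elementary subgroupoid. -/
def AlmostFinite : Prop :=
  (∀ g : G, ∃ V : Set G, IsCompact V ∧ IsOpen V ∧ IsGSet V ∧ g ∈ V) ∧
  ∀ C : Set G, IsCompact C → ∀ ε : ℝ, 0 < ε →
    ∃ K : Set G, IsElementary K ∧ IsAlmostInvariant C ε K

end AlmostFinite

section MatrixOperator

/-- The Hilbert space `ℓ²(X)`. -/
abbrev Ell2 (X : Type*) : Type _ := lp (fun _ : X => ℂ) 2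

variable {X : Type*}

/-- A bounded matrix with a uniform bound on the number of non-zero entries in every row and
every column. -/
structure IsBandMatrix (a : X → X → ℂ) (M : ℝ) (N : ℕ) : Prop where
  norm_le : ∀ g k, ‖a g k‖ ≤ M
  row : ∀ g, {k | a g k ≠ 0}.encard ≤ N
  col : ∀ k, {g | a g k ≠ 0}.encard ≤ N

theorem IsBandMatrix.row_finite {a : X → X → ℂ} {M : ℝ} {N : ℕ} (h : IsBandMatrix a M N) (g : X) :
    {k | a g k ≠ 0}.Finite :=
  Set.finite_of_encard_le_coe (h.row g)

theorem IsBandMatrix.summable {a : X → X → ℂ} {M : ℝ} {N : ℕ} (h : IsBandMatrix a M N)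
    (ξ : X → ℂ) (g : X) : Summable fun k => a g k * ξ k := by
  refine summable_of_hasFiniteSupport ((h.row_finite g).subset fun k hk => ?_)
  exact left_ne_zero_of_mul hk

theorem IsBandMatrix.sum_le {a : X → X → ℂ} {M : ℝ} {N : ℕ} (h : IsBandMatrix a M N)
    (ξ : Ell2 X) (s : Finset X) :
    ∑ g ∈ s, ‖∑' k, a g k * ξ k‖ ^ (2 : ENNReal).toReal ≤
      (|M| * N * ‖ξ‖) ^ (2 : ENNReal).toReal := by
  classical
  have h2 : (2 : ENNReal).toReal = ((2 : ℕ) : ℝ) := by norm_num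
  set S : X → Finset X := fun g => (h.row_finite g).toFinset with hS
  have hmem : ∀ g k, k ∈ S g ↔ a g k ≠ 0 := by intro g k; simp [hS]
  have hcardS : ∀ g, ((S g).card : ℝ) ≤ N := by
    intro g
    have := h.row g
    rw [(h.row_finite g).encard_eq_coe_toFinset_card] at this
    exact_mod_cast this
  have hcol : ∀ k, ((s.filter fun g => a g k ≠ 0).card : ℝ) ≤ N := by
    intro k
    have h1 : ((s.filter fun g => a g k ≠ 0 : Finset X) : Set X).encard ≤ N :=
      (Set.encard_le_encard (by intro g hg; simpa using (Finset.mem_filter.1 hg).2)).trans (h.col k)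
    rw [Set.encard_coe_eq_coe_finsetCard] at h1
    exact_mod_cast h1
  have key : ∀ g, ‖∑' k, a g k * ξ k‖ ^ 2 ≤ N * (M ^ 2 * ∑ k ∈ S g, ‖ξ k‖ ^ 2) := by
    intro g
    have e : ∑' k, a g k * ξ k = ∑ k ∈ S g, a g k * ξ k := by
      refine tsum_eq_sum fun k hk => ?_
      have : a g k = 0 := by by_contra hne; exact hk ((hmem g k).2 hne)
      simp [this]
    rw [e]
    calc ‖∑ k ∈ S g, a g k * ξ k‖ ^ 2 ≤ (∑ k ∈ S g, ‖a g k * ξ k‖) ^ 2 := by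
          gcongr; exact norm_sum_le _ _
      _ ≤ (S g).card * ∑ k ∈ S g, ‖a g k * ξ k‖ ^ 2 := sq_sum_le_card_mul_sum_sq
      _ ≤ N * ∑ k ∈ S g, M ^ 2 * ‖ξ k‖ ^ 2 := by
          gcongr with k hk
          · exact_mod_cast hcardS g
          · rw [norm_mul, mul_pow]
            gcongr
            exact h.norm_le g k
      _ = _ := by rw [← Finset.mul_sum]
  have hle : ∑ k ∈ s.biUnion S, ‖ξ k‖ ^ 2 ≤ ‖ξ‖ ^ 2 := by
    have := lp.sum_rpow_le_norm_rpow (p := 2) (by norm_num) ξ (s.biUnion S)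
    simpa only [h2, Real.rpow_natCast] using this
  simp only [h2, Real.rpow_natCast]
  calc ∑ g ∈ s, ‖∑' k, a g k * ξ k‖ ^ 2
      ≤ ∑ g ∈ s, N * (M ^ 2 * ∑ k ∈ S g, ‖ξ k‖ ^ 2) := Finset.sum_le_sum fun g _ => key g
    _ = N * M ^ 2 * ∑ g ∈ s, ∑ k ∈ S g, ‖ξ k‖ ^ 2 := by
        rw [Finset.mul_sum]; refine Finset.sum_congr rfl fun g _ => ?_; ring
    _ = N * M ^ 2 * ∑ k ∈ s.biUnion S, ∑ g ∈ s.filter (fun g => a g k ≠ 0), ‖ξ k‖ ^ 2 := by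
        congr 1
        refine Finset.sum_comm' fun g k => ?_
        simp only [Finset.mem_biUnion, Finset.mem_filter, hmem]
        exact ⟨fun ⟨h1, h2⟩ => ⟨⟨h1, h2⟩, g, h1, h2⟩, fun ⟨⟨h1, h2⟩, _⟩ => ⟨h1, h2⟩⟩
    _ ≤ N * M ^ 2 * ∑ k ∈ s.biUnion S, N * ‖ξ k‖ ^ 2 := by
        gcongr with k hk
        rw [Finset.sum_const, nsmul_eq_mul]
        gcongr
        exact_mod_cast hcol k
    _ = (N * M) ^ 2 * ∑ k ∈ s.biUnion S, ‖ξ k‖ ^ 2 := by rw [← Finset.mul_sum]; ring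
    _ ≤ (N * M) ^ 2 * ‖ξ‖ ^ 2 := by gcongr
    _ = (|M| * N * ‖ξ‖) ^ 2 := by rw [mul_pow, mul_pow, mul_pow, sq_abs]; ring

/-- The bounded operator `(Tξ)(g) = ∑ₖ a(g, k) ξ(k)` on `ℓ²(X)`. -/
noncomputable def IsBandMatrix.toOp {a : X → X → ℂ} {M : ℝ} {N : ℕ} (h : IsBandMatrix a M N) :
    Ell2 X →L[ℂ] Ell2 X :=
  LinearMap.mkContinuous
    { toFun := fun ξ => ⟨fun g => ∑' k, a g k * ξ k, memℓp_gen' (h.sum_le ξ)⟩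
      map_add' := fun ξ η => by
        ext g
        simp only [lp.coeFn_add, Pi.add_apply, mul_add]
        exact (h.summable ξ g).tsum_add (h.summable η g)
      map_smul' := fun c ξ => by
        ext g
        simp only [lp.coeFn_smul, Pi.smul_apply, smul_eq_mul, RingHom.id_apply]
        rw [← tsum_mul_left]
        exact tsum_congr fun k => by ring }
    (|M| * N)
    (fun ξ => lp.norm_le_of_forall_sum_le (by norm_num) (by positivity) (h.sum_le ξ))

theorem IsBandMatrix.toOp_apply {a : X → X → ℂ} {M : ℝ} {N : ℕ} (h : IsBandMatrix a M N)
    (ξ : Ell2 X) (g : X) : h.toOp ξ g = ∑' k, a g k * ξ k := rfl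

end MatrixOperator

section Reduced

theorem exists_card_le {G Y : Type*} [TopologicalSpace G] (φ : G → Y) (hφ : ∀ g : G, ∃ U ∈ nhds g, Set.InjOn φ U)
    {C : Set G} (hC : IsCompact C) : ∃ N : ℕ, ∀ y, {g ∈ C | φ g = y}.encard ≤ N := by
  classical
  choose U hU hinj using hφ
  obtain ⟨t, -, ht⟩ := hC.elim_nhds_subcover U fun g _ => hU g
  refine ⟨t.card, fun y => ?_⟩
  have hsub : {g ∈ C | φ g = y} ⊆ ⋃ x ∈ t, {g ∈ U x | φ g = y} := by
    rintro g ⟨hg, hy⟩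
    obtain ⟨x, hx, hgx⟩ := Set.mem_iUnion₂.1 (ht hg)
    exact Set.mem_iUnion₂.2 ⟨x, hx, hgx, hy⟩
  choose! p hp using fun (g : G) (hg : g ∈ {g ∈ C | φ g = y}) => Set.mem_iUnion₂.1 (hsub hg)
  have hmaps : Set.MapsTo p {g ∈ C | φ g = y} (t : Set G) := fun g hg => (hp g hg).1
  have hpinj : Set.InjOn p {g ∈ C | φ g = y} := by
    intro g hg g' hg' e
    obtain ⟨_, h1, h2⟩ := hp g hg
    obtain ⟨_, h1', h2'⟩ := hp g' hg'
    rw [← e] at h1'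
    exact hinj _ h1 h1' (h2.trans h2'.symm)
  have := Set.encard_le_encard_of_injOn hmaps hpinj
  rwa [Set.encard_coe_eq_coe_finsetCard] at this

variable {G : Type*} [TopologicalSpace G] [EtaleGroupoid G]

open scoped CompactlySupported

open Classical in
/-- The matrix of left convolution by `f`: the entry at `(g, k)` is `f(g k⁻¹)` if `s(g) = s(k)`,
and zero otherwise. -/
noncomputable def convKernel (f : G → ℂ) (g k : G) : ℂ :=
  if src g = src k then f (comp g (inver k)) else 0

theorem comp_inver_left_inj {g h k : G} (h1 : src g = src k) (h2 : src h = src k)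
    (e : comp g (inver k) = comp h (inver k)) : g = h := by
  have key : ∀ x : G, src x = src k → comp (comp x (inver k)) k = x := by
    intro x hx
    rw [assoc _ _ _ (by rw [rng_inver, hx]) (src_inver k), inver_mul, ← hx, mul_src_self]
  rw [← key g h1, e, key h h2]

theorem comp_inver_right_inj {g h k : G} (h1 : src g = src h) (h2 : src g = src k)
    (e : comp g (inver h) = comp g (inver k)) : h = k := by
  have key : ∀ x : G, src g = src x → comp (inver g) (comp g (inver x)) = inver x := by
    intro x hx
    rw [← assoc _ _ _ (src_inver g) (by rw [rng_inver, hx]), inver_mul, hx, ← rng_inver,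
      rng_mul_self]
  have e' : inver h = inver k := by rw [← key h h1, e, key k h2]
  have key2 : ∀ x : G, comp (comp x (inver x)) x = x := by
    intro x; rw [mul_inver, rng_mul_self]
  have hr : rng h = rng k := by rw [← src_inver, e', src_inver]
  calc h = comp (rng h) h := (rng_mul_self h).symm
    _ = comp (comp k (inver k)) h := by rw [hr, mul_inver]
    _ = comp k (comp (inver k) h) :=
        assoc _ _ _ (by rw [rng_inver]) (by rw [src_inver, hr])
    _ = k := by rw [← e', inver_mul, ← h1, h2, mul_src_self]

theorem exists_isBandMatrix (f : C_c(G, ℂ)) :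
    ∃ (M : ℝ) (N : ℕ), IsBandMatrix (convKernel (f : G → ℂ)) M N := by
  have hC : IsCompact (tsupport f) := f.hasCompactSupport
  obtain ⟨M, hM⟩ := f.hasCompactSupport.exists_bound_of_continuous f.continuous
  have loc : ∀ φ : G → (units : Set G), IsLocalHomeomorph φ →
      ∀ g : G, ∃ U ∈ nhds g, Set.InjOn φ U := by
    intro φ hφ g
    obtain ⟨e, he, rfl⟩ := hφ g
    exact ⟨e.source, e.open_source.mem_nhds he, e.injOn⟩
  obtain ⟨N₁, h₁⟩ := exists_card_le _ (loc _ (isLocalHomeomorph_rng (G := G))) hC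
  obtain ⟨N₂, h₂⟩ := exists_card_le _ (loc _ (isLocalHomeomorph_src (G := G))) hC
  have hne : ∀ g k, convKernel (f : G → ℂ) g k ≠ 0 →
      src g = src k ∧ comp g (inver k) ∈ tsupport f := by
    intro g k hgk
    unfold convKernel at hgk
    split_ifs at hgk with hs
    · exact ⟨hs, subset_tsupport _ hgk⟩
    · exact absurd rfl hgk
  refine ⟨M, max N₁ N₂, ⟨fun g k => ?_, fun g => ?_, fun k => ?_⟩⟩
  · unfold convKernel
    split_ifs
    · exact hM _
    · simpa using (norm_nonneg _).trans (hM g)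
  · refine (Set.encard_le_encard_of_injOn (f := fun k => comp g (inver k))
      (t := {x ∈ tsupport f | (⟨rng x, rng_mem x⟩ : (units : Set G)) = ⟨rng g, rng_mem g⟩})
      ?_ ?_).trans ((h₁ _).trans (by exact_mod_cast le_max_left _ _))
    · intro k hk
      obtain ⟨hs, ht⟩ := hne g k hk
      exact ⟨ht, Subtype.ext (rng_comp _ _ (by rw [rng_inver, hs]))⟩
    · intro k hk k' hk' e
      exact comp_inver_right_inj (hne g k hk).1 (hne g k' hk').1 e
  · refine (Set.encard_le_encard_of_injOn (f := fun g => comp g (inver k))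
      (t := {x ∈ tsupport f | (⟨src x, src_mem x⟩ : (units : Set G)) = ⟨rng k, rng_mem k⟩})
      ?_ ?_).trans ((h₂ _).trans (by exact_mod_cast le_max_right _ _))
    · intro g hg
      obtain ⟨hs, ht⟩ := hne g k hg
      exact ⟨ht, Subtype.ext ((src_comp _ _ (by rw [rng_inver, hs])).trans (src_inver k))⟩
    · intro g hg g' hg' e
      exact comp_inver_left_inj (hne g k hg).1 (hne g' k hg').1 e

/-- The left regular representation of `C_c(G)` on `ℓ²(G) = ⨁ₓ ℓ²(s⁻¹(x))`, the direct sum being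
over all units `x`: the operator of left convolution,
`(λ(f)ξ)(g) = ∑_{hk = g} f(h) ξ(k) = ∑_{s(k) = s(g)} f(g k⁻¹) ξ(k)`. -/
noncomputable def regularRep (f : C_c(G, ℂ)) : Ell2 G →L[ℂ] Ell2 G :=
  (exists_isBandMatrix f).choose_spec.choose_spec.toOp

theorem regularRep_apply (f : C_c(G, ℂ)) (ξ : Ell2 G) (g : G) :
    regularRep f ξ g = ∑' k, convKernel (f : G → ℂ) g k * ξ k := rfl

variable (G) in
/-- The reduced groupoid C⋆-algebra of `G`: the C⋆-algebra of bounded operators on `ℓ²(G)`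
generated by the image of `C_c(G)` under the left regular representation.  (This image is a unital
⋆-algebra if the unit space is compact, so this is the norm closure of the image.) -/
noncomputable def reducedCStarAlgebra : StarSubalgebra ℂ (Ell2 G →L[ℂ] Ell2 G) :=
  (StarAlgebra.adjoin ℂ (Set.range (regularRep (G := G)))).topologicalClosure

instance isClosed_reducedCStarAlgebra :
    IsClosed (reducedCStarAlgebra G : Set (Ell2 G →L[ℂ] Ell2 G)) :=
  StarSubalgebra.isClosed_topologicalClosure _

end Reduced

section StableRank

/-- `Lg_n(A)`: the `n`-tuples that generate `A` as a left ideal, `A a₁ + ⋯ + A aₙ = A`. -/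
def leftGenerators (A : Type*) [Ring A] (n : ℕ) : Set (Fin n → A) :=
  {a | ∀ b : A, ∃ c : Fin n → A, ∑ i, c i * a i = b}

/-- The (topological) stable rank of a unital C⋆-algebra: the least `n ≥ 1` such that `Lg_n(A)` is
norm dense in `Aⁿ`, or `∞` if there is none. -/
noncomputable def stableRank (A : Type*) [CStarAlgebra A] : ℕ∞ :=
  sInf {m : ℕ∞ | ∃ n : ℕ, m = n ∧ 1 ≤ n ∧ Dense (leftGenerators A n)}

end StableRank

end EtaleGroupoid

/-! Stable rank one means that the invertible elements are dense. If some source fibre is finite,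
minimality makes G finite and the algebra finite-dimensional, so spectra are finite and small scalar
shifts are invertible. Otherwise all source fibres are infinite, and a non-invertible a is treated
in Rørdam's manner: a small perturbation of a, multiplied by invertibles, becomes a nilpotent x, and
x is the limit of the invertibles t + x.

Two counting facts drive the argument. For an elementary K and a unit x, the set Kx is finite; if K
is sufficiently invariant, only a small fraction of Kx consists of points at which an arrow of a
given compact C leaves K (`IsAlmostInvariant.bad_le`). By minimality a nonempty open set O of units
is reached from every unit by an arrow of a fixed compact set, so O occupies a definite fraction of
Kx (`IsAlmostInvariant.le_good`).

Finiteness (`mul_star_self_eq_one`). On one set Kx compare the column and row sums of squares of the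
matrix of an approximation to an isometry v. Up to the bad points the rows carry at least as much as
the columns, whereas vv* ≠ 1 would cost the rows a definite fraction of the mass. So isometries are
unitary. Hence if a is not invertible, neither a*a nor aa* is, and functional calculus gives b near
a with b d*d = 0 = e*e b and d, e ≠ 0 (`exists_near_zero_divisor`).

Clopen annihilators. On a suitable small open set of units the function f approximating d*d has no
off-diagonal arrows, which yields d*d h = u h with u invertible and h ≠ 0 a function on the units
(`exists_isUnit_mul_unitRep`). The set {h ≠ 0} meets every orbit of an invariant K, and the arrows
of K spread h over a whole level of K by an invertible element (`IsTower.exists_isUnit_mul_level`).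
So, up to invertible factors, b is annihilated on both sides by the indicator of a nonempty clopen
set U (`exists_clopen_annihilator`).

Nilpotency. Such an element is approximated by λ(f) with f vanishing on all arrows that start or end
in U. Let C be the support of f. With two nested scales K₁, K of towers one finds a clopen B such
that arrows of C with range outside B lie in both K₁ and K, while each K-orbit has more points in U
than in B, with a surplus exceeding the size N of the K₁-orbits (`exists_two_towers`). Order each
K-orbit in two ways: U first, then the rest with the classes of K₁ ∩ K kept together; and B first,
then the remaining points outside U in the same order as before, then U. Let the bisection W send
the point of a given rank in the second order to the point of that rank in the first. An arrow of C
outside U followed by W either ends in U or strictly lowers the first rank: passing from its source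
to its range changes the position inside a class by at most N, and exchanging U for B at the head of
the list gains more than that (`exists_lowering_bisection`). Thus 1_W f is nilpotent, and 1_W acts
by a coisometry, which is unitary by finiteness. -/

namespace EtaleGroupoid

open ArrowGroupoid Set Filter Topology
open scoped CompactlySupported

/-! ### Algebra of arrows: cancellation and quotients g k⁻¹. -/

section Algebra

variable {G : Type*} [ArrowGroupoid G]

theorem rng_rng (g : G) : rng (rng g) = rng g := rng_unit _ (rng_mem g)

theorem src_rng (g : G) : src (rng g) = rng g := src_unit _ (rng_mem g)

theorem rng_src (g : G) : rng (src g) = src g := rng_unit _ (src_mem g)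

theorem src_src (g : G) : src (src g) = src g := src_unit _ (src_mem g)

theorem inver_comp_cancel {g h : G} (e : src g = rng h) : comp (inver g) (comp g h) = h := by
  rw [← assoc _ _ _ (src_inver g) e, inver_mul, e, rng_mul_self]

theorem comp_inver_cancel {g h : G} (e : src g = rng h) : comp (comp g h) (inver h) = g := by
  rw [assoc _ _ _ e (rng_inver h).symm, mul_inver, ← e, mul_src_self]

theorem comp_left_cancel {g h k : G} (e : src g = rng h) (e' : src g = rng k)
    (he : comp g h = comp g k) : h = k := by
  rw [← inver_comp_cancel e, he, inver_comp_cancel e']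

theorem comp_right_cancel {g h k : G} (e : src g = rng k) (e' : src h = rng k)
    (he : comp g k = comp h k) : g = h := by
  rw [← comp_inver_cancel e, he, comp_inver_cancel e']

theorem inver_inver (g : G) : inver (inver g) = g := by
  refine comp_left_cancel (g := inver g) (by rw [rng_inver]) (src_inver g) ?_
  rw [mul_inver, inver_mul, rng_inver]

theorem inver_injective : Function.Injective (inver : G → G) := fun g h e => by
  rw [← inver_inver g, e, inver_inver]

theorem inver_unit {x : G} (hx : x ∈ (units : Set G)) : inver x = x := by
  have h := rng_mul_self (inver x)
  rw [rng_inver, src_unit x hx] at h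
  rw [← h, mul_inver, rng_unit x hx]

theorem comp_inver_comp_cancel {g k : G} (e : src g = src k) : comp (comp g (inver k)) k = g := by
  rw [assoc _ _ _ (by rw [rng_inver, e]) (src_inver k), inver_mul, ← e, mul_src_self]

theorem rng_div {g k : G} (e : src g = src k) : rng (comp g (inver k)) = rng g :=
  rng_comp _ _ (by rw [rng_inver, e])

theorem src_div {g k : G} (e : src g = src k) : src (comp g (inver k)) = rng k := by
  rw [src_comp _ _ (by rw [rng_inver, e]), src_inver]

theorem inver_comp {g h : G} (e : src g = rng h) :
    inver (comp g h) = comp (inver h) (inver g) := by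
  have e1 : src (inver h) = rng (inver g) := by rw [src_inver, rng_inver, e]
  refine comp_left_cancel (g := comp g h) (by rw [rng_inver]) ?_ ?_
  · rw [src_comp _ _ e, rng_comp _ _ e1, rng_inver]
  · rw [mul_inver, rng_comp _ _ e, ← assoc _ _ _ _ e1, comp_inver_cancel e, mul_inver]
    rw [src_comp _ _ e, rng_inver]

theorem inver_div {g k : G} (e : src g = src k) : inver (comp g (inver k)) = comp k (inver g) := by
  rw [inver_comp (by rw [rng_inver, e]), inver_inver]

theorem div_comp_div {g k l : G} (e : src g = src k) (e' : src k = src l) :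
    comp (comp g (inver k)) (comp k (inver l)) = comp g (inver l) := by
  rw [← assoc _ _ _ (by rw [src_div e]) (by rw [rng_inver, e']), comp_inver_comp_cancel e]

theorem div_div_cancel {g k l : G} (e : src g = src k) (e' : src k = src l) :
    comp (comp g (inver l)) (inver (comp k (inver l))) = comp g (inver k) := by
  rw [inver_div e', div_comp_div (e.trans e') e'.symm]

theorem div_src (g : G) : comp g (inver (src g)) = g := by
  rw [inver_unit (src_mem g), mul_src_self]

theorem div_mem_units_iff {g k : G} (e : src g = src k) :
    comp g (inver k) ∈ (units : Set G) ↔ g = k := by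
  constructor
  · intro h
    rw [← comp_inver_comp_cancel e, ← src_unit _ h, src_div e, rng_mul_self]
  · rintro rfl
    rw [mul_inver]
    exact rng_mem _

theorem mem_setComp_singleton {K : Set G} {x g : G} (hx : x ∈ (units : Set G)) :
    g ∈ setComp K {x} ↔ g ∈ K ∧ src g = x := by
  constructor
  · rintro ⟨k, hk, w, rfl, e, rfl⟩
    rw [rng_unit _ hx] at e
    have : comp k w = k := by rw [← e, mul_src_self]
    rw [this]
    exact ⟨hk, e⟩
  · rintro ⟨hg, rfl⟩
    exact ⟨g, hg, _, rfl, (rng_src g).symm, mul_src_self g⟩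

end Algebra

/-! ### Topology of étale groupoids and compact open bisections. -/

section Topological

variable {G : Type*} [TopologicalSpace G] [EtaleGroupoid G]

theorem exists_mem_nhds_injOn_rng (g : G) : ∃ U ∈ 𝓝 g, InjOn (rng : G → G) U := by
  obtain ⟨e, he, h⟩ := isLocalHomeomorph_rng (G := G) g
  refine ⟨e.source, e.open_source.mem_nhds he, fun a ha b hb hab => e.injOn ha hb ?_⟩
  rw [← h]
  exact Subtype.ext hab

theorem exists_mem_nhds_injOn_src (g : G) : ∃ U ∈ 𝓝 g, InjOn (src : G → G) U := by
  obtain ⟨e, he, h⟩ := isLocalHomeomorph_src (G := G) g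
  refine ⟨e.source, e.open_source.mem_nhds he, fun a ha b hb hab => e.injOn ha hb ?_⟩
  rw [← h]
  exact Subtype.ext hab

variable (G) in
-- Near a unit, both g and r(g) lie in a neighbourhood where r is injective, and r(r(g)) = r(g)
-- forces g = r(g).
theorem isOpen_units : IsOpen (units : Set G) := by
  rw [isOpen_iff_mem_nhds]
  intro x hx
  obtain ⟨U, hU, hinj⟩ := exists_mem_nhds_injOn_rng x
  have hr : (rng : G → G) ⁻¹' U ∈ 𝓝 x := by
    refine continuous_rng.continuousAt ?_
    rwa [rng_unit x hx]
  filter_upwards [hU, hr] with g hg hg'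
  rw [← hinj hg' hg (rng_rng g)]
  exact rng_mem g

variable (G) in
theorem isClosed_units [T2Space G] : IsClosed (units : Set G) := by
  have : (units : Set G) = {g | rng g = g} := by
    ext g
    exact ⟨rng_unit g, fun h => by rw [← show rng g = g from h]; exact rng_mem g⟩
  rw [this]
  exact isClosed_eq continuous_rng continuous_id

variable (G) in
theorem isClopen_units [T2Space G] : IsClopen (units : Set G) := ⟨isClosed_units G, isOpen_units G⟩

variable (G) in
theorem isCompact_units [CompactSpace (units : Set G)] : IsCompact (units : Set G) :=
  isCompact_iff_compactSpace.2 inferInstance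

theorem isOpenMap_rng : IsOpenMap (rng : G → G) := by
  have h := (isOpen_units G).isOpenMap_subtype_val.comp (isLocalHomeomorph_rng (G := G)).isOpenMap
  exact h

theorem isOpenMap_src : IsOpenMap (src : G → G) := by
  have h := (isOpen_units G).isOpenMap_subtype_val.comp (isLocalHomeomorph_src (G := G)).isOpenMap
  exact h

theorem isClopen_image_rng [T2Space G] {D : Set G} (hc : IsCompact D) (ho : IsOpen D) :
    IsClopen (rng '' D) :=
  ⟨(hc.image continuous_rng).isClosed, isOpenMap_rng D ho⟩

theorem isClopen_image_src [T2Space G] {D : Set G} (hc : IsCompact D) (ho : IsOpen D) :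
    IsClopen (src '' D) :=
  ⟨(hc.image continuous_src).isClosed, isOpenMap_src D ho⟩

theorem isCompact_image_inver {D : Set G} (hc : IsCompact D) : IsCompact (inver ⁻¹' D : Set G) := by
  have : (inver ⁻¹' D : Set G) = inver '' D := by
    ext g
    exact ⟨fun h => ⟨inver g, h, inver_inver g⟩, by rintro ⟨k, hk, rfl⟩; simpa [inver_inver] using hk⟩
  rw [this]
  exact hc.image continuous_inver

theorem isCompact_setComp [T2Space G] {C D : Set G} (hC : IsCompact C) (hD : IsCompact D) :
    IsCompact (setComp C D) := by
  have h1 : IsCompact ((C ×ˢ D) ∩ {p : G × G | src p.1 = rng p.2}) :=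
    (hC.prod hD).inter_right
      (isClosed_eq (continuous_src.comp continuous_fst) (continuous_rng.comp continuous_snd))
  have : setComp C D =
      (fun p : G × G => comp p.1 p.2) '' ((C ×ˢ D) ∩ {p : G × G | src p.1 = rng p.2}) := by
    ext x
    constructor
    · rintro ⟨v, hv, w, hw, e, rfl⟩
      exact ⟨(v, w), ⟨⟨hv, hw⟩, e⟩, rfl⟩
    · rintro ⟨⟨v, w⟩, ⟨⟨hv, hw⟩, e⟩, rfl⟩
      exact ⟨v, hv, w, hw, e, rfl⟩
  rw [this]
  exact h1.image_of_continuousOn (continuousOn_comp.mono inter_subset_right)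

theorem exists_encard_src_le {C : Set G} (hC : IsCompact C) :
    ∃ N : ℕ, ∀ y, {g ∈ C | src g = y}.encard ≤ N :=
  exists_card_le _ exists_mem_nhds_injOn_src hC

theorem exists_encard_rng_le {C : Set G} (hC : IsCompact C) :
    ∃ N : ℕ, ∀ y, {g ∈ C | rng g = y}.encard ≤ N :=
  exists_card_le _ exists_mem_nhds_injOn_rng hC

theorem finite_src_fiber {C : Set G} (hC : IsCompact C) (y : G) : {g ∈ C | src g = y}.Finite := by
  obtain ⟨N, hN⟩ := exists_encard_src_le hC
  exact finite_of_encard_le_coe (hN y)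

variable (G) in
/-- The compact open `G`-sets cover `G`. -/
def HasCompactOpenCover : Prop :=
  ∀ g : G, ∃ V : Set G, IsCompact V ∧ IsOpen V ∧ IsGSet V ∧ g ∈ V

theorem HasCompactOpenCover.exists_compact_open (hcov : HasCompactOpenCover G) {C : Set G}
    (hC : IsCompact C) : ∃ D : Set G, IsCompact D ∧ IsOpen D ∧ C ⊆ D ∧ inver ⁻¹' D = D := by
  choose V hVc hVo _ hV using hcov
  obtain ⟨t, -, ht⟩ := hC.elim_nhds_subcover V fun g _ => (hVo g).mem_nhds (hV g)
  have h1 : IsCompact (⋃ x ∈ t, V x) := t.isCompact_biUnion fun x _ => hVc x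
  have h2 : IsOpen (⋃ x ∈ t, V x) := isOpen_biUnion fun x _ => hVo x
  refine ⟨(⋃ x ∈ t, V x) ∪ inver ⁻¹' (⋃ x ∈ t, V x), h1.union (isCompact_image_inver h1),
    h2.union (h2.preimage continuous_inver), fun g hg => Or.inl (ht hg), ?_⟩
  ext g
  simp only [mem_preimage, mem_union, inver_inver]
  exact or_comm

/-- A bisection has a continuous section of the range map. -/
theorem tendsto_section_rng {V : Set G} (ho : IsOpen V) (hinj : InjOn rng V) {σ : G → G} {x : G}
    (hσ : ∀ᶠ y in 𝓝 x, σ y ∈ V ∧ rng (σ y) = rng y) : Tendsto σ (𝓝 x) (𝓝 (σ x)) := by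
  have hx := hσ.self_of_nhds
  intro N hN
  have h1 : rng '' (interior N ∩ V) ∈ 𝓝 (rng x) := by
    refine (isOpenMap_rng _ (isOpen_interior.inter ho)).mem_nhds ?_
    exact ⟨σ x, ⟨mem_interior_iff_mem_nhds.2 hN, hx.1⟩, hx.2⟩
  have h2 : rng ⁻¹' (rng '' (interior N ∩ V)) ∈ 𝓝 x := continuous_rng.continuousAt (x := x) h1
  rw [mem_map]
  filter_upwards [hσ, h2] with y hy hy2
  obtain ⟨v, ⟨hv, hvV⟩, e⟩ := hy2
  have : σ y = v := hinj hy.1 hvV (hy.2.trans e.symm)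
  rw [mem_preimage, this]
  exact interior_subset hv

end Topological

/-! ### Convolution and involution on compactly supported functions. -/

section Convolution

variable {G : Type*} [TopologicalSpace G] [EtaleGroupoid G]

/-- The convolution `(f * g)(x) = ∑ₖ f(x k⁻¹) g(k)` of two functions. -/
noncomputable def convFun (f g : G → ℂ) (x : G) : ℂ := ∑' k, convKernel f x k * g k

theorem convKernel_ne_zero {f : G → ℂ} {x k : G} (h : convKernel f x k ≠ 0) :
    src x = src k ∧ f (comp x (inver k)) ≠ 0 := by
  unfold convKernel at h
  split_ifs at h with hs
  · exact ⟨hs, h⟩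
  · exact absurd rfl h

theorem convKernel_of_eq {f : G → ℂ} {x k : G} (h : src x = src k) :
    convKernel f x k = f (comp x (inver k)) := if_pos h

theorem convKernel_of_ne {f : G → ℂ} {x k : G} (h : src x ≠ src k) :
    convKernel f x k = 0 := if_neg h

theorem convKernel_self (f : G → ℂ) (x : G) : convKernel f x x = f (rng x) := by
  rw [convKernel_of_eq rfl, mul_inver]

theorem convKernel_add (f g : C_c(G, ℂ)) (x k : G) :
    convKernel (f + g : C_c(G, ℂ)) x k = convKernel f x k + convKernel g x k := by
  unfold convKernel
  split_ifs <;> simp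

theorem summable_convKernel (f : C_c(G, ℂ)) (g : G → ℂ) (x : G) :
    Summable fun k => convKernel f x k * g k := by
  obtain ⟨M, N, h⟩ := exists_isBandMatrix f
  exact h.summable g x

theorem finite_support_convKernel (f : C_c(G, ℂ)) (x : G) :
    {k | convKernel f x k ≠ 0}.Finite := by
  obtain ⟨M, N, h⟩ := exists_isBandMatrix f
  exact h.row_finite x

theorem convFun_add (f f' : C_c(G, ℂ)) (g : G → ℂ) (x : G) :
    convFun (f + f' : C_c(G, ℂ)) g x = convFun f g x + convFun f' g x := by
  unfold convFun
  rw [← (summable_convKernel f g x).tsum_add (summable_convKernel f' g x)]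
  exact tsum_congr fun k => by rw [convKernel_add, add_mul]

theorem exists_of_convFun_ne_zero {f g : G → ℂ} {x : G} (h : convFun f g x ≠ 0) :
    ∃ k, src x = src k ∧ f (comp x (inver k)) ≠ 0 ∧ g k ≠ 0 := by
  by_contra! hn
  refine h ?_
  unfold convFun
  rw [← tsum_zero]
  refine tsum_congr fun k => ?_
  by_contra hk
  obtain ⟨h1, h2⟩ := convKernel_ne_zero (left_ne_zero_of_mul hk)
  exact (right_ne_zero_of_mul hk) (hn k h1 h2)

/-- Over r(x) only the arrow v of V contributes, so the convolution sum has the single term k =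
v⁻¹x. -/
theorem convFun_of_mem {f g : G → ℂ} {V : Set G} (hV : InjOn rng V) (hf : ∀ x ∉ V, f x = 0)
    {x v : G} (hv : v ∈ V) (e : rng v = rng x) :
    convFun f g x = f v * g (comp (inver v) x) := by
  have e1 : src (inver v) = rng x := by rw [src_inver, e]
  have e2 : src (comp (inver v) x) = src x := src_comp _ _ e1
  have e3 : comp x (inver (comp (inver v) x)) = v := by
    rw [inver_comp e1, inver_inver, ← assoc _ _ _ (by rw [rng_inver]) (by rw [src_inver, e]),
      mul_inver, ← e, rng_mul_self]
  unfold convFun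
  rw [tsum_eq_single (comp (inver v) x), convKernel_of_eq e2.symm, e3]
  intro k hk
  by_contra hne
  obtain ⟨h1, h2⟩ := convKernel_ne_zero (left_ne_zero_of_mul hne)
  have h3 : comp x (inver k) ∈ V := by
    by_contra hn
    exact h2 (hf _ hn)
  have h4 : comp x (inver k) = v := hV h3 hv (by rw [rng_div h1, e])
  refine hk (comp_inver_right_inj h1 e2.symm (h4.trans e3.symm))

theorem convFun_of_notMem {f g : G → ℂ} {V : Set G} (hf : ∀ x ∉ V, f x = 0)
    {x : G} (hx : rng x ∉ rng '' V) : convFun f g x = 0 := by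
  by_contra h
  obtain ⟨k, h1, h2, -⟩ := exists_of_convFun_ne_zero h
  refine hx ⟨comp x (inver k), ?_, rng_div h1⟩
  by_contra hn
  exact h2 (hf _ hn)

/-- The restriction of a compactly supported function to a clopen set. -/
noncomputable def restrictClopen (f : C_c(G, ℂ)) {D : Set G} (hD : IsClopen D) : C_c(G, ℂ) where
  toFun := D.indicator f
  continuous_toFun := f.continuous.indicator (by simp [hD.frontier_eq])
  hasCompactSupport' := f.hasCompactSupport.mono fun x hx => by
    simp only [Function.mem_support, indicator_apply_ne_zero] at hx ⊢
    exact hx.2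

/-- The support is covered by finitely many compact open bisections, and these are clopen, so a
function can be cut along them one at a time without a partition of unity. -/
theorem compactlySupported_induction [T2Space G] (hcov : HasCompactOpenCover G)
    {P : C_c(G, ℂ) → Prop}
    (h0 : P 0) (hadd : ∀ f g, P f → P g → P (f + g))
    (hb : ∀ (f : C_c(G, ℂ)) (V : Set G), IsCompact V → IsOpen V → IsGSet V →
      (∀ g ∉ V, f g = 0) → P f) (f : C_c(G, ℂ)) : P f := by
  classical
  choose V hVc hVo hVg hV using hcov
  obtain ⟨t, -, ht⟩ := f.hasCompactSupport.isCompact.elim_nhds_subcover V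
    fun g _ => (hVo g).mem_nhds (hV g)
  have ht' : ∀ g ∉ ⋃ x ∈ t, V x, f g = 0 := fun g hg => by
    by_contra hne
    exact hg (ht (subset_tsupport _ hne))
  clear ht
  induction t using Finset.induction_on generalizing f with
  | empty =>
    have : f = 0 := by ext g; exact ht' g (by simp)
    rw [this]; exact h0
  | insert a t _ ih =>
    have hcl : IsClopen (V a) := ⟨(hVc a).isClosed, hVo a⟩
    have : f = restrictClopen f hcl + restrictClopen f hcl.compl := by
      ext g
      exact (congrFun (indicator_self_add_compl (V a) (f : G → ℂ)) g).symm
    rw [this]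
    refine hadd _ _ (hb _ (V a) (hVc a) (hVo a) (hVg a) fun g hg => indicator_of_notMem hg _) ?_
    refine ih _ fun g hg => ?_
    show (V a)ᶜ.indicator f g = 0
    by_cases h : g ∈ V a
    · exact indicator_of_notMem (by simpa using h) _
    · rw [indicator_of_mem h]
      refine ht' g ?_
      simp only [Finset.mem_insert, iUnion_iUnion_eq_or_left, mem_union, not_or]
      exact ⟨h, hg⟩

/-- For f on a bisection the convolution is f(σ(y)) g(σ(y)⁻¹y) with σ a continuous local section of
the range map. The second factor is only assumed continuous: with g = 1 this later shows that
counting functions are continuous. -/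
theorem continuous_convFun [T2Space G] (hcov : HasCompactOpenCover G) (f : C_c(G, ℂ)) {g : G → ℂ}
    (hg : Continuous g) : Continuous (convFun f g) := by
  classical
  refine compactlySupported_induction hcov (P := fun f => Continuous (convFun f g)) ?_ ?_ ?_ f
  · refine (continuous_const (y := (0 : ℂ))).congr fun x => ?_
    exact (convFun_of_notMem (V := ∅) (fun _ _ => rfl) (by simp)).symm
  · intro f f' h h'
    exact (h.add h').congr fun x => (convFun_add f f' g x).symm
  · intro f V hc ho hG hf
    have hcl : IsClopen (rng ⁻¹' (rng '' V) : Set G) :=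
      (isClopen_image_rng hc ho).preimage continuous_rng
    rw [continuous_iff_continuousAt]
    intro x
    by_cases hx : rng x ∈ rng '' V
    · have hx' : ∀ᶠ y in 𝓝 x, rng y ∈ rng '' V := hcl.isOpen.mem_nhds hx
      choose! σ hσ using fun (y : G) (hy : rng y ∈ rng '' V) => hy
      have hσ' : ∀ᶠ y in 𝓝 x, σ y ∈ V ∧ rng (σ y) = rng y := hx'.mono hσ
      have hlim := tendsto_section_rng ho hG.1 hσ'
      have h1 : ContinuousAt (fun y => f (σ y)) x := f.continuous.continuousAt.tendsto.comp hlim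
      have h2 : ContinuousAt (fun y => comp (inver (σ y)) y) x := by
        have h3 : Tendsto (fun y => (inver (σ y), y)) (𝓝 x) (𝓝[{p : G × G | src p.1 = rng p.2}]
            (inver (σ x), x)) := by
          refine tendsto_nhdsWithin_iff.2 ⟨?_, hσ'.mono fun y hy => ?_⟩
          · exact ((continuous_inver.tendsto _).comp hlim).prodMk_nhds tendsto_id
          · show src (inver (σ y)) = rng y
            rw [src_inver, hy.2]
        exact (continuousOn_comp (G := G) (inver (σ x), x)
          (show src (inver (σ x)) = rng x by rw [src_inver, (hσ x hx).2])).tendsto.comp h3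
      have h4 : ContinuousAt (fun y => f (σ y) * g (comp (inver (σ y)) y)) x :=
        h1.mul (hg.continuousAt.comp_of_eq h2 rfl)
      refine h4.congr (hσ'.mono fun y hy => ?_)
      exact (convFun_of_mem hG.1 hf hy.1 hy.2).symm
    · refine (continuousAt_const (y := (0 : ℂ))).congr ?_
      filter_upwards [hcl.compl.isOpen.mem_nhds hx] with y hy
      exact (convFun_of_notMem hf hy).symm

theorem tsupport_convFun_subset [T2Space G] (f g : C_c(G, ℂ)) :
    HasCompactSupport (convFun (f : G → ℂ) g) := by
  refine HasCompactSupport.intro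
    (isCompact_setComp f.hasCompactSupport.isCompact g.hasCompactSupport.isCompact) fun x hx => ?_
  by_contra h
  obtain ⟨k, h1, h2, h3⟩ := exists_of_convFun_ne_zero h
  exact hx ⟨_, subset_tsupport _ h2, k, subset_tsupport _ h3, src_div h1, comp_inver_comp_cancel h1⟩

/-- The convolution product of `C_c(G)`. -/
noncomputable def conv [T2Space G] (hcov : HasCompactOpenCover G) (f g : C_c(G, ℂ)) : C_c(G, ℂ) where
  toFun := convFun f g
  continuous_toFun := continuous_convFun hcov f g.continuous
  hasCompactSupport' := tsupport_convFun_subset f g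

theorem conv_apply [T2Space G] (hcov : HasCompactOpenCover G) (f g : C_c(G, ℂ)) (x : G) :
    conv hcov f g x = ∑' k, convKernel f x k * g k := rfl

/-- The involution `f*(g) = conj f(g⁻¹)` of `C_c(G)`. -/
noncomputable def adj (f : C_c(G, ℂ)) : C_c(G, ℂ) where
  toFun := fun g => star (f (inver g))
  continuous_toFun := continuous_star.comp (f.continuous.comp continuous_inver)
  hasCompactSupport' := by
    refine HasCompactSupport.intro' (isCompact_image_inver f.hasCompactSupport.isCompact)
      ((isClosed_tsupport _).preimage continuous_inver) fun x hx => ?_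
    rw [image_eq_zero_of_notMem_tsupport hx, star_zero]

theorem adj_apply (f : C_c(G, ℂ)) (g : G) : adj f g = star (f (inver g)) := rfl

theorem convKernel_adj (f : C_c(G, ℂ)) (g k : G) :
    convKernel (adj f) g k = star (convKernel f k g) := by
  unfold convKernel
  by_cases h : src g = src k
  · rw [if_pos h, if_pos h.symm, adj_apply, inver_div h]
  · rw [if_neg h, if_neg (Ne.symm h), star_zero]

/-- The substitution m = l k⁻¹ turns the matrix product into the convolution sum at x k⁻¹; this
makes the regular representation multiplicative. -/
theorem tsum_convKernel_mul_convKernel (f g : C_c(G, ℂ)) (x k : G) :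
    ∑' l, convKernel f x l * convKernel g l k = convKernel (convFun f g) x k := by
  by_cases hs : src x = src k
  · rw [convKernel_of_eq hs]
    unfold convFun
    symm
    have hi : ∀ l : Function.support fun l => convKernel f x l * convKernel g l k,
        src (l : G) = src k := fun l => (convKernel_ne_zero (right_ne_zero_of_mul l.2)).1
    refine tsum_eq_tsum_of_ne_zero_bij (fun l => comp (l : G) (inver k)) ?_ ?_ ?_
    · intro l l' e
      exact Subtype.ext (comp_inver_left_inj (hi l) (hi l') e)
    · intro m hm
      obtain ⟨h1, h2⟩ := convKernel_ne_zero (left_ne_zero_of_mul hm)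
      have h3 : src m = rng k := by rw [← h1, src_div hs]
      have h4 : src (comp m k) = src k := src_comp _ _ h3
      have h5 : comp (comp m k) (inver k) = m := comp_inver_cancel h3
      refine ⟨⟨comp m k, ?_⟩, h5⟩
      have h6 : comp (comp x (inver k)) (inver m) = comp x (inver (comp m k)) := by
        rw [← div_div_cancel (g := x) (k := comp m k) (l := k) (hs.trans h4.symm) h4, h5]
      rw [Function.mem_support, convKernel_of_eq (hs.trans h4.symm), convKernel_of_eq h4, h5,
        ← h6, ← convKernel_of_eq (f := f) h1]
      exact hm
    · intro l
      rw [convKernel_of_eq (hs.trans (hi l).symm), convKernel_of_eq (hi l), convKernel_of_eq,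
        div_div_cancel (hs.trans (hi l).symm) (hi l)]
      rw [src_div hs, src_div (hi l)]
  · rw [convKernel_of_ne hs, ← tsum_zero]
    refine tsum_congr fun l => ?_
    by_contra h
    exact hs ((convKernel_ne_zero (left_ne_zero_of_mul h)).1.trans
      (convKernel_ne_zero (right_ne_zero_of_mul h)).1)

end Convolution

/-! ### Indicators of compact open sets. -/

section Indicator

variable {X : Type*} [TopologicalSpace X]

/-- The indicator function of a compact open set. -/
noncomputable def indicatorCc {D : Set X} (ho : IsClopen D) (hc : IsCompact D) : C_c(X, ℂ) where
  toFun := D.indicator 1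
  continuous_toFun := continuous_one.indicator (by simp [ho.frontier_eq])
  hasCompactSupport' := HasCompactSupport.intro' hc ho.isClosed fun _ hx => indicator_of_notMem hx _

theorem indicatorCc_apply {D : Set X} (ho : IsClopen D) (hc : IsCompact D) (g : X) :
    indicatorCc ho hc g = D.indicator 1 g := rfl

end Indicator

/-! ### Matrix entries of operators on ℓ². -/

section Operators

variable {X : Type*}

open Classical in
/-- The standard basis vectors of `ℓ²(X)`. -/
noncomputable def delta (x : X) : Ell2 X := lp.single 2 x 1

theorem norm_delta (x : X) : ‖delta x‖ = 1 := by
  classical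
  unfold delta
  rw [lp.norm_single (by norm_num)]
  exact norm_one

theorem inner_delta_left (x : X) (ξ : Ell2 X) : inner ℂ (delta x) ξ = ξ x := by
  classical
  unfold delta
  rw [lp.inner_single_left]
  simp

theorem delta_apply_self (x : X) : delta x x = 1 := by
  classical
  exact lp.single_apply_self 2 x 1

theorem delta_apply_ne {x y : X} (h : y ≠ x) : delta x y = 0 := by
  classical
  exact lp.single_apply_ne 2 x 1 h

theorem hasSum_delta (ξ : Ell2 X) : HasSum (fun x => ξ x • delta x) ξ := by
  classical
  have := lp.hasSum_single (p := 2) (by norm_num) ξ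
  convert this using 2 with x
  unfold delta
  rw [← lp.single_smul]
  simp

theorem ext_delta {S T : Ell2 X →L[ℂ] Ell2 X} (h : ∀ x, S (delta x) = T (delta x)) : S = T := by
  ext1 ξ
  have h1 := (hasSum_delta ξ).mapL S
  have h2 := (hasSum_delta ξ).mapL T
  simp only [map_smul, h] at h1 h2
  exact h1.unique h2

theorem ext_entries {S T : Ell2 X →L[ℂ] Ell2 X} (h : ∀ x y, S (delta x) y = T (delta x) y) :
    S = T :=
  ext_delta fun x => by ext y; exact h x y

theorem adjoint_delta_apply (T : Ell2 X →L[ℂ] Ell2 X) (x y : X) :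
    (star T) (delta x) y = star (T (delta y) x) := by
  rw [← inner_delta_left, ContinuousLinearMap.star_eq_adjoint,
    ContinuousLinearMap.adjoint_inner_right, ← inner_conj_symm, inner_delta_left]
  rfl

theorem sum_norm_sq_le (ξ : Ell2 X) (s : Finset X) : ∑ x ∈ s, ‖ξ x‖ ^ 2 ≤ ‖ξ‖ ^ 2 := by
  have := lp.sum_rpow_le_norm_rpow (p := 2) (by norm_num) ξ s
  simpa using this

theorem norm_sq_eq_sum (ξ : Ell2 X) (s : Finset X) (h : ∀ x ∉ s, ξ x = 0) :
    ‖ξ‖ ^ 2 = ∑ x ∈ s, ‖ξ x‖ ^ 2 := by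
  have := lp.hasSum_norm (p := 2) (by norm_num) ξ
  have h2 : HasSum (fun x => ‖ξ x‖ ^ (2 : ENNReal).toReal)
      (∑ x ∈ s, ‖ξ x‖ ^ (2 : ENNReal).toReal) :=
    hasSum_sum_of_ne_finset_zero fun x hx => by rw [h x hx]; simp
  simpa using this.unique h2

theorem norm_apply_le (ξ : Ell2 X) (x : X) : ‖ξ x‖ ≤ ‖ξ‖ := by
  rw [← inner_delta_left]
  simpa [norm_delta] using norm_inner_le_norm (𝕜 := ℂ) (delta x) ξ

end Operators

/-! ### The regular representation, and functions on the unit space as multiplication operators. -/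

section Representation

variable {G : Type*} [TopologicalSpace G] [EtaleGroupoid G]

theorem regularRep_delta (f : C_c(G, ℂ)) (k g : G) :
    regularRep f (delta k) g = convKernel f g k := by
  rw [regularRep_apply, tsum_eq_single k, delta_apply_self, mul_one]
  intro l hl
  rw [delta_apply_ne hl, mul_zero]

theorem regularRep_add (f g : C_c(G, ℂ)) : regularRep (f + g) = regularRep f + regularRep g := by
  refine ext_entries fun k x => ?_
  rw [regularRep_delta, convKernel_add, add_apply, lp.coeFn_add, Pi.add_apply,
    regularRep_delta, regularRep_delta]

theorem regularRep_conv [T2Space G] (hcov : HasCompactOpenCover G) (f g : C_c(G, ℂ)) :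
    regularRep (conv hcov f g) = regularRep f * regularRep g := by
  refine ext_entries fun k x => ?_
  rw [regularRep_delta, mul_apply_eq_comp, regularRep_apply]
  simp only [regularRep_delta]
  exact (tsum_convKernel_mul_convKernel f g x k).symm

theorem regularRep_adj (f : C_c(G, ℂ)) : regularRep (adj f) = star (regularRep f) := by
  refine ext_entries fun k x => ?_
  rw [regularRep_delta, adjoint_delta_apply, regularRep_delta, convKernel_adj]

theorem regularRep_mem (f : C_c(G, ℂ)) : regularRep f ∈ reducedCStarAlgebra G :=
  StarSubalgebra.le_topologicalClosure _ (StarAlgebra.subset_adjoin ℂ _ ⟨f, rfl⟩)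

/-- The left regular representation, as a map into the reduced C⋆-algebra. -/
noncomputable def lam (f : C_c(G, ℂ)) : reducedCStarAlgebra G := ⟨regularRep f, regularRep_mem f⟩

theorem coe_lam (f : C_c(G, ℂ)) : (lam f : Ell2 G →L[ℂ] Ell2 G) = regularRep f := rfl

theorem lam_conv [T2Space G] (hcov : HasCompactOpenCover G) (f g : C_c(G, ℂ)) :
    lam (conv hcov f g) = lam f * lam g := Subtype.ext (regularRep_conv hcov f g)

theorem lam_adj (f : C_c(G, ℂ)) : lam (adj f) = star (lam f) := Subtype.ext (regularRep_adj f)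

/-- The range of an arrow, as an element of the unit space. -/
def unitRng (g : G) : (units : Set G) := ⟨rng g, rng_mem g⟩

/-- The source of an arrow, as an element of the unit space. -/
def unitSrc (g : G) : (units : Set G) := ⟨src g, src_mem g⟩

theorem continuous_unitRng : Continuous (unitRng : G → (units : Set G)) :=
  continuous_rng.subtype_mk _

theorem continuous_unitSrc : Continuous (unitSrc : G → (units : Set G)) :=
  continuous_src.subtype_mk _

/-- A function on the unit space, extended by zero. -/
noncomputable def ofUnits [T2Space G] [CompactSpace (units : Set G)] (φ : C((units : Set G), ℂ)) :
    C_c(G, ℂ) where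
  toFun := (units : Set G).indicator fun g => φ (unitRng g)
  continuous_toFun := (φ.continuous.comp continuous_unitRng).indicator
    (by simp [(isClopen_units G).frontier_eq])
  hasCompactSupport' := HasCompactSupport.intro' (isCompact_units G) (isClosed_units G)
    fun _ hx => indicator_of_notMem hx _

theorem ofUnits_apply [T2Space G] [CompactSpace (units : Set G)] (φ : C((units : Set G), ℂ))
    (g : G) : ofUnits φ g = (units : Set G).indicator (fun g => φ (unitRng g)) g := rfl

/-- The function `φ(r(g)) f(g) ψ(s(g))`. -/
noncomputable def cutoff (φ : C((units : Set G), ℂ)) (f : C_c(G, ℂ)) (ψ : C((units : Set G), ℂ)) :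
    C_c(G, ℂ) where
  toFun := fun g => φ (unitRng g) * f g * ψ (unitSrc g)
  continuous_toFun := ((φ.continuous.comp continuous_unitRng).mul f.continuous).mul
    (ψ.continuous.comp continuous_unitSrc)
  hasCompactSupport' := f.hasCompactSupport.mono fun x hx => by
    simp only [Function.mem_support] at hx ⊢
    exact right_ne_zero_of_mul (left_ne_zero_of_mul hx)

theorem cutoff_apply (φ : C((units : Set G), ℂ)) (f : C_c(G, ℂ)) (ψ : C((units : Set G), ℂ))
    (g : G) : cutoff φ f ψ g = φ (unitRng g) * f g * ψ (unitSrc g) := rfl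

theorem unitRng_div {g k : G} (e : src g = src k) : unitRng (comp g (inver k)) = unitRng g :=
  Subtype.ext (rng_div e)

theorem unitSrc_div {g k : G} (e : src g = src k) : unitSrc (comp g (inver k)) = unitRng k :=
  Subtype.ext (src_div e)

section Units

variable [T2Space G] [CompactSpace (units : Set G)]

theorem convKernel_ofUnits_self (φ : C((units : Set G), ℂ)) (x : G) :
    convKernel (ofUnits φ) x x = φ (unitRng x) := by
  rw [convKernel_self, ofUnits_apply, indicator_of_mem (rng_mem x)]
  congr 1
  exact Subtype.ext (rng_rng x)

theorem convKernel_ofUnits_ne (φ : C((units : Set G), ℂ)) {x k : G} (h : x ≠ k) :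
    convKernel (ofUnits φ) x k = 0 := by
  by_contra hne
  obtain ⟨h1, h2⟩ := convKernel_ne_zero hne
  refine h2 ?_
  rw [ofUnits_apply, indicator_of_notMem]
  rwa [div_mem_units_iff h1]

theorem regularRep_ofUnits_apply (φ : C((units : Set G), ℂ)) (ξ : Ell2 G) (x : G) :
    regularRep (ofUnits φ) ξ x = φ (unitRng x) * ξ x := by
  rw [regularRep_apply, tsum_eq_single x, convKernel_ofUnits_self]
  intro k hk
  rw [convKernel_ofUnits_ne φ hk.symm, zero_mul]

theorem regularRep_cutoff (φ : C((units : Set G), ℂ)) (f : C_c(G, ℂ)) (ψ : C((units : Set G), ℂ)) :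
    regularRep (cutoff φ f ψ) =
      regularRep (ofUnits φ) * regularRep f * regularRep (ofUnits ψ) := by
  refine ext_entries fun k x => ?_
  have h1 : regularRep (ofUnits ψ) (delta k) = ψ (unitRng k) • delta k := by
    ext l
    rw [regularRep_ofUnits_apply, lp.coeFn_smul, Pi.smul_apply, smul_eq_mul]
    by_cases h : l = k
    · rw [h]
    · rw [delta_apply_ne h, mul_zero, mul_zero]
  rw [mul_apply_eq_comp, mul_apply_eq_comp, h1, map_smul, map_smul,
    lp.coeFn_smul, Pi.smul_apply, regularRep_ofUnits_apply, regularRep_delta, regularRep_delta,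
    smul_eq_mul]
  by_cases hs : src x = src k
  · rw [convKernel_of_eq hs, convKernel_of_eq hs, cutoff_apply, unitRng_div hs, unitSrc_div hs]
    ring
  · rw [convKernel_of_ne hs, convKernel_of_ne hs, mul_zero, mul_zero]

variable (G) in
/-- Functions on the unit space act by multiplication operators. -/
noncomputable def unitRep : C((units : Set G), ℂ) →⋆ₐ[ℂ] reducedCStarAlgebra G where
  toFun φ := lam (ofUnits φ)
  map_one' := by
    refine Subtype.ext (ContinuousLinearMap.ext fun ξ => ?_)
    ext x
    exact (regularRep_ofUnits_apply _ _ _).trans (one_mul _)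
  map_mul' φ ψ := by
    refine Subtype.ext (ContinuousLinearMap.ext fun ξ => ?_)
    ext x
    change regularRep _ ξ x = regularRep _ (regularRep _ ξ) x
    rw [regularRep_ofUnits_apply, regularRep_ofUnits_apply, regularRep_ofUnits_apply,
      ContinuousMap.mul_apply, mul_assoc]
  map_zero' := by
    refine Subtype.ext (ContinuousLinearMap.ext fun ξ => ?_)
    ext x
    exact (regularRep_ofUnits_apply _ _ _).trans (zero_mul _)
  map_add' φ ψ := by
    refine Subtype.ext (ContinuousLinearMap.ext fun ξ => ?_)
    ext x
    change regularRep _ ξ x = (regularRep _ ξ + regularRep _ ξ : Ell2 G) x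
    rw [lp.coeFn_add, Pi.add_apply, regularRep_ofUnits_apply, regularRep_ofUnits_apply,
      regularRep_ofUnits_apply, ContinuousMap.add_apply, add_mul]
  commutes' c := by
    refine Subtype.ext (ContinuousLinearMap.ext fun ξ => ?_)
    ext x
    change regularRep _ ξ x = (c • ξ : Ell2 G) x
    rw [regularRep_ofUnits_apply]
    rfl
  map_star' φ := by
    rw [← lam_adj]
    congr 1
    ext g
    rw [adj_apply, ofUnits_apply, ofUnits_apply]
    by_cases h : g ∈ (units : Set G)
    · rw [inver_unit h, indicator_of_mem h, indicator_of_mem h]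
      rfl
    · rw [indicator_of_notMem h, indicator_of_notMem, star_zero]
      intro h'
      rw [← inver_inver g, inver_unit h'] at h
      exact h h'

theorem unitRep_apply (φ : C((units : Set G), ℂ)) : unitRep G φ = lam (ofUnits φ) := rfl

theorem norm_unitRep_le (φ : C((units : Set G), ℂ)) : ‖unitRep G φ‖ ≤ ‖φ‖ :=
  NonUnitalStarAlgHom.norm_apply_le _ φ

theorem lam_cutoff (φ : C((units : Set G), ℂ)) (f : C_c(G, ℂ)) (ψ : C((units : Set G), ℂ)) :
    lam (cutoff φ f ψ) = unitRep G φ * lam f * unitRep G ψ :=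
  Subtype.ext (regularRep_cutoff φ f ψ)

/-- The image of C_c(G) is already a unital ⋆-algebra, so adjoining adds nothing before the closure
is taken. -/
theorem exists_lam_near (hcov : HasCompactOpenCover G) (a : reducedCStarAlgebra G) {ε : ℝ}
    (hε : 0 < ε) : ∃ f : C_c(G, ℂ), ‖lam f - a‖ < ε := by
  have hsub : ∀ T ∈ StarAlgebra.adjoin ℂ (range (regularRep (G := G))),
      T ∈ range (regularRep (G := G)) := by
    intro T hT
    induction hT using StarAlgebra.adjoin_induction with
    | mem x hx => exact hx
    | algebraMap c =>
      refine ⟨ofUnits (algebraMap ℂ _ c), ?_⟩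
      exact congrArg Subtype.val ((unitRep G).commutes' c)
    | add x y _ _ hx hy =>
      obtain ⟨f, rfl⟩ := hx
      obtain ⟨g, rfl⟩ := hy
      exact ⟨f + g, regularRep_add f g⟩
    | mul x y _ _ hx hy =>
      obtain ⟨f, rfl⟩ := hx
      obtain ⟨g, rfl⟩ := hy
      exact ⟨conv hcov f g, regularRep_conv hcov f g⟩
    | star x _ hx =>
      obtain ⟨f, rfl⟩ := hx
      exact ⟨adj f, regularRep_adj f⟩
  have ha : (a : Ell2 G →L[ℂ] Ell2 G) ∈
      closure (StarAlgebra.adjoin ℂ (range (regularRep (G := G))) : Set (Ell2 G →L[ℂ] Ell2 G)) :=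
    a.2
  obtain ⟨T, hT, hd⟩ := Metric.mem_closure_iff.1 ha ε hε
  obtain ⟨f, rfl⟩ := hsub T hT
  refine ⟨f, ?_⟩
  rw [dist_eq_norm, ← norm_neg, neg_sub] at hd
  exact hd

end Units

end Representation

/-! ### Towers, minimality and counting in orbits. -/

section Towers

variable {G : Type*} [TopologicalSpace G] [EtaleGroupoid G]

/-- A compact open subgroupoid `K` with the same units, together with a locally constant function
of the range (the level in the towers of `K`) which separates the arrows of `K` with given
source. -/
structure IsTower (K : Set G) (lev : G → ℕ) : Prop where
  isOpen : IsOpen K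
  isCompact : IsCompact K
  comp_mem : ∀ g ∈ K, ∀ h ∈ K, src g = rng h → comp g h ∈ K
  inver_mem : ∀ g ∈ K, inver g ∈ K
  units_subset : units ⊆ K
  lev_loc : IsLocallyConstant lev
  lev_rng : ∀ g, lev (rng g) = lev g
  inj : ∀ g ∈ K, ∀ h ∈ K, src g = src h → lev g = lev h → g = h

/-- A compact set on which the range map is injective and whose range is open is itself open. -/
theorem isOpen_of_isOpen_image_rng [T2Space G] {V : Set G} (hc : IsCompact V) (hinj : InjOn rng V)
    (ho : IsOpen (rng '' V)) : IsOpen V := by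
  rw [isOpen_iff_mem_nhds]
  intro v hv
  obtain ⟨U, hU, hUinj⟩ := exists_mem_nhds_injOn_rng v
  -- The units whose unique preimage in V lies in the interior of U; near v, an arrow over such a
  -- unit coincides with that preimage.
  have h1 : IsOpen (rng '' V \ rng '' (V \ interior U)) :=
    ho.sdiff ((hc.diff isOpen_interior).image continuous_rng).isClosed
  have h2 : rng v ∈ rng '' V \ rng '' (V \ interior U) := by
    refine ⟨⟨v, hv, rfl⟩, ?_⟩
    rintro ⟨w, ⟨hw, hw'⟩, e⟩
    rw [hinj hw hv e] at hw'
    exact hw' (mem_interior_iff_mem_nhds.2 hU)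
  filter_upwards [hU, (h1.preimage continuous_rng).mem_nhds h2] with g hg hg'
  obtain ⟨⟨w, hw, e⟩, hn⟩ := hg'
  have hwU : w ∈ U := by
    by_contra h
    exact hn ⟨w, ⟨hw, fun h' => h (interior_subset h')⟩, e⟩
  rw [hUinj hg hwU e.symm]
  exact hw

theorem isOpen_of_isOpen_preimage_units {P : Set G} (hP : P ⊆ units)
    (h : IsOpen ((↑) ⁻¹' P : Set (units : Set G))) : IsOpen P := by
  have := (isOpen_units G).isOpenMap_subtype_val _ h
  rwa [Subtype.image_preimage_coe, inter_eq_right.2 hP] at this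

/-- The level of g is the index j of the set P i j containing r(g). The tower index i can be
forgotten, since arrows of K with the same source belong to the same tower. -/
theorem IsElementary.exists_isTower [T2Space G] {K : Set G} (hK : IsElementary K) :
    ∃ lev, IsTower K lev := by
  obtain ⟨⟨hmul, hinv⟩, hc, hu, F, n, N, hN, P, V, hP, hPd, hPu, -, hV, -, -, hKV⟩ := hK
  have hPo : ∀ i j, IsOpen (P i j) := fun i j =>
    isOpen_of_isOpen_preimage_units (hP i j).1 (hP i j).2.isOpen
  have hex : ∀ g : G, ∃ p : (i : Fin n) × Fin (N i), rng g ∈ P p.1 p.2 := fun g => by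
    have := rng_mem g
    rw [← hPu] at this
    obtain ⟨i, hi⟩ := mem_iUnion.1 this
    obtain ⟨j, hj⟩ := mem_iUnion.1 hi
    exact ⟨⟨i, j⟩, hj⟩
  choose p hp using hex
  have huniq : ∀ (g : G) (q : (i : Fin n) × Fin (N i)), rng g ∈ P q.1 q.2 → p g = q := by
    intro g q hq
    by_contra hne
    exact disjoint_left.1 (hPd _ _ hne) (hp g) hq
  have hploc : IsLocallyConstant p := by
    intro S
    have : p ⁻¹' S = ⋃ q ∈ S, rng ⁻¹' (P q.1 q.2) := by
      ext g
      simp only [mem_preimage, mem_iUnion, exists_prop]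
      exact ⟨fun h => ⟨p g, h, hp g⟩, fun ⟨q, hq, h⟩ => by rwa [huniq g q h]⟩
    rw [this]
    exact isOpen_biUnion fun q _ => (hPo q.1 q.2).preimage continuous_rng
  have hVo : ∀ i j k, IsOpen (V i j k) := fun i j k =>
    isOpen_of_isOpen_image_rng (hV i j k).1.2.1 (hV i j k).1.2.2.2.1
      (by rw [(hV i j k).2.1]; exact hPo i j)
  have hmem : ∀ g ∈ K, ∃ i j k, g ∈ V i j k ∧ p g = ⟨i, j⟩ ∧ p (src g) = ⟨i, k⟩ := by
    intro g hg
    rw [hKV] at hg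
    simp only [mem_iUnion] at hg
    obtain ⟨i, j, k, h⟩ := hg
    refine ⟨i, j, k, h, huniq g ⟨i, j⟩ ?_, huniq (src g) ⟨i, k⟩ ?_⟩
    · rw [← (hV i j k).2.1]
      exact ⟨g, h, rfl⟩
    · rw [rng_src, ← (hV i j k).2.2]
      exact ⟨g, h, rfl⟩
  refine ⟨fun g => ((p g).2 : ℕ), ⟨?_, hc, hmul, hinv, hu,
    hploc.comp (fun q : (i : Fin n) × Fin (N i) => (q.2 : ℕ)), ?_, ?_⟩⟩
  · rw [hKV]
    exact isOpen_iUnion fun i => isOpen_iUnion fun j => isOpen_iUnion fun k => hVo i j k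
  · intro g
    have : p (rng g) = p g := huniq (rng g) _ (by rw [rng_rng]; exact hp g)
    rw [this]
  · intro g hg h hh e el
    obtain ⟨i, j, k, h1, h2, h3⟩ := hmem g hg
    obtain ⟨i', j', k', h1', h2', h3'⟩ := hmem h hh
    rw [e, h3'] at h3
    obtain ⟨rfl, hk⟩ := Sigma.mk.inj_iff.1 h3
    obtain rfl := eq_of_heq hk
    rw [h2, h2'] at el
    have : j = j' := Fin.ext el
    subst this
    exact (hV _ _ _).1.2.2.2.2 h1 h1' e

/-- The arrows of `K` with source `x`. -/
def fib (K : Set G) (x : G) : Set G := {g ∈ K | src g = x}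

theorem finite_fib {K : Set G} (hK : IsCompact K) (x : G) : (fib K x).Finite :=
  finite_src_fiber hK x

theorem IsTower.div_mem {K : Set G} {lev : G → ℕ} (hK : IsTower K lev) {g k : G} (hg : g ∈ K)
    (hk : k ∈ K) (e : src g = src k) : comp g (inver k) ∈ K :=
  hK.comp_mem g hg _ (hK.inver_mem k hk) (by rw [rng_inver, e])

theorem IsTower.of_comp_mem {K : Set G} {lev : G → ℕ} (hK : IsTower K lev) {g k : G} (hk : k ∈ K)
    (e : src g = rng k) (h : comp g k ∈ K) : g ∈ K := by
  rw [← comp_inver_cancel e]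
  exact hK.comp_mem _ h _ (hK.inver_mem k hk) (by rw [src_comp _ _ e, rng_inver])

theorem IsTower.mem_units {K : Set G} {lev : G → ℕ} (hK : IsTower K lev) {g : G} (hg : g ∈ K)
    (h : lev g = lev (src g)) : g ∈ (units : Set G) := by
  rw [hK.inj g hg (src g) (hK.units_subset (src_mem g)) (by rw [src_src]) h]
  exact src_mem g

theorem IsTower.exists_lev_lt {K : Set G} {lev : G → ℕ} (hK : IsTower K lev) [T2Space G]
    [CompactSpace (units : Set G)] : ∃ L, 0 < L ∧ ∀ g, lev g < L := by
  obtain ⟨L, hL⟩ := ((isCompact_units G).image hK.lev_loc.continuous).bddAbove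
  refine ⟨L + 1, by omega, fun g => Nat.lt_succ_of_le ?_⟩
  rw [← hK.lev_rng]
  exact hL ⟨_, rng_mem g, rfl⟩

/-- The saturation r(s⁻¹(O)) is open, invariant and nonempty, hence everything by minimality;
compactness of the unit space reduces to finitely many compact open bisections. -/
theorem exists_compact_translate [T2Space G] [CompactSpace (units : Set G)]
    (hcov : HasCompactOpenCover G) (hmin : IsMinimal G) {O : Set G} (hO : IsOpen O)
    (hsub : O ⊆ units) (hne : O.Nonempty) :
    ∃ C : Set G, IsCompact C ∧ ∀ x ∈ (units : Set G), ∃ g ∈ C, src g = x ∧ rng g ∈ O := by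
  set U : Set G := rng '' (src ⁻¹' O) with hU
  have hUo : IsOpen U := isOpenMap_rng _ (hO.preimage continuous_src)
  have hUu : U ⊆ units := by rintro _ ⟨g, -, rfl⟩; exact rng_mem g
  have hinv : IsInvariant U := by
    ext x
    constructor
    · rintro ⟨_, ⟨v, -, _, ⟨g, hg, rfl⟩, e, rfl⟩, rfl⟩
      rw [rng_rng] at e
      refine ⟨comp v g, ?_, ?_⟩
      · rw [mem_preimage, src_comp _ _ e]
        exact hg
      · rw [rng_comp _ _ e, rng_comp _ _ (by rw [rng_rng]; exact e)]
    · rintro ⟨g, hg, rfl⟩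
      refine ⟨rng g, ⟨rng g, mem_univ _, rng g, ⟨g, hg, rfl⟩, by rw [rng_rng, src_rng], ?_⟩,
        rng_rng g⟩
      simpa only [rng_rng] using rng_mul_self (rng g)
  have hUe : U = units := by
    refine (hmin U hUu (hUo.preimage continuous_subtype_val) hinv).resolve_left ?_
    obtain ⟨x, hx⟩ := hne
    refine Set.Nonempty.ne_empty ⟨rng x, x, ?_, rfl⟩
    rw [mem_preimage, src_unit x (hsub hx)]
    exact hx
  have hex : ∀ x : G, ∃ V : Set G, IsCompact V ∧ IsOpen V ∧
      (x ∈ (units : Set G) → ∃ g ∈ V, src g = x ∧ rng g ∈ O) := by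
    intro x
    by_cases hx : x ∈ (units : Set G)
    · rw [← hUe] at hx
      obtain ⟨g, hg, rfl⟩ := hx
      obtain ⟨V, h1, h2, -, h3⟩ := hcov (inver g)
      exact ⟨V, h1, h2, fun _ => ⟨inver g, h3, src_inver g, by rw [rng_inver]; exact hg⟩⟩
    · exact ⟨∅, isCompact_empty, isOpen_empty, fun h => absurd h hx⟩
  choose V hVc hVo hV using hex
  obtain ⟨t, -, ht⟩ := (isCompact_units G).elim_nhds_subcover
    (fun x => src '' (V x ∩ rng ⁻¹' O) ∪ unitsᶜ) (fun x hx => by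
      obtain ⟨g, h1, h2, h3⟩ := hV x hx
      exact mem_of_superset ((isOpenMap_src _ ((hVo x).inter (hO.preimage continuous_rng))).mem_nhds
        ⟨g, ⟨h1, h3⟩, h2⟩) subset_union_left)
  refine ⟨⋃ x ∈ t, V x, t.isCompact_biUnion fun x _ => hVc x, fun x hx => ?_⟩
  obtain ⟨y, hy, h⟩ := mem_iUnion₂.1 (ht hx)
  rcases h with ⟨g, ⟨h1, h2⟩, h3⟩ | h
  · exact ⟨g, mem_iUnion₂.2 ⟨y, hy, h1⟩, h3, h2⟩
  · exact absurd hx h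

/-- The map k ↦ c(k)k is at most M-to-one: its value z fixes the range of c, which leaves M choices,
and z and c together determine k. -/
theorem ncard_le_of_translate {C S T : Set G} {M : ℕ} (hM : ∀ y, {c ∈ C | rng c = y}.encard ≤ M)
    (hS : S.Finite) (hT : T.Finite)
    (h : ∀ k ∈ S, ∃ c ∈ C, src c = rng k ∧ comp c k ∈ T) : S.ncard ≤ M * T.ncard := by
  classical
  choose! c hcC hce hcT using h
  rw [ncard_eq_toFinset_card S hS, ncard_eq_toFinset_card T hT]
  refine Finset.card_le_mul_card_image_of_maps_to (f := fun k => comp (c k) k) ?_ M ?_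
  · intro k hk
    rw [Finite.mem_toFinset] at hk ⊢
    exact hcT k hk
  · intro z _
    have h1 : ((hS.toFinset.filter fun k => comp (c k) k = z : Finset G) : Set G).encard ≤ M := by
      refine (encard_le_encard_of_injOn (f := c) (t := {x ∈ C | rng x = rng z}) ?_ ?_).trans (hM _)
      · intro k hk
        simp only [Finset.coe_filter, Finite.mem_toFinset, mem_ofPred_eq] at hk
        exact ⟨hcC k hk.1, by rw [← hk.2, rng_comp _ _ (hce k hk.1)]⟩
      · intro k hk l hl e
        simp only [Finset.coe_filter, Finite.mem_toFinset, mem_ofPred_eq] at hk hl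
        refine comp_left_cancel (hce k hk.1) (by rw [e]; exact hce l hl.1) ?_
        rw [hk.2, e, hl.2]
    rw [encard_coe_eq_coe_finsetCard] at h1
    exact_mod_cast h1

theorem fib_eq_setComp {K : Set G} {x : G} (hx : x ∈ (units : Set G)) :
    setComp K {x} = fib K x := by
  ext g
  exact mem_setComp_singleton hx

theorem IsTower.fib_pos {K : Set G} {lev : G → ℕ} (hK : IsTower K lev) {x : G}
    (hx : x ∈ (units : Set G)) : 0 < (fib K x).ncard :=
  (ncard_pos (finite_fib hK.isCompact x)).2 ⟨x, hK.units_subset hx, src_unit x hx⟩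

theorem finite_setComp_fib [T2Space G] {C K : Set G} (hC : IsCompact C) (hK : IsCompact K) (x : G) :
    (setComp C (fib K x)).Finite := by
  refine (finite_src_fiber (isCompact_setComp hC hK) x).subset ?_
  rintro _ ⟨c, hc, k, ⟨hk, hk'⟩, e, rfl⟩
  exact ⟨⟨c, hc, k, hk, e, rfl⟩, by rw [src_comp _ _ e, hk']⟩

theorem IsAlmostInvariant.ncard_lt [T2Space G] {C C₀ K : Set G} {ε : ℝ} {lev : G → ℕ}
    (hinv : IsAlmostInvariant C ε K) (hK : IsTower K lev) (hC : IsCompact C) (hsub : C₀ ⊆ C) {x : G}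
    (hx : x ∈ (units : Set G)) :
    ((setComp C₀ (fib K x) \ fib K x).ncard : ℝ) < ε * (fib K x).ncard := by
  have h := hinv x hx
  rw [fib_eq_setComp hx, div_lt_iff₀ (by exact_mod_cast hK.fib_pos hx)] at h
  refine lt_of_le_of_lt ?_ h
  have : (setComp C₀ (fib K x) \ fib K x).ncard ≤ (setComp C (fib K x) \ fib K x).ncard := by
    refine ncard_le_ncard ?_ ((finite_setComp_fib hC hK.isCompact x).subset sdiff_subset)
    refine sdiff_subset_sdiff_left ?_
    rintro _ ⟨c, hc, k, hk, e, rfl⟩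
    exact ⟨c, hsub hc, k, hk, e, rfl⟩
  exact_mod_cast this

/-- If c ∈ C₀ \ K starts at r(k), then ck is outside K and so belongs to the boundary of Kx; each
boundary point is hit at most M times. -/
theorem IsAlmostInvariant.bad_le [T2Space G] {C C₀ K : Set G} {ε : ℝ} {lev : G → ℕ} {M : ℕ}
    (hinv : IsAlmostInvariant C ε K) (hK : IsTower K lev) (hC : IsCompact C) (hsub : C₀ ⊆ C)
    (hM : ∀ y, {c ∈ C₀ | rng c = y}.encard ≤ M) {x : G} (hx : x ∈ (units : Set G)) :
    ({k ∈ fib K x | rng k ∈ src '' (C₀ \ K)}.ncard : ℝ) ≤ M * (ε * (fib K x).ncard) := by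
  have hfin := finite_fib hK.isCompact x
  have hfin2 : (setComp C₀ (fib K x) \ fib K x).Finite := by
    refine ((finite_setComp_fib hC hK.isCompact x).subset ?_).subset sdiff_subset
    rintro _ ⟨c, hc, k, hk, e, rfl⟩
    exact ⟨c, hsub hc, k, hk, e, rfl⟩
  have h1 := ncard_le_of_translate hM (hfin.subset (sep_subset _ _)) hfin2
    (S := {k ∈ fib K x | rng k ∈ src '' (C₀ \ K)}) (by
      rintro k ⟨hk, c, ⟨hc, hcK⟩, e⟩
      refine ⟨c, hc, e, ⟨c, hc, k, hk, e, rfl⟩, fun h => hcK ?_⟩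
      exact hK.of_comp_mem hk.1 e h.1)
  have h2 := (hinv.ncard_lt hK hC hsub hx).le
  calc ({k ∈ fib K x | rng k ∈ src '' (C₀ \ K)}.ncard : ℝ)
      ≤ M * ((setComp C₀ (fib K x) \ fib K x).ncard : ℝ) := by exact_mod_cast h1
    _ ≤ _ := by gcongr

/-- Push every point of Kx into O by an arrow of C₀: the result is either a point of Kx over O or a
boundary point. -/
theorem IsAlmostInvariant.le_good [T2Space G] {C C₀ K O : Set G} {ε : ℝ} {lev : G → ℕ} {M : ℕ}
    (hinv : IsAlmostInvariant C ε K) (hK : IsTower K lev) (hC : IsCompact C) (hsub : C₀ ⊆ C)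
    (hM : ∀ y, {c ∈ C₀ | rng c = y}.encard ≤ M)
    (hO : ∀ x ∈ (units : Set G), ∃ g ∈ C₀, src g = x ∧ rng g ∈ O) {x : G}
    (hx : x ∈ (units : Set G)) :
    ((fib K x).ncard : ℝ) ≤ M * ({k ∈ fib K x | rng k ∈ O}.ncard + ε * (fib K x).ncard) := by
  have hfin := finite_fib hK.isCompact x
  have hfin2 : (setComp C₀ (fib K x) \ fib K x).Finite := by
    refine ((finite_setComp_fib hC hK.isCompact x).subset ?_).subset sdiff_subset
    rintro _ ⟨c, hc, k, hk, e, rfl⟩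
    exact ⟨c, hsub hc, k, hk, e, rfl⟩
  have hfin3 : {k ∈ fib K x | rng k ∈ O}.Finite := hfin.subset (sep_subset _ _)
  have h1 := ncard_le_of_translate (S := fib K x)
    (T := {k ∈ fib K x | rng k ∈ O} ∪ (setComp C₀ (fib K x) \ fib K x)) hM hfin
    (hfin3.union hfin2) (by
      intro k hk
      obtain ⟨c, hc, e, hr⟩ := hO (rng k) (rng_mem k)
      refine ⟨c, hc, e, ?_⟩
      by_cases h : comp c k ∈ fib K x
      · exact Or.inl ⟨h, by rwa [rng_comp _ _ e]⟩
      · exact Or.inr ⟨⟨c, hc, k, hk, e, rfl⟩, h⟩)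
  have h2 := (hinv.ncard_lt hK hC hsub hx).le
  have h3 := ncard_union_le {k ∈ fib K x | rng k ∈ O} (setComp C₀ (fib K x) \ fib K x)
  calc ((fib K x).ncard : ℝ)
      ≤ M * (({k ∈ fib K x | rng k ∈ O} ∪ (setComp C₀ (fib K x) \ fib K x)).ncard : ℝ) := by
        exact_mod_cast h1
    _ ≤ M * ({k ∈ fib K x | rng k ∈ O}.ncard + (setComp C₀ (fib K x) \ fib K x).ncard) := by
        gcongr
        exact_mod_cast h3
    _ ≤ _ := by gcongr

/-- Disjoint neighbourhoods of m arrows starting at x give m distinct arrows over every unit near x.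
-/
theorem exists_compact_le_encard [T2Space G] [CompactSpace (units : Set G)]
    (hcov : HasCompactOpenCover G)
    (hinf : ∀ x ∈ (units : Set G), {g : G | src g = x}.Infinite) (m : ℕ) :
    ∃ C : Set G, IsCompact C ∧ ∀ x ∈ (units : Set G), (m : ℕ∞) ≤ (fib C x).encard := by
  have hex : ∀ x : G, ∃ V N : Set G, IsCompact V ∧ (x ∈ (units : Set G) → N ∈ 𝓝 x) ∧
      ∀ y ∈ N, (m : ℕ∞) ≤ (fib V y).encard := by
    intro x
    by_cases hx : x ∈ (units : Set G)
    swap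
    · exact ⟨∅, ∅, isCompact_empty, fun h => absurd h hx, fun _ h => h.elim⟩
    obtain ⟨t, ht, htm⟩ := (hinf x hx).exists_subset_card_eq m
    obtain ⟨U, hU, hUd⟩ := t.finite_toSet.t2_separation
    choose V hVc hVo hVg hV using hcov
    refine ⟨⋃ g ∈ t, V g, ⋂ g ∈ t, src '' (U g ∩ V g), t.isCompact_biUnion fun g _ => hVc g,
      fun _ => (biInter_finset_mem t).2 fun g hg => ?_, fun y hy => ?_⟩
    · exact (isOpenMap_src _ ((hU g).2.inter (hVo g))).mem_nhds ⟨g, ⟨(hU g).1, hV g⟩, ht hg⟩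
    · have hy' : ∀ g ∈ t, ∃ k ∈ U g ∩ V g, src k = y := fun g hg => mem_iInter₂.1 hy g hg
      choose! k hk hks using hy'
      have : (t : Set G).encard ≤ (fib (⋃ g ∈ t, V g) y).encard := by
        refine encard_le_encard_of_injOn (f := k) (fun g hg => ?_) fun g hg h hh e => ?_
        · exact ⟨mem_iUnion₂.2 ⟨g, hg, (hk g hg).2⟩, hks g hg⟩
        · by_contra hne
          have := hUd hg hh hne
          refine disjoint_left.1 this (hk g hg).1 ?_
          rw [e]
          exact (hk h hh).1
      rwa [encard_coe_eq_coe_finsetCard, htm] at this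
  choose V N hV hN hVN using hex
  obtain ⟨t, -, ht⟩ := (isCompact_units G).elim_nhds_subcover N hN
  refine ⟨⋃ x ∈ t, V x, t.isCompact_biUnion fun x _ => hV x, fun x hx => ?_⟩
  obtain ⟨y, hy, h⟩ := mem_iUnion₂.1 (ht hx)
  exact (hVN y x h).trans (encard_le_encard fun g hg => ⟨mem_iUnion₂.2 ⟨y, hy, hg.1⟩, hg.2⟩)

/-- An orbit with fewer than m points would have fewer than εm ≤ 1 boundary points, so none; as x ∈
Kx, it would then contain all of C₀x, which has at least m points. -/
theorem IsAlmostInvariant.le_ncard_fib [T2Space G] {C C₀ K : Set G} {ε : ℝ} {lev : G → ℕ} {m : ℕ}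
    (hinv : IsAlmostInvariant C ε K) (hK : IsTower K lev) (hC : IsCompact C) (hsub : C₀ ⊆ C)
    (hε : ε * m ≤ 1) (hε0 : 0 ≤ ε) {x : G} (hx : x ∈ (units : Set G))
    (hm : (m : ℕ∞) ≤ (fib C₀ x).encard) :
    m ≤ (fib K x).ncard := by
  by_contra! hlt
  have h1 := hinv.ncard_lt hK hC hsub hx
  have h2 : ((setComp C₀ (fib K x) \ fib K x).ncard : ℝ) < 1 := by
    refine h1.trans_le (le_trans ?_ hε)
    gcongr
  have hfin2 : (setComp C₀ (fib K x) \ fib K x).Finite := by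
    refine ((finite_setComp_fib hC hK.isCompact x).subset ?_).subset sdiff_subset
    rintro _ ⟨c, hc, k, hk, e, rfl⟩
    exact ⟨c, hsub hc, k, hk, e, rfl⟩
  have h3 : setComp C₀ (fib K x) \ fib K x = ∅ := by
    rw [← ncard_eq_zero hfin2]
    have : (setComp C₀ (fib K x) \ fib K x).ncard < 1 := by exact_mod_cast h2
    omega
  have h4 : fib C₀ x ⊆ fib K x := by
    intro c hc
    by_contra hn
    have : c ∈ setComp C₀ (fib K x) \ fib K x :=
      ⟨⟨c, hc.1, x, ⟨hK.units_subset hx, src_unit x hx⟩, by rw [hc.2, rng_unit x hx],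
        by rw [← hc.2, mul_src_self]⟩, hn⟩
    rw [h3] at this
    exact this
  have h5 := hm.trans (encard_le_encard h4)
  rw [← (finite_fib hK.isCompact x).cast_ncard_eq] at h5
  have : m ≤ (fib K x).ncard := by exact_mod_cast h5
  omega

theorem AlmostFinite.exists_isTower [T2Space G] (haf : AlmostFinite G) {C : Set G}
    (hC : IsCompact C) {ε : ℝ} (hε : 0 < ε) :
    ∃ K lev, IsTower K lev ∧ IsAlmostInvariant C ε K := by
  obtain ⟨K, hK, hinv⟩ := haf.2 C hC ε hε
  obtain ⟨lev, hlev⟩ := hK.exists_isTower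
  exact ⟨K, lev, hlev, hinv⟩

end Towers

/-! ### Invertible elements and approximate zero divisors in C⋆-algebras. -/

section Invertibles

theorem isUnit_one_add_mul_comm {R : Type*} [Ring R] {x y : R} (h : IsUnit (1 + x * y)) :
    IsUnit (1 + y * x) := by
  obtain ⟨u, hu⟩ := h
  have h1 : (1 + x * y) * (↑u⁻¹ : R) = 1 := by rw [← hu]; exact u.mul_inv
  have h2 : (↑u⁻¹ : R) * (1 + x * y) = 1 := by rw [← hu]; exact u.inv_mul
  refine ⟨⟨1 + y * x, 1 - y * (↑u⁻¹ : R) * x, ?_, ?_⟩, rfl⟩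
  · calc (1 + y * x) * (1 - y * (↑u⁻¹ : R) * x)
        = 1 + y * x - y * ((1 + x * y) * (↑u⁻¹ : R)) * x := by noncomm_ring
      _ = 1 := by rw [h1]; noncomm_ring
  · calc (1 - y * (↑u⁻¹ : R) * x) * (1 + y * x)
        = 1 + y * x - y * ((↑u⁻¹ : R) * (1 + x * y)) * x := by noncomm_ring
      _ = 1 := by rw [h2]; noncomm_ring

variable {A : Type*} [CStarAlgebra A]

theorem stableRank_eq_one (h : Dense {a : A | IsUnit a}) : stableRank A = 1 := by
  unfold stableRank
  refine le_antisymm (sInf_le ⟨1, rfl, le_rfl, ?_⟩) (le_sInf ?_)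
  · have h1 : Dense ((Homeomorph.funUnique (Fin 1) A) ⁻¹' {a : A | IsUnit a}) :=
      h.preimage (Homeomorph.funUnique (Fin 1) A).isOpenMap
    refine h1.mono fun a ha b => ?_
    obtain ⟨u, hu⟩ := (show IsUnit (a 0) from ha)
    refine ⟨fun _ => b * (↑u⁻¹ : A), ?_⟩
    simp [← hu, mul_assoc]
  · rintro _ ⟨n, rfl, hn, -⟩
    exact_mod_cast hn

theorem mem_closure_isUnit_of_mul {a u v : A} (hu : IsUnit u) (hv : IsUnit v)
    (h : u * a * v ∈ closure {x : A | IsUnit x}) : a ∈ closure {x : A | IsUnit x} := by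
  obtain ⟨u, rfl⟩ := hu
  obtain ⟨v, rfl⟩ := hv
  have hc : Continuous fun x : A => (↑u⁻¹ : A) * x * (↑v⁻¹ : A) := by fun_prop
  have := map_mem_closure hc h (t := {x : A | IsUnit x}) fun x (hx : IsUnit x) =>
    (u⁻¹.isUnit.mul hx).mul v⁻¹.isUnit
  simpa [mul_assoc] using this

/-- A nonzero scalar plus a nilpotent is invertible, and the factor w can be undone. -/
theorem mem_closure_isUnit_of_isNilpotent {a w : A} (hw : IsUnit w) (h : IsNilpotent (w * a)) :
    a ∈ closure {x : A | IsUnit x} := by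
  refine mem_closure_isUnit_of_mul hw isUnit_one ?_
  rw [mul_one]
  have hlim : Tendsto (fun t : ℂ => algebraMap ℂ A t + w * a) (𝓝[≠] 0) (𝓝 (w * a)) := by
    have hc : Continuous fun t : ℂ => algebraMap ℂ A t + w * a := by fun_prop
    have := (hc.tendsto 0).mono_left (nhdsWithin_le_nhds (s := {0}ᶜ))
    simpa using this
  refine mem_closure_of_tendsto hlim ?_
  filter_upwards [self_mem_nhdsWithin] with t ht
  have h1 : IsUnit (algebraMap ℂ A t) := (IsUnit.mk0 t ht).map (algebraMap ℂ A)
  exact h.isUnit_add_left_of_commute h1 (Algebra.commutes t (w * a)).symm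

theorem dense_isUnit_of_finiteDimensional [FiniteDimensional ℂ A] :
    Dense {a : A | IsUnit a} := by
  intro a
  have hlim : Tendsto (fun t : ℂ => a - algebraMap ℂ A t) (𝓝[≠] 0) (𝓝 a) := by
    have hc : Continuous fun t : ℂ => a - algebraMap ℂ A t := by fun_prop
    have := (hc.tendsto 0).mono_left (nhdsWithin_le_nhds (s := {0}ᶜ))
    simpa using this
  refine mem_closure_of_tendsto hlim ?_
  have hfin : (spectrum ℂ a).Finite := by
    cases subsingleton_or_nontrivial A
    · rw [spectrum.of_subsingleton]; exact finite_empty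
    · refine ((minpoly ℂ a).roots.toFinset.finite_toSet).subset fun t ht => ?_
      have h := spectrum.subset_polynomial_aeval a (minpoly ℂ a) ⟨t, ht, rfl⟩
      rw [minpoly.aeval, spectrum.zero_eq, mem_singleton_iff] at h
      simpa [minpoly.ne_zero (Algebra.IsIntegral.isIntegral a)] using h
  have h2 : ∀ᶠ t in 𝓝[≠] (0 : ℂ), t ∉ spectrum ℂ a := by
    have : (spectrum ℂ a \ {0})ᶜ ∈ 𝓝 (0 : ℂ) :=
      (hfin.subset sdiff_subset).isClosed.isOpen_compl.mem_nhds (by simp)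
    filter_upwards [mem_nhdsWithin_of_mem_nhds this, self_mem_nhdsWithin] with t h1 h2 h3
    exact h1 ⟨h3, h2⟩
  filter_upwards [h2] with t ht
  have := spectrum.notMem_iff.1 ht
  rw [← IsUnit.neg_iff] at this
  simpa using this

/-- Polar decomposition: with a*a invertible, a|a|⁻¹ is an isometry, hence unitary by `hfin`. -/
theorem isUnit_of_isUnit_star_mul_self (hfin : ∀ v : A, star v * v = 1 → v * star v = 1) {a : A}
    (h : IsUnit (star a * a)) : IsUnit a := by
  have hsa : IsSelfAdjoint (star a * a) := IsSelfAdjoint.star_mul_self a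
  have hpos : ∀ t ∈ spectrum ℝ (star a * a), 0 < t := fun t ht =>
    lt_of_le_of_ne (spectrum_star_mul_self_nonneg t ht) fun h0 => by
      rw [← h0] at ht
      exact (spectrum.zero_notMem ℝ h) ht
  have hc : ContinuousOn (fun t : ℝ => (√t)⁻¹) (spectrum ℝ (star a * a)) :=
    Real.continuous_sqrt.continuousOn.inv₀ fun t ht => (Real.sqrt_pos.2 (hpos t ht)).ne'
  have hc' : ContinuousOn (fun t : ℝ => √t) (spectrum ℝ (star a * a)) :=
    Real.continuous_sqrt.continuousOn
  set r : A := cfc (fun t : ℝ => (√t)⁻¹) (star a * a) with hr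
  set s : A := cfc (fun t : ℝ => √t) (star a * a) with hs
  have hrs : r * s = 1 := by
    rw [hr, hs, ← cfc_mul _ _ _ hc hc', ← cfc_one ℝ (star a * a)]
    exact cfc_congr fun t ht => inv_mul_cancel₀ (Real.sqrt_pos.2 (hpos t ht)).ne'
  have hsr : s * r = 1 := by
    rw [hr, hs, ← cfc_mul _ _ _ hc' hc, ← cfc_one ℝ (star a * a)]
    exact cfc_congr fun t ht => mul_inv_cancel₀ (Real.sqrt_pos.2 (hpos t ht)).ne'
  have hss : s * s = star a * a := by
    rw [hs, ← cfc_mul _ _ _ hc' hc']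
    conv_rhs => rw [← cfc_id ℝ (star a * a)]
    exact cfc_congr fun t ht => Real.mul_self_sqrt (hpos t ht).le
  have hrst : star r = r := IsSelfAdjoint.cfc
  have hv : star (a * r) * (a * r) = 1 := by
    rw [star_mul, hrst]
    calc r * star a * (a * r) = r * (star a * a) * r := by noncomm_ring
      _ = (r * s) * (s * r) := by rw [← hss]; noncomm_ring
      _ = 1 := by rw [hrs, hsr, one_mul]
  have hv' := hfin _ hv
  have hu : IsUnit (a * r) := ⟨⟨a * r, star (a * r), hv', hv⟩, rfl⟩
  have : a = a * r * s := by rw [mul_assoc, hrs, mul_one]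
  rw [this]
  exact hu.mul ⟨⟨s, r, hsr, hrs⟩, rfl⟩

theorem norm_mul_cfc_sq (a : A) {g : ℝ → ℝ} (hg : Continuous g) :
    ‖a * cfc g (star a * a)‖ * ‖a * cfc g (star a * a)‖ =
      ‖cfc (fun t => g t * t * g t) (star a * a)‖ := by
  have hsa : IsSelfAdjoint (star a * a) := IsSelfAdjoint.star_mul_self a
  have hst : star (cfc g (star a * a)) = cfc g (star a * a) := IsSelfAdjoint.cfc
  have h2 : cfc g (star a * a) * (star a * a) * cfc g (star a * a) =
      cfc (fun t => g t * t * g t) (star a * a) := by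
    rw [cfc_mul (fun t => g t * t) g (star a * a) (by fun_prop) (by fun_prop),
      cfc_mul g (fun t => t) (star a * a) (by fun_prop) (by fun_prop), cfc_id' ℝ (star a * a)]
  rw [← CStarRing.norm_star_mul_self, star_mul, hst, ← h2]
  congr 1
  noncomm_ring

/-- A bump function at `0`, and a second one which is `1` on its support and vanishes beyond `2δ`. -/
theorem exists_cutoff_functions {δ : ℝ} (hδ : 0 < δ) : ∃ f g : ℝ → ℝ, Continuous f ∧ Continuous g ∧
    (∀ t, 0 ≤ g t) ∧ (∀ t, g t ≤ 1) ∧ (∀ t, g t * f t = f t) ∧ f 0 = 1 ∧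
    ∀ t, 2 * δ ≤ t → g t = 0 := by
  refine ⟨fun t => max 0 (1 - t / δ), fun t => min 1 (max 0 (2 - t / δ)), by fun_prop, by fun_prop,
    fun t => le_min zero_le_one (le_max_left _ _), fun t => min_le_left _ _, fun t => ?_, by simp,
    fun t ht => ?_⟩
  · by_cases ht : 0 ≤ 1 - t / δ
    · simp only
      rw [max_eq_right (show 0 ≤ 2 - t / δ by linarith), min_eq_left (by linarith), one_mul]
    · simp only
      rw [max_eq_left (show 1 - t / δ ≤ 0 by linarith), mul_zero]
  · have h5 : 2 ≤ t / δ := by rwa [le_div_iff₀ hδ]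
    simp only
    rw [max_eq_left (by linarith), min_eq_right zero_le_one]

/-- Both c = g(a*a) and d = f(a*a) come from bumps at 0. As 0 is in the spectrum and f(0) = 1, d is
nonzero; g f = f gives c d = d. -/
theorem exists_approx_annihilator {a : A} (h : ¬ IsUnit (star a * a)) {η : ℝ} (hη : 0 < η) :
    ∃ c d : A, star c = c ∧ ‖a * c‖ ≤ η ∧ ‖c‖ ≤ 1 ∧ d ≠ 0 ∧ c * (star d * d) = star d * d := by
  have hsa : IsSelfAdjoint (star a * a) := IsSelfAdjoint.star_mul_self a
  have hnn : ∀ t ∈ spectrum ℝ (star a * a), 0 ≤ t := spectrum_star_mul_self_nonneg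
  -- With this δ the function g vanishes beyond η², so ‖ac‖² is at most the supremum of t g(t)²,
  -- which is at most η².
  have hδ0 : 0 < η ^ 2 / 2 := by positivity
  obtain ⟨f, g, hfc, hgc, hg0, hg1, hgf, hf0, hgz⟩ := exists_cutoff_functions hδ0
  set c : A := cfc g (star a * a) with hc
  set d : A := cfc f (star a * a) with hd
  have hcst : star c = c := IsSelfAdjoint.cfc
  have hdst : star d = d := IsSelfAdjoint.cfc
  refine ⟨c, d, hcst, ?_, ?_, ?_, ?_⟩
  · have h1 : ‖a * c‖ * ‖a * c‖ = _ := norm_mul_cfc_sq a hgc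
    have h3 : ‖cfc (fun t => g t * t * g t) (star a * a)‖ ≤ η ^ 2 := by
      refine norm_cfc_le (by positivity) fun t ht => ?_
      have ht0 := hnn t ht
      rw [Real.norm_of_nonneg (mul_nonneg (mul_nonneg (hg0 t) ht0) (hg0 t))]
      rcases le_total t (η ^ 2) with htδ | htδ
      · have hg0t := hg0 t
        have hg1t := hg1 t
        calc g t * t * g t ≤ 1 * t * 1 := by gcongr
          _ ≤ η ^ 2 := by linarith
      · rw [hgz t (by linarith)]
        simp only [zero_mul]
        positivity
    rw [← h1] at h3
    nlinarith [norm_nonneg (a * c)]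
  · refine norm_cfc_le zero_le_one fun t _ => ?_
    rw [Real.norm_of_nonneg (hg0 t)]
    exact hg1 t
  · intro hd0
    have h0 : (0 : ℝ) ∈ spectrum ℝ (star a * a) := spectrum.zero_mem_iff (R := ℝ) |>.2 h
    have h1 : f 0 ∈ spectrum ℝ d := by
      rw [hd, cfc_map_spectrum f (star a * a)]
      exact ⟨0, h0, rfl⟩
    rw [hd0, hf0, spectrum.mem_iff] at h1
    exact h1 (by simp)
  · have : c * d = d := by
      rw [hc, hd, ← cfc_mul g f]
      exact cfc_congr fun t _ => hgf t
    rw [hdst, ← mul_assoc, this]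

/-- Take b = (1 − c')a(1 − c) with c, c' the approximate annihilators for a and a*. Finiteness is
what makes both a*a and aa* singular. -/
theorem exists_near_zero_divisor (hfin : ∀ v : A, star v * v = 1 → v * star v = 1) {a : A}
    (ha : ¬ IsUnit a) {η : ℝ} (hη : 0 < η) :
    ∃ b d e : A, ‖b - a‖ ≤ η ∧ d ≠ 0 ∧ e ≠ 0 ∧ b * (star d * d) = 0 ∧ (star e * e) * b = 0 := by
  have h1 : ¬ IsUnit (star a * a) := fun h => ha (isUnit_of_isUnit_star_mul_self hfin h)
  have h2 : ¬ IsUnit (star (star a) * star a) := fun h =>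
    ha (isUnit_star.1 (isUnit_of_isUnit_star_mul_self hfin h))
  obtain ⟨c, d, hc, hac, -, hd, hcd⟩ := exists_approx_annihilator h1 (by positivity : 0 < η / 3)
  obtain ⟨c', e, hc', hac', hc'1, he, hce⟩ :=
    exists_approx_annihilator h2 (by positivity : 0 < η / 3)
  have hac'' : ‖c' * a‖ ≤ η / 3 := by
    rw [← norm_star, star_mul, hc']
    exact hac'
  have hce' : (star e * e) * c' = star e * e := by
    have := congrArg star hce
    rwa [star_mul, star_mul, star_star, hc'] at this
  refine ⟨(1 - c') * a * (1 - c), d, e, ?_, hd, he, ?_, ?_⟩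
  · have h3 : (1 - c') * a * (1 - c) - a = -(c' * a) - a * c + c' * (a * c) := by noncomm_ring
    rw [h3]
    have h4 : ‖c' * (a * c)‖ ≤ 1 * (η / 3) := (norm_mul_le _ _).trans (by gcongr)
    calc ‖-(c' * a) - a * c + c' * (a * c)‖ ≤ ‖-(c' * a)‖ + ‖a * c‖ + ‖c' * (a * c)‖ :=
          (norm_add_le _ _).trans (by gcongr; exact norm_sub_le _ _)
      _ ≤ η := by rw [norm_neg]; linarith
  · rw [mul_assoc, sub_mul 1 c, one_mul, hcd, sub_self, mul_zero]
  · rw [← mul_assoc, ← mul_assoc, mul_sub _ 1 c', mul_one, hce', sub_self, zero_mul, zero_mul]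

end Invertibles

/-! ### Isometries are unitary, and positive elements compared with functions on units. -/

section Finite

variable {G : Type*} [TopologicalSpace G] [EtaleGroupoid G]

theorem lam_delta (f : C_c(G, ℂ)) (k g : G) :
    (lam f : Ell2 G →L[ℂ] Ell2 G) (delta k) g = convKernel f g k := regularRep_delta f k g

theorem exists_delta_ne_zero {c : reducedCStarAlgebra G} (hc : c ≠ 0) :
    ∃ g : G, (c : Ell2 G →L[ℂ] Ell2 G) (delta g) ≠ 0 := by
  by_contra! h
  exact hc (Subtype.ext (ext_delta fun g => h g))

theorem star_mul_self_delta (c : reducedCStarAlgebra G) (g : G) :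
    ((star c * c : reducedCStarAlgebra G) : Ell2 G →L[ℂ] Ell2 G) (delta g) g =
      ((‖(c : Ell2 G →L[ℂ] Ell2 G) (delta g)‖ ^ 2 : ℝ) : ℂ) := by
  have h : ((star c * c : reducedCStarAlgebra G) : Ell2 G →L[ℂ] Ell2 G) (delta g) =
      ContinuousLinearMap.adjoint (c : Ell2 G →L[ℂ] Ell2 G)
        ((c : Ell2 G →L[ℂ] Ell2 G) (delta g)) := rfl
  rw [h, ← inner_delta_left, ContinuousLinearMap.adjoint_inner_right, inner_self_eq_norm_sq_to_K]
  push_cast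
  rfl

theorem norm_coe_delta_le (c : reducedCStarAlgebra G) (g : G) :
    ‖(c : Ell2 G →L[ℂ] Ell2 G) (delta g)‖ ≤ ‖c‖ := by
  have := (c : Ell2 G →L[ℂ] Ell2 G).le_opNorm (delta g)
  rwa [norm_delta, mul_one] at this

theorem norm_apply_rng_sub_le (f : C_c(G, ℂ)) (b : reducedCStarAlgebra G) (g : G) :
    ‖f (rng g) - (b : Ell2 G →L[ℂ] Ell2 G) (delta g) g‖ ≤ ‖lam f - b‖ := by
  have h : ((lam f - b : reducedCStarAlgebra G) : Ell2 G →L[ℂ] Ell2 G) (delta g) g =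
      f (rng g) - (b : Ell2 G →L[ℂ] Ell2 G) (delta g) g := by
    rw [← convKernel_self (f : G → ℂ) g, ← lam_delta f g g]
    rfl
  rw [← h]
  exact (norm_apply_le _ _).trans (norm_coe_delta_le _ _)

/-- The diagonal entry of c*c at g is ‖cδ_g‖², and f(r(g)) is the corresponding entry of λ(f). If
that entry is s, then t ≤ s/4 gives Re f ≥ s − t ≥ 3t > 2t at r(g); t ≤ 1/2 keeps 2t ≤ 1 for later.
-/
theorem exists_lam_near_star_mul_self [T2Space G] [CompactSpace (units : Set G)]
    (hcov : HasCompactOpenCover G) {c : reducedCStarAlgebra G} (hc : c ≠ 0) :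
    ∃ (t : ℝ) (f : C_c(G, ℂ)), 0 < t ∧ t ≤ 1 / 2 ∧ ‖lam f - star c * c‖ < t ∧
      {x ∈ (units : Set G) | 2 * t < (f x).re}.Nonempty := by
  obtain ⟨g, hg⟩ := exists_delta_ne_zero hc
  set s : ℝ := ‖(c : Ell2 G →L[ℂ] Ell2 G) (delta g)‖ ^ 2 with hs
  have hs0 : 0 < s := by positivity
  obtain ⟨f, hf⟩ := exists_lam_near hcov (star c * c)
    (lt_min (by positivity : 0 < s / 4) (by norm_num : (0 : ℝ) < 1 / 2))
  refine ⟨min (s / 4) (1 / 2), f, lt_min (by positivity) (by norm_num), min_le_right _ _, hf, rng g,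
    rng_mem g, ?_⟩
  have h1 := norm_apply_rng_sub_le f (star c * c) g
  rw [star_mul_self_delta] at h1
  have h2 := (Complex.abs_re_le_norm _).trans (h1.trans hf.le)
  rw [Complex.sub_re, Complex.ofReal_re] at h2
  have h3 := (abs_le.1 h2).1
  have h4 := min_le_left (s / 4) (1 / 2)
  linarith

theorem isOpen_units_re_lt (f : C_c(G, ℂ)) (t : ℝ) :
    IsOpen {x ∈ (units : Set G) | t < (f x).re} :=
  (isOpen_units G).inter
    (isOpen_lt continuous_const (Complex.continuous_re.comp f.continuous))

/-- Both sides are compared with the sum of squares of the entries of the block indexed by Kx. A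
column that is not bad lives entirely in the block; a bad one costs at most R². The rows of the
block are parts of the rows of λ(f). -/
theorem sum_norm_sq_le_sum_adjoint [T2Space G] (f : C_c(G, ℂ)) {K : Set G} {lev : G → ℕ}
    (hK : IsTower K lev) {R : ℝ} (hR : ‖lam f‖ ≤ R) (x : G) :
    ∑ k ∈ (finite_fib hK.isCompact x).toFinset,
        ‖(lam f : Ell2 G →L[ℂ] Ell2 G) (delta k)‖ ^ 2 ≤
      ∑ k ∈ (finite_fib hK.isCompact x).toFinset,
        ‖((star (lam f) : reducedCStarAlgebra G) : Ell2 G →L[ℂ] Ell2 G) (delta k)‖ ^ 2 +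
      R ^ 2 * {k ∈ fib K x | rng k ∈ src '' (tsupport f \ K)}.ncard := by
  classical
  set S := (finite_fib hK.isCompact x).toFinset with hS
  have hSm : ∀ k, k ∈ S ↔ k ∈ fib K x := fun k => Finite.mem_toFinset _
  set T : Ell2 G →L[ℂ] Ell2 G := (lam f : Ell2 G →L[ℂ] Ell2 G) with hT
  have h1 : ∀ k ∈ S, ‖T (delta k)‖ ^ 2 ≤ ∑ l ∈ S, ‖T (delta k) l‖ ^ 2 +
      if rng k ∈ src '' (tsupport f \ K) then R ^ 2 else 0 := by
    intro k hk
    split_ifs with hb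
    · have h2 : ‖T (delta k)‖ ^ 2 ≤ R ^ 2 := by
        gcongr
        exact (norm_coe_delta_le _ _).trans hR
      have h3 : 0 ≤ ∑ l ∈ S, ‖T (delta k) l‖ ^ 2 := Finset.sum_nonneg fun _ _ => by positivity
      linarith
    · rw [add_zero]
      refine (norm_sq_eq_sum _ S fun l hl => ?_).le
      by_contra hne
      rw [hT, lam_delta] at hne
      obtain ⟨e, h⟩ := convKernel_ne_zero hne
      have hk' := (hSm k).1 hk
      refine hb ⟨_, ⟨subset_tsupport _ h, fun hmem => hl ((hSm l).2 ⟨?_, e.trans hk'.2⟩)⟩, src_div e⟩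
      rw [← comp_inver_comp_cancel e]
      exact hK.comp_mem _ hmem _ hk'.1 (src_div e)
  have h2 : ∀ l ∈ S, ∑ k ∈ S, ‖T (delta k) l‖ ^ 2 ≤
      ‖((star (lam f) : reducedCStarAlgebra G) : Ell2 G →L[ℂ] Ell2 G) (delta l)‖ ^ 2 := by
    intro l _
    refine le_trans (le_of_eq (Finset.sum_congr rfl fun k _ => ?_)) (sum_norm_sq_le _ S)
    have : ((star (lam f) : reducedCStarAlgebra G) : Ell2 G →L[ℂ] Ell2 G) = star T := rfl
    rw [this, adjoint_delta_apply, norm_star]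
  calc ∑ k ∈ S, ‖T (delta k)‖ ^ 2
      ≤ ∑ k ∈ S, (∑ l ∈ S, ‖T (delta k) l‖ ^ 2 +
          if rng k ∈ src '' (tsupport f \ K) then R ^ 2 else 0) := Finset.sum_le_sum h1
    _ = ∑ l ∈ S, ∑ k ∈ S, ‖T (delta k) l‖ ^ 2 +
          R ^ 2 * {k ∈ fib K x | rng k ∈ src '' (tsupport f \ K)}.ncard := by
        rw [Finset.sum_add_distrib, Finset.sum_comm, ← Finset.sum_filter, Finset.sum_const,
          nsmul_eq_mul, mul_comm (R ^ 2)]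
        congr 3
        rw [← ncard_coe_finset]
        congr 1
        ext k
        simp [hSm]
    _ ≤ _ := by gcongr with l hl; exact h2 l hl

/-- Row loss t·good is paid by the error 5τn and by 4·bad. The constants make 5τ = t/(4M') and ε(t +
4M) ≤ t/(8M'), so a mass nt/M' would be at most 3/8 of itself. -/
theorem count_contradiction {t M' M n τ ε good bad : ℝ} (ht : 0 < t) (hM' : 1 ≤ M') (hM : 0 ≤ M)
    (hn : 0 < n) (hτ : τ = t / (20 * M')) (hε : ε = t / (8 * M' * (t + 4 * M + 1)))
    (e1 : n * (1 - 2 * τ) ≤ n * (1 + 3 * τ) - t * good + 4 * bad)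
    (hgood : n ≤ M' * (good + ε * n)) (hbad : bad ≤ M * (ε * n)) : False := by
  have hM0 : 0 < M' := by linarith
  have hε0 : 0 < ε := by rw [hε]; positivity
  have e2 : n / M' - ε * n ≤ good := by
    have : n / M' ≤ good + ε * n := by
      rw [div_le_iff₀ hM0]
      linarith
    linarith
  have e3 : t * (n / M' - ε * n) ≤ t * good := by gcongr
  have e4 : ε * (t + 4 * M) ≤ t / (8 * M') := by
    have : t / (8 * M') = ε * (t + 4 * M + 1) := by
      rw [hε]; field_simp
    rw [this]
    exact mul_le_mul_of_nonneg_left (by linarith) hε0.le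
  have e5 : 5 * τ = t / (4 * M') := by rw [hτ]; field_simp; norm_num
  have e6 : t * (n / M') ≤ n * (t / (4 * M')) + n * (t / (8 * M')) := by
    have h7 : n * (ε * (t + 4 * M)) ≤ n * (t / (8 * M')) := by gcongr
    rw [← e5]
    linarith
  have e7 : t * (n / M') = n * (t / M') := by ring
  have e8 : n * (t / (4 * M')) + n * (t / (8 * M')) = (3 / 8) * (n * (t / M')) := by
    field_simp
    norm_num
  have e9 : 0 < n * (t / M') := by positivity
  linarith

theorem one_sub_le_norm_sq {E : Type*} [NormedAddCommGroup E] {ξ η : E} {τ : ℝ} (hτ1 : τ ≤ 1)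
    (h : ‖ξ - η‖ ≤ τ) (hη : ‖η‖ ^ 2 = 1) : 1 - 2 * τ ≤ ‖ξ‖ ^ 2 := by
  have h2 : ‖η‖ = 1 := (pow_eq_one_iff_of_nonneg (norm_nonneg _) two_ne_zero).1 hη
  have h3 := norm_sub_norm_le η ξ
  rw [norm_sub_rev, h2] at h3
  nlinarith [sq_nonneg τ, mul_self_le_mul_self (sub_nonneg.2 hτ1) (by linarith : 1 - τ ≤ ‖ξ‖)]

theorem norm_sq_le_add {E : Type*} [NormedAddCommGroup E] {ξ η : E} {τ s : ℝ} (hτ0 : 0 ≤ τ)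
    (hτ1 : τ ≤ 1) (h : ‖ξ - η‖ ≤ τ) (hη : ‖η‖ ^ 2 = 1 - s) (hs : 0 ≤ s) :
    ‖ξ‖ ^ 2 ≤ 1 - s + 3 * τ := by
  have h2 := norm_sub_norm_le ξ η
  have h5 : ‖η‖ ≤ 1 := by nlinarith [norm_nonneg η]
  have h6 := norm_nonneg ξ
  rw [← hη]
  nlinarith [norm_nonneg η]

theorem one_sub_mul_star_sq {R : Type*} [Ring R] [StarRing R] {v : R} (hv : star v * v = 1) :
    star (1 - v * star v) * (1 - v * star v) = 1 - v * star v := by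
  rw [star_sub, star_one, star_mul, star_star]
  calc (1 - v * star v) * (1 - v * star v)
      = 1 - 2 • (v * star v) + v * (star v * v) * star v := by noncomm_ring
    _ = _ := by rw [hv]; noncomm_ring

/-- For an isometry v with defect projection c = 1 − vv*, the columns have ‖vδ_k‖² = 1 and the rows
‖v*δ_k‖² = 1 − ‖cδ_k‖². If c ≠ 0, the loss is at least t over an open set of units, hence at a
definite fraction of the points of Kx, against the near balance of columns and rows of an
approximating λ(φ). -/
theorem mul_star_self_eq_one [T2Space G] [CompactSpace (units : Set G)] (hmin : IsMinimal G)
    (haf : AlmostFinite G) (v : reducedCStarAlgebra G) (hv : star v * v = 1) : v * star v = 1 := by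
  classical
  have hcov : HasCompactOpenCover G := haf.1
  by_contra hne
  set c : reducedCStarAlgebra G := 1 - v * star v with hc
  have hc0 : c ≠ 0 := fun h => hne (sub_eq_zero.1 h).symm
  have hcc : star c * c = c := one_sub_mul_star_sq hv
  obtain ⟨t, f, ht, ht2, hf, hO⟩ := exists_lam_near_star_mul_self hcov hc0
  obtain ⟨C', hC', hC'O⟩ := exists_compact_translate hcov hmin (isOpen_units_re_lt f (2 * t))
    (sep_subset _ _) hO
  obtain ⟨x, hx, -⟩ := hO
  obtain ⟨M₀, hM₀⟩ := exists_encard_rng_le hC'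
  set M' : ℕ := M₀ + 1 with hM'
  have hM'C : ∀ y, {g ∈ C' | rng g = y}.encard ≤ M' := fun y =>
    (hM₀ y).trans (by rw [hM']; exact_mod_cast Nat.le_succ _)
  have hM'0 : (1 : ℝ) ≤ M' := by rw [hM']; push_cast; linarith [Nat.cast_nonneg (α := ℝ) M₀]
  set τ : ℝ := t / (20 * M') with hτ
  have hτ0 : 0 < τ := by positivity
  have hτ1 : τ ≤ 1 := by rw [hτ, div_le_one (by positivity)]; nlinarith
  obtain ⟨φ, hφ⟩ := exists_lam_near hcov v hτ0
  obtain ⟨M, hM⟩ := exists_encard_rng_le φ.hasCompactSupport.isCompact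
  set ε : ℝ := t / (8 * M' * (t + 4 * M + 1)) with hε
  have hε0 : 0 < ε := by positivity
  have hC : IsCompact (C' ∪ tsupport φ) := hC'.union φ.hasCompactSupport.isCompact
  obtain ⟨K, lev, hK, hinv⟩ := haf.exists_isTower hC hε0
  have hgood := hinv.le_good hK hC subset_union_left hM'C hC'O hx
  have hbad := hinv.bad_le hK hC subset_union_right hM hx
  have hvn : ∀ k, ‖(v : Ell2 G →L[ℂ] Ell2 G) (delta k)‖ ^ 2 = 1 := by
    intro k
    refine Complex.ofReal_injective ((star_mul_self_delta v k).symm.trans ?_)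
    rw [hv, Complex.ofReal_one]
    exact delta_apply_self k
  have hcn : ∀ k, ‖((star v : reducedCStarAlgebra G) : Ell2 G →L[ℂ] Ell2 G) (delta k)‖ ^ 2 =
      1 - ‖(c : Ell2 G →L[ℂ] Ell2 G) (delta k)‖ ^ 2 := by
    intro k
    have h := star_mul_self_delta c k
    have h3 := star_mul_self_delta (star v) k
    rw [hcc] at h
    rw [star_star] at h3
    have h2 : (c : Ell2 G →L[ℂ] Ell2 G) (delta k) k =
        1 - ((v * star v : reducedCStarAlgebra G) : Ell2 G →L[ℂ] Ell2 G) (delta k) k := by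
      rw [← delta_apply_self k]
      rfl
    rw [h2, h3] at h
    have : (1 : ℝ) - ‖((star v : reducedCStarAlgebra G) : Ell2 G →L[ℂ] Ell2 G) (delta k)‖ ^ 2 =
      ‖(c : Ell2 G →L[ℂ] Ell2 G) (delta k)‖ ^ 2 :=
      Complex.ofReal_injective (by rw [Complex.ofReal_sub, Complex.ofReal_one]; exact h)
    linarith
  have hTn : ∀ k, 1 - 2 * τ ≤ ‖(lam φ : Ell2 G →L[ℂ] Ell2 G) (delta k)‖ ^ 2 := by
    intro k
    have h1 : ‖(lam φ : Ell2 G →L[ℂ] Ell2 G) (delta k) - (v : Ell2 G →L[ℂ] Ell2 G) (delta k)‖ ≤ τ :=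
      (norm_coe_delta_le (lam φ - v) k).trans hφ.le
    exact one_sub_le_norm_sq hτ1 h1 (hvn k)
  have hTa : ∀ k, ‖((star (lam φ) : reducedCStarAlgebra G) : Ell2 G →L[ℂ] Ell2 G) (delta k)‖ ^ 2 ≤
      1 - ‖(c : Ell2 G →L[ℂ] Ell2 G) (delta k)‖ ^ 2 + 3 * τ := by
    intro k
    have h1 : ‖((star (lam φ) : reducedCStarAlgebra G) : Ell2 G →L[ℂ] Ell2 G) (delta k) -
        ((star v : reducedCStarAlgebra G) : Ell2 G →L[ℂ] Ell2 G) (delta k)‖ ≤ τ := by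
      refine (norm_coe_delta_le (star (lam φ) - star v) k).trans ?_
      rw [← star_sub, norm_star]
      exact hφ.le
    exact norm_sq_le_add hτ0.le hτ1 h1 (hcn k) (sq_nonneg _)
  have hcO : ∀ k, rng k ∈ {x ∈ (units : Set G) | 2 * t < (f x).re} →
      t ≤ ‖(c : Ell2 G →L[ℂ] Ell2 G) (delta k)‖ ^ 2 := by
    intro k hk
    have h1 := norm_apply_rng_sub_le f (star c * c) k
    rw [star_mul_self_delta] at h1
    have h2 := (Complex.abs_re_le_norm _).trans (h1.trans hf.le)
    rw [Complex.sub_re, Complex.ofReal_re] at h2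
    have h3 := (abs_le.1 h2).2
    have h4 := hk.2
    linarith
  -- The bound R = 2 is the source of the coefficient 4 of the bad points.
  have hnorm : ‖lam φ‖ ≤ 2 := by
    have h1 : ‖v‖ ≤ 1 := by
      have := CStarRing.norm_star_mul_self (x := v)
      rw [hv] at this
      have h2 : ‖(1 : reducedCStarAlgebra G)‖ ≤ 1 := by
        have : Nontrivial (reducedCStarAlgebra G) := ⟨c, 0, hc0⟩
        exact CStarRing.norm_one.le
      nlinarith [norm_nonneg v]
    have h2 := norm_sub_norm_le (lam φ) v
    linarith
  have hmain := sum_norm_sq_le_sum_adjoint φ hK hnorm x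
  set S := (finite_fib hK.isCompact x).toFinset with hS
  have hSm : ∀ k, k ∈ S ↔ k ∈ fib K x := fun k => Finite.mem_toFinset _
  have hScard : ((fib K x).ncard : ℝ) = S.card := by
    rw [ncard_eq_toFinset_card _ (finite_fib hK.isCompact x)]
  have hlow : (S.card : ℝ) * (1 - 2 * τ) ≤
      ∑ k ∈ S, ‖(lam φ : Ell2 G →L[ℂ] Ell2 G) (delta k)‖ ^ 2 := by
    rw [← nsmul_eq_mul]
    exact Finset.card_nsmul_le_sum _ _ _ fun k _ => hTn k
  have hup : ∑ k ∈ S,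
      ‖((star (lam φ) : reducedCStarAlgebra G) : Ell2 G →L[ℂ] Ell2 G) (delta k)‖ ^ 2 ≤
      S.card * (1 + 3 * τ) -
        t * {k ∈ fib K x | rng k ∈ {x ∈ (units : Set G) | 2 * t < (f x).re}}.ncard := by
    have h1 : ∀ k ∈ S,
        ‖((star (lam φ) : reducedCStarAlgebra G) : Ell2 G →L[ℂ] Ell2 G) (delta k)‖ ^ 2 ≤
        (1 + 3 * τ) - if rng k ∈ {x ∈ (units : Set G) | 2 * t < (f x).re} then t else 0 := by
      intro k _
      have h2 := hTa k
      split_ifs with h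
      · linarith [hcO k h]
      · linarith [sq_nonneg ‖(c : Ell2 G →L[ℂ] Ell2 G) (delta k)‖]
    refine (Finset.sum_le_sum h1).trans (le_of_eq ?_)
    rw [Finset.sum_sub_distrib, Finset.sum_const, nsmul_eq_mul, ← Finset.sum_filter,
      Finset.sum_const, nsmul_eq_mul, mul_comm t]
    congr 3
    rw [← ncard_coe_finset]
    congr 1
    ext k
    simp [hSm]
  rw [hScard] at hgood hbad
  have hn : (0 : ℝ) < S.card := by
    rw [← hScard]
    exact_mod_cast hK.fib_pos hx
  set n : ℝ := (S.card : ℝ)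
  set good : ℝ :=
    ({k ∈ fib K x | rng k ∈ {x ∈ (units : Set G) | 2 * t < (f x).re}}.ncard : ℝ)
  set bad : ℝ := ({k ∈ fib K x | rng k ∈ src '' (tsupport φ \ K)}.ncard : ℝ)
  exact count_contradiction ht hM'0 (Nat.cast_nonneg M) hn hτ hε (by linarith) hgood hbad

/-- If L compresses under Y to a function, then 1 + Y(D − 1)Y is the invertible function Ψ up to an
error controlled by L − D. -/
theorem one_add_mul_sub_one_mul {R : Type*} [Ring R] {Y D L Ψ Ψ' : R} (h : Y * L * Y = Ψ - 1 + Y * Y)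
    (h' : Ψ * Ψ' = 1) : 1 + Y * ((D - 1) * Y) = Ψ * (1 - Ψ' * (Y * (L - D) * Y)) := by
  calc 1 + Y * ((D - 1) * Y) = 1 - Y * Y + Y * L * Y - Y * (L - D) * Y := by noncomm_ring
    _ = Ψ - Y * (L - D) * Y := by rw [h]; noncomm_ring
    _ = Ψ - (Ψ * Ψ') * (Y * (L - D) * Y) := by rw [h', one_mul]
    _ = _ := by noncomm_ring

/-- A real-valued function on a space, regarded as a complex-valued one. -/
def complexify {X : Type*} [TopologicalSpace X] (h : C(X, ℝ)) : C(X, ℂ) :=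
  ⟨fun x => (h x : ℂ), Complex.continuous_ofReal.comp h.continuous⟩

theorem complexify_apply {X : Type*} [TopologicalSpace X] (h : C(X, ℝ)) (x : X) :
    complexify h x = h x := rfl

/-- Let λ(f) approximate D = c*c. Near a well-chosen unit, where Re f > 2t, the only arrows in the
support of f are units, so D cut down there is close to an invertible function. -/
theorem exists_isUnit_mul_unitRep [T2Space G] [CompactSpace (units : Set G)] (hmin : IsMinimal G)
    (haf : AlmostFinite G) {c : reducedCStarAlgebra G} (hc : c ≠ 0) :
    ∃ (u : reducedCStarAlgebra G) (h : C((units : Set G), ℝ)), IsUnit u ∧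
      (∀ x, 0 ≤ h x ∧ h x ≤ 1) ∧ (∃ x, h x ≠ 0) ∧
      u * unitRep G (complexify h) = star c * c * unitRep G (complexify h) := by
  classical
  have hcov : HasCompactOpenCover G := haf.1
  obtain ⟨t, f, ht, ht2, hf, hO⟩ := exists_lam_near_star_mul_self hcov hc
  obtain ⟨C', hC', hC'O⟩ := exists_compact_translate hcov hmin (isOpen_units_re_lt f (2 * t))
    (sep_subset _ _) hO
  obtain ⟨x, hx, -⟩ := hO
  obtain ⟨M₀, hM₀⟩ := exists_encard_rng_le hC'
  obtain ⟨M, hM⟩ := exists_encard_rng_le f.hasCompactSupport.isCompact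
  -- If every point over O were bad, this ε would give n ≤ n/2 for the size n of Kx.
  set ε : ℝ := 1 / (2 * (M₀ + 1) * (M + 1)) with hε
  have hε0 : 0 < ε := by positivity
  have hC : IsCompact (C' ∪ tsupport f) := hC'.union f.hasCompactSupport.isCompact
  obtain ⟨K, lev, hK, hinv⟩ := haf.exists_isTower hC hε0
  have hgood := hinv.le_good hK hC subset_union_left hM₀ hC'O hx
  have hbad := hinv.bad_le hK hC subset_union_right hM hx
  have hex : ∃ k ∈ fib K x, rng k ∈ {x ∈ (units : Set G) | 2 * t < (f x).re} ∧
      rng k ∉ src '' (tsupport f \ K) := by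
    by_contra! hno
    have hle : {k ∈ fib K x | rng k ∈ {x ∈ (units : Set G) | 2 * t < (f x).re}}.ncard ≤
        {k ∈ fib K x | rng k ∈ src '' (tsupport f \ K)}.ncard :=
      ncard_le_ncard (fun k hk => ⟨hk.1, hno k hk.1 hk.2⟩)
        ((finite_fib hK.isCompact x).subset (sep_subset _ _))
    have hle' : ({k ∈ fib K x | rng k ∈ {x ∈ (units : Set G) | 2 * t < (f x).re}}.ncard : ℝ) ≤
        {k ∈ fib K x | rng k ∈ src '' (tsupport f \ K)}.ncard := by exact_mod_cast hle
    have hn : (0 : ℝ) < (fib K x).ncard := by exact_mod_cast hK.fib_pos hx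
    set n : ℝ := ((fib K x).ncard : ℝ)
    have h1 : n ≤ M₀ * (M * (ε * n) + ε * n) := hgood.trans (by gcongr; exact hle'.trans hbad)
    have h2 : M₀ * (M * (ε * n) + ε * n) ≤ n / 2 := by
      have : M₀ * (M * (ε * n) + ε * n) ≤ (M₀ + 1) * (M * (ε * n) + ε * n) := by
        gcongr
        linarith
      refine this.trans (le_of_eq ?_)
      rw [hε]
      field_simp
    linarith
  obtain ⟨k, -, hkO, hkB⟩ := hex
  -- No arrow of the support starting in O₁ leaves K, and an arrow of K between points of the same
  -- level is a unit.
  set O₁ : Set G := {x | x ∈ {x ∈ (units : Set G) | 2 * t < (f x).re} ∧ lev x = lev (rng k) ∧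
    x ∉ src '' (tsupport f \ K)} with hO₁
  have hBc : IsClosed (src '' (tsupport f \ K)) :=
    ((f.hasCompactSupport.isCompact.diff hK.isOpen).image continuous_src).isClosed
  have hO₁o : IsOpen O₁ :=
    (isOpen_units_re_lt f (2 * t)).inter ((hK.lev_loc.isOpen_fiber _).inter hBc.isOpen_compl)
  have hdiag : ∀ g, f g ≠ 0 → rng g ∈ O₁ → src g ∈ O₁ → g ∈ (units : Set G) := by
    intro g hg h1 h2
    have hgK : g ∈ K := by
      by_contra hn
      exact h2.2.2 ⟨g, ⟨subset_tsupport _ hg, hn⟩, rfl⟩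
    refine hK.mem_units hgK ?_
    rw [← hK.lev_rng g, h1.2.1, h2.2.1]
  set x₁ : (units : Set G) := ⟨rng k, rng_mem k⟩
  obtain ⟨y₀, hy0, hy1, hy01⟩ := exists_continuous_zero_one_of_isClosed
    (X := (units : Set G)) (s := ((↑) ⁻¹' O₁)ᶜ) (t := {x₁})
    (hO₁o.preimage continuous_subtype_val).isClosed_compl isClosed_singleton
    (by
      rw [disjoint_singleton_right]
      simp only [mem_compl_iff, not_not]
      exact ⟨hkO, rfl, hkB⟩)
  -- Two cutoffs from one Urysohn function, arranged so that y = 1 wherever h ≠ 0.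
  set y : C((units : Set G), ℝ) := ⟨fun x => min 1 (2 * y₀ x), by fun_prop⟩ with hy
  set h : C((units : Set G), ℝ) := ⟨fun x => max 0 (2 * y₀ x - 1), by fun_prop⟩ with hh
  have hy_le : ∀ x, y x ≤ 1 := fun x => min_le_left _ _
  have hy_nn : ∀ x, 0 ≤ y x := fun x => le_min zero_le_one (by linarith [(hy01 x).1])
  have hyO : ∀ x, y x ≠ 0 → (x : G) ∈ O₁ := by
    intro x hx
    by_contra hn
    refine hx ?_
    have : y₀ x = 0 := hy0 hn
    simp [hy, this]
  have hyh : ∀ x, y x * y x * h x = h x := by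
    intro x
    by_cases h1 : 0 ≤ 2 * y₀ x - 1
    · have : y x = 1 := min_eq_left (by linarith)
      rw [this]; ring
    · have : h x = 0 := max_eq_left (by linarith)
      rw [this]; ring
  set Y := unitRep G (complexify y) with hY
  set D := star c * c with hD
  -- Since y²h = h, this u satisfies u h = D h. Its invertibility is equivalent to that of the
  -- symmetric form 1 + Y(D − 1)Y.
  refine ⟨1 + (D - 1) * Y * Y, h, ?_, fun x => ⟨le_max_left _ _, max_le zero_le_one ?_⟩,
    ⟨x₁, ?_⟩, ?_⟩
  · refine isUnit_one_add_mul_comm ?_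
    -- Re ψ is a convex combination of 1 and a value above 2t where y ≠ 0, and 1 elsewhere. So ψ⁻¹
    -- has norm at most 1/(2t), and an error of size t is a relative error of at most 1/2.
    set ψ : C((units : Set G), ℂ) := ⟨fun x => 1 - (y x : ℂ) * y x + y x * f x * y x, by
      have := f.continuous
      fun_prop⟩ with hψ
    have hψre : ∀ x, 2 * t ≤ (ψ x).re := by
      intro x
      have e : (ψ x).re = 1 - y x * y x + y x * (f x).re * y x := by
        simp [hψ]
      rw [e]
      by_cases hz : y x = 0
      · rw [hz]; linarith
      · have h1 := (hyO x hz).1.2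
        nlinarith [hy_le x, hy_nn x, mul_self_nonneg (y x),
          mul_le_mul (hy_le x) (hy_le x) (hy_nn x) zero_le_one]
    have hψn : ∀ x, 2 * t ≤ ‖ψ x‖ := fun x =>
      (hψre x).trans ((le_abs_self _).trans (Complex.abs_re_le_norm _))
    have hψ0 : ∀ x, ψ x ≠ 0 := fun x h0 => by
      have := hψn x
      rw [h0, norm_zero] at this
      linarith
    set ψi : C((units : Set G), ℂ) := ⟨fun x => (ψ x)⁻¹, ψ.continuous.inv₀ hψ0⟩ with hψi
    have hψψ : ψ * ψi = 1 := by
      ext x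
      exact mul_inv_cancel₀ (hψ0 x)
    have hψin : ‖ψi‖ ≤ (2 * t)⁻¹ := by
      rw [ContinuousMap.norm_le _ (by positivity)]
      intro x
      change ‖(ψ x)⁻¹‖ ≤ _
      rw [norm_inv]
      exact inv_anti₀ (by positivity) (hψn x)
    have hYn : ‖Y‖ ≤ 1 := by
      refine (norm_unitRep_le _).trans ?_
      rw [ContinuousMap.norm_le _ zero_le_one]
      intro x
      rw [complexify_apply, Complex.norm_real, Real.norm_of_nonneg (hy_nn x)]
      exact hy_le x
    have hcut : cutoff (complexify y) f (complexify y) = ofUnits (ψ - 1 + complexify (y * y)) := by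
      ext g
      rw [cutoff_apply, ofUnits_apply]
      by_cases hg : g ∈ (units : Set G)
      · rw [indicator_of_mem hg]
        have e1 : unitSrc g = unitRng g := Subtype.ext ((src_unit g hg).trans (rng_unit g hg).symm)
        have e2 : ((unitRng g : (units : Set G)) : G) = g := rng_unit g hg
        simp only [ContinuousMap.add_apply, ContinuousMap.sub_apply, ContinuousMap.one_apply,
          complexify_apply, ContinuousMap.mul_apply, hψ, ContinuousMap.coe_mk, e1, e2]
        push_cast
        ring
      · rw [indicator_of_notMem hg]
        by_contra hne
        refine hg (hdiag g (right_ne_zero_of_mul (left_ne_zero_of_mul hne)) ?_ ?_)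
        · exact hyO (unitRng g) (by
            have := left_ne_zero_of_mul (left_ne_zero_of_mul hne)
            rw [complexify_apply] at this
            exact_mod_cast this)
        · exact hyO (unitSrc g) (by
            have := right_ne_zero_of_mul hne
            rw [complexify_apply] at this
            exact_mod_cast this)
    have hYfY : Y * lam f * Y = unitRep G ψ - 1 + Y * Y := by
      have hyy : complexify (y * y) = complexify y * complexify y := by
        ext x
        simp [complexify_apply]
      rw [hY, ← lam_cutoff, hcut, ← unitRep_apply, map_add, map_sub, map_one, hyy, map_mul]
    have key : 1 + Y * ((D - 1) * Y) =
        unitRep G ψ * (1 - unitRep G ψi * (Y * (lam f - D) * Y)) := by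
      have e1 : unitRep G ψ * unitRep G ψi = 1 := by rw [← map_mul, hψψ, map_one]
      exact one_add_mul_sub_one_mul hYfY e1
    rw [key]
    refine IsUnit.mul ?_ (isUnit_one_sub_of_norm_lt_one ?_)
    · refine IsUnit.map (unitRep G) ?_
      exact ⟨⟨ψ, ψi, hψψ, by rw [mul_comm, hψψ]⟩, rfl⟩
    · have h1 : ‖Y * (lam f - D) * Y‖ ≤ t := by
        calc ‖Y * (lam f - D) * Y‖ ≤ ‖Y‖ * ‖lam f - D‖ * ‖Y‖ :=
              (norm_mul_le _ _).trans (by gcongr; exact norm_mul_le _ _)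
          _ ≤ 1 * t * 1 := by gcongr
          _ = t := by ring
      calc ‖unitRep G ψi * (Y * (lam f - D) * Y)‖ ≤ ‖unitRep G ψi‖ * ‖Y * (lam f - D) * Y‖ :=
            norm_mul_le _ _
        _ ≤ (2 * t)⁻¹ * t := by
            gcongr
            exact (norm_unitRep_le _).trans hψin
        _ < 1 := by
            rw [mul_inv, mul_assoc, inv_mul_cancel₀ ht.ne']
            norm_num
  · linarith [(hy01 x).2]
  · have : y₀ x₁ = 1 := hy1 rfl
    simp [hh, this]
    norm_num
  · have e1 : Y * Y * unitRep G (complexify h) = unitRep G (complexify h) := by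
      rw [hY, ← map_mul, ← map_mul]
      congr 1
      ext x
      simp only [ContinuousMap.mul_apply, complexify_apply]
      exact_mod_cast hyh x
    calc (1 + (D - 1) * Y * Y) * unitRep G (complexify h)
        = unitRep G (complexify h) + (D - 1) * (Y * Y * unitRep G (complexify h)) := by noncomm_ring
      _ = D * unitRep G (complexify h) := by rw [e1]; noncomm_ring

end Finite

/-! ### From annihilating functions to annihilating clopen levels. -/

section Level

/-- An element `v = v q` extends to an invertible element if its Schur complement is invertible. -/
theorem exists_isUnit_mul_eq {R : Type*} [Ring R] [StarRing R] {q v : R} (hq : star q = q)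
    (hqq : q * q = q) (hv : v * q = v)
    (hS : IsUnit (1 - q + q * v + star (v - q * v) * (v - q * v))) :
    ∃ T : R, IsUnit T ∧ T * q = v := by
  set w := v - q * v with hw
  set S := 1 - q + q * v + star w * w with hSdef
  have h1 : q * w = 0 := by rw [hw, mul_sub, ← mul_assoc, hqq, sub_self]
  have h2 : w * q = w := by rw [hw, sub_mul, mul_assoc, hv]
  have h3 : w * w = 0 := by
    calc w * w = w * q * w := by rw [h2]
      _ = 0 := by rw [mul_assoc, h1, mul_zero]
  have h4 : v * w = 0 := by
    calc v * w = v * q * w := by rw [hv]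
      _ = 0 := by rw [mul_assoc, h1, mul_zero]
  have h5 : star w * q = 0 := by
    have := congrArg star h1
    rwa [star_mul, hq, star_zero] at this
  have h6 : star w * star w = 0 := by rw [← star_mul, h3, star_zero]
  have hu1 : IsUnit (1 - star w) := IsNilpotent.isUnit_one_sub ⟨2, by rw [sq, h6]⟩
  have hu2 : IsUnit (1 + w) := IsNilpotent.isUnit_one_add ⟨2, by rw [sq, h3]⟩
  -- In blocks with respect to q this is the matrix with rows (qv, −w*) and (w, 1), factored through
  -- its Schur complement qv + w*w.
  refine ⟨(1 - star w) * S * (1 + w), (hu1.mul hS).mul hu2, ?_⟩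
  have e1 : S * q = q * v + star w * w := by
    calc S * q = q - q * q + q * (v * q) + star w * (w * q) := by rw [hSdef]; noncomm_ring
      _ = _ := by rw [hqq, hv, h2, sub_self, zero_add]
  have e2 : S * w = w := by
    calc S * w = w - q * w + q * (v * w) + star w * (w * w) := by rw [hSdef]; noncomm_ring
      _ = w := by rw [h1, h4, h3]; simp
  calc (1 - star w) * S * (1 + w) * q = (1 - star w) * (S * q + S * (w * q)) := by noncomm_ring
    _ = (1 - star w) * (q * v + star w * w + w) := by rw [h2, e1, e2]
    _ = q * v + w - (star w * q) * v - (star w * star w) * w := by noncomm_ring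
    _ = v := by rw [h5, h6, hw]; noncomm_ring

theorem star_sub_mul_self {R : Type*} [Ring R] [StarRing R] {q v : R} (hq : star q = q)
    (hqq : q * q = q) :
    star (v - q * v) * (v - q * v) = star v * v - star (q * v) * (q * v) := by
  have : star (q * v) * (q * v) = star v * (q * v) := by
    rw [star_mul, hq, mul_assoc, ← mul_assoc q q, hqq]
  rw [this, star_sub, star_mul, hq]
  calc (star v - star v * q) * (v - q * v)
      = star v * v - star v * (q * v) - star v * (q * v) + star v * ((q * q) * v) := by noncomm_ring
    _ = _ := by rw [hqq]; noncomm_ring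

variable {G : Type*} [TopologicalSpace G] [EtaleGroupoid G]

/-- The indicator function of a level of a tower. -/
noncomputable def IsTower.levelFn {K : Set G} {lev : G → ℕ} (hK : IsTower K lev) (t : ℕ) :
    C((units : Set G), ℂ) :=
  ⟨fun x => if lev x = t then 1 else 0,
    (hK.lev_loc.comp (fun n => if n = t then (1 : ℂ) else 0)).continuous.comp
      continuous_subtype_val⟩

theorem IsTower.levelFn_apply {K : Set G} {lev : G → ℕ} (hK : IsTower K lev) (t : ℕ)
    (x : (units : Set G)) : hK.levelFn t x = if lev x = t then 1 else 0 := rfl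

theorem IsTower.levelFn_ne_zero {K : Set G} {lev : G → ℕ} (hK : IsTower K lev) {t : ℕ}
    {x : (units : Set G)} (h : hK.levelFn t x ≠ 0) : lev x = t := by
  by_contra hn
  exact h (if_neg hn)

theorem IsTower.levelFn_mul_self {K : Set G} {lev : G → ℕ} (hK : IsTower K lev) (t : ℕ) :
    hK.levelFn t * hK.levelFn t = hK.levelFn t := by
  ext x
  rw [ContinuousMap.mul_apply, hK.levelFn_apply]
  split_ifs <;> simp

theorem IsTower.star_levelFn {K : Set G} {lev : G → ℕ} (hK : IsTower K lev) (t : ℕ) :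
    star (hK.levelFn t) = hK.levelFn t := by
  ext x
  rw [ContinuousMap.star_apply, hK.levelFn_apply]
  split_ifs <;> simp

theorem IsTower.isClopen [T2Space G] {K : Set G} {lev : G → ℕ} (hK : IsTower K lev) : IsClopen K :=
  ⟨hK.isCompact.isClosed, hK.isOpen⟩

theorem conv_adj_self_apply [T2Space G] (hcov : HasCompactOpenCover G) (f : C_c(G, ℂ)) {x : G}
    (hx : x ∈ (units : Set G)) :
    conv hcov (adj f) f x =
      ∑' k, (({k : G | src k = x}.indicator (fun k => ‖f k‖ ^ 2) k : ℝ) : ℂ) := by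
  rw [conv_apply]
  refine tsum_congr fun k => ?_
  by_cases hk : src k = x
  · have e : src x = src k := by rw [hk, src_unit x hx]
    rw [indicator_of_mem (show k ∈ {k : G | src k = x} from hk), convKernel_of_eq e, adj_apply,
      inver_div e, ← hk, div_src]
    rw [← starRingEnd_apply, Complex.conj_mul']
    push_cast
    rfl
  · rw [indicator_of_notMem (show k ∉ {k : G | src k = x} from hk), convKernel_of_ne]
    · simp
    · rw [src_unit x hx]
      exact fun h => hk h.symm

theorem summable_indicator_norm_sq (f : C_c(G, ℂ)) (x : G) :
    Summable fun k => {k : G | src k = x}.indicator (fun k => ‖f k‖ ^ 2) k := by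
  refine summable_of_hasFiniteSupport
    ((finite_src_fiber f.hasCompactSupport.isCompact x).subset fun k hk => ?_)
  have h1 : k ∈ {k : G | src k = x} := by
    by_contra hn
    exact hk (indicator_of_notMem hn _)
  have h2 : f k ≠ 0 := by
    intro h0
    refine hk ?_
    show {k : G | src k = x}.indicator (fun k => ‖f k‖ ^ 2) k = 0
    rw [indicator_of_mem h1, h0]
    simp
  exact ⟨subset_tsupport _ h2, h1⟩

theorem conv_adj_self_re [T2Space G] (hcov : HasCompactOpenCover G) (f : C_c(G, ℂ)) {x : G}
    (hx : x ∈ (units : Set G)) {k : G} (hk : src k = x) :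
    ‖f k‖ ^ 2 ≤ (conv hcov (adj f) f x).re := by
  rw [conv_adj_self_apply hcov f hx, ← Complex.ofReal_tsum, Complex.ofReal_re]
  have h := (summable_indicator_norm_sq f x).le_tsum k fun j _ =>
    indicator_nonneg (fun _ _ => by positivity) j
  rwa [indicator_of_mem (show k ∈ {k : G | src k = x} from hk)] at h

variable [T2Space G] [CompactSpace (units : Set G)]

/-- The column v = H λ(1_K) q collects the values of h along the orbits of K into level t. Both qv
and v*v are functions on the units, so the Schur complement of `exists_isUnit_mul_eq` is one too,
and meeting every orbit makes it nowhere zero. -/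
theorem IsTower.exists_isUnit_mul_level (hcov : HasCompactOpenCover G) {K : Set G} {lev : G → ℕ}
    (hK : IsTower K lev) (t : ℕ) (h : C((units : Set G), ℝ)) (h01 : ∀ x, 0 ≤ h x ∧ h x ≤ 1)
    (hmeet : ∀ x ∈ (units : Set G), ∃ k ∈ K, src k = x ∧ h (unitRng k) ≠ 0) :
    ∃ T z : reducedCStarAlgebra G, IsUnit T ∧
      T * unitRep G (hK.levelFn t) = unitRep G (complexify h) * z := by
  set e := hK.levelFn t with he
  set L := indicatorCc hK.isClopen hK.isCompact with hL
  have hLa : ∀ g, L g ≠ 0 → g ∈ K := fun g hg => by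
    by_contra hn
    exact hg (indicator_of_notMem hn _)
  set vf := cutoff (complexify h) L e with hvf
  set q := unitRep G e with hq
  set H := unitRep G (complexify h) with hH
  set v := lam vf with hv
  have hv' : v = H * lam L * q := lam_cutoff _ _ _
  have hvf0 : ∀ g, vf g ≠ 0 → g ∈ K ∧ lev (src g) = t := by
    intro g hg
    rw [hvf, cutoff_apply] at hg
    exact ⟨hLa g (right_ne_zero_of_mul (left_ne_zero_of_mul hg)),
      hK.levelFn_ne_zero (right_ne_zero_of_mul hg)⟩
  have hqq : q * q = q := by rw [hq, ← map_mul, he, hK.levelFn_mul_self]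
  have hqs : star q = q := by rw [hq, ← map_star, he, hK.star_levelFn]
  have hcut : cutoff e L e = ofUnits e := by
    ext g
    rw [cutoff_apply, ofUnits_apply]
    by_cases hg : g ∈ (units : Set G)
    · rw [indicator_of_mem hg]
      have e1 : unitSrc g = unitRng g := Subtype.ext ((src_unit g hg).trans (rng_unit g hg).symm)
      have e2 : L g = 1 := indicator_of_mem (hK.units_subset hg) _
      rw [e1, e2, mul_one, ← ContinuousMap.mul_apply, he, hK.levelFn_mul_self]
    · rw [indicator_of_notMem hg]
      by_contra hne
      refine hg (hK.mem_units (hLa g (right_ne_zero_of_mul (left_ne_zero_of_mul hne))) ?_)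
      have h1 := hK.levelFn_ne_zero (left_ne_zero_of_mul (left_ne_zero_of_mul hne))
      have h2 := hK.levelFn_ne_zero (right_ne_zero_of_mul hne)
      change lev (rng g) = t at h1
      change lev (src g) = t at h2
      rw [← hK.lev_rng, h1, h2]
  have hHq : H * q = q * H := by rw [hH, hq, ← map_mul, ← map_mul, mul_comm]
  have hqv : q * v = unitRep G (complexify h * e) := by
    rw [hv', ← mul_assoc, ← mul_assoc, ← hHq, mul_assoc H, mul_assoc H, hq, ← lam_cutoff, hcut,
      map_mul]
    rfl
  have hvq : v * q = v := by rw [hv', mul_assoc, hqq]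
  set p := conv hcov (adj vf) vf with hp
  set ρ : C((units : Set G), ℂ) := ⟨fun x => p x, p.continuous.comp continuous_subtype_val⟩ with hρ
  -- An arrow in the support of v*v lies in K and has both ends on level t, hence is a unit.
  have hpu : p = ofUnits ρ := by
    ext g
    rw [ofUnits_apply]
    by_cases hg : g ∈ (units : Set G)
    · rw [indicator_of_mem hg]
      change p g = p (rng g)
      rw [rng_unit g hg]
    · rw [indicator_of_notMem hg]
      by_contra hne
      obtain ⟨k, h1, h2, h3⟩ := exists_of_convFun_ne_zero hne
      rw [adj_apply, inver_div h1] at h2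
      obtain ⟨h4, h5⟩ := hvf0 _ (star_ne_zero.1 h2)
      obtain ⟨h6, h7⟩ := hvf0 k h3
      rw [src_div h1.symm] at h5
      have hgK : g ∈ K := by
        have h8 : inver (comp k (inver g)) ∈ K := hK.inver_mem _ h4
        rw [inver_div h1.symm] at h8
        exact (comp_inver_comp_cancel h1) ▸ hK.comp_mem _ h8 _ h6 (src_div h1)
      refine hg (hK.mem_units hgK ?_)
      rw [← hK.lev_rng, h5, h1, h7]
  have hvv : star v * v = unitRep G ρ := by
    rw [hv, ← lam_adj, ← lam_conv hcov, ← hp, hpu]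
    rfl
  have hres : ∀ x : (units : Set G), 0 ≤ (ρ x).re := fun x =>
    le_trans (by positivity) (conv_adj_self_re hcov vf x.2 (src_unit (x : G) x.2))
  have hpos : ∀ x : (units : Set G), lev x = t → 0 < (ρ x).re := by
    intro x hx
    obtain ⟨k, hkK, hks, hkh⟩ := hmeet x x.2
    refine lt_of_lt_of_le ?_ (conv_adj_self_re hcov vf x.2 hks)
    have h1 : vf k ≠ 0 := by
      rw [hvf, cutoff_apply]
      refine mul_ne_zero (mul_ne_zero ?_ ?_) ?_
      · rw [complexify_apply]
        exact_mod_cast hkh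
      · rw [hL, indicatorCc_apply, indicator_of_mem hkK]
        exact one_ne_zero
      · rw [he, hK.levelFn_apply,
          if_pos (show lev (unitSrc k : G) = t from (congrArg lev hks).trans hx)]
        exact one_ne_zero
    positivity
  have hS : 1 - q + q * v + star (v - q * v) * (v - q * v) =
      unitRep G (1 - e + complexify h * e + (ρ - star (complexify h * e) * (complexify h * e))) := by
    rw [star_sub_mul_self hqs hqq, hqv, hvv, hq]
    simp only [map_add, map_sub, map_one, map_mul, map_star]
  obtain ⟨T, hT, hTq⟩ := exists_isUnit_mul_eq hqs hqq hvq (by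
    rw [hS]
    refine IsUnit.map (unitRep G) ?_
    -- The real part is h + ρ − h² on level t, positive since h² ≤ h and ρ > 0 there; off the level
    -- it is 1 + ρ with ρ ≥ 0.
    rw [ContinuousMap.isUnit_iff_forall_ne_zero]
    intro x h0
    have h1 := congrArg Complex.re h0
    simp only [ContinuousMap.add_apply, ContinuousMap.sub_apply, ContinuousMap.one_apply,
      ContinuousMap.mul_apply, ContinuousMap.star_apply, complexify_apply, he,
      hK.levelFn_apply] at h1
    have h2 := h01 x
    by_cases hx : lev x = t
    · have h3 := hpos x hx
      simp [hx] at h1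
      nlinarith
    · have h3 := hres x
      simp [hx] at h1
      linarith)
  exact ⟨T, lam L * q, hT, by rw [hTq, hv', mul_assoc]⟩

/-- Orbits of sufficiently invariant towers meet every nonempty open set. The larger C' and smaller
ε' are allowed so that one tower can serve two functions. -/
theorem exists_meeting_set (hcov : HasCompactOpenCover G) (hmin : IsMinimal G)
    {h : C((units : Set G), ℝ)} (h0 : ∃ x, h x ≠ 0) :
    ∃ (C : Set G) (ε : ℝ), IsCompact C ∧ 0 < ε ∧ ∀ C' ε' K lev, IsCompact C' → C ⊆ C' → ε' ≤ ε →
      IsTower K lev → IsAlmostInvariant C' ε' K →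
      ∀ x ∈ (units : Set G), ∃ k ∈ K, src k = x ∧ h (unitRng k) ≠ 0 := by
  set O : Set G := (↑) '' {x : (units : Set G) | h x ≠ 0} with hO
  have hOo : IsOpen O := (isOpen_units G).isOpenMap_subtype_val _
    (isOpen_ne_fun h.continuous continuous_const)
  have hOu : O ⊆ units := by rintro _ ⟨x, -, rfl⟩; exact x.2
  obtain ⟨x₀, hx₀⟩ := h0
  obtain ⟨C, hC, hCO⟩ := exists_compact_translate hcov hmin hOo hOu ⟨x₀, x₀, hx₀, rfl⟩
  obtain ⟨M, hM⟩ := exists_encard_rng_le hC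
  -- With no point over O, `IsAlmostInvariant.le_good` would give n ≤ Mε'n < n.
  refine ⟨C, 1 / (M + 1), hC, by positivity, fun C' ε' K lev hC' hsub hε hK hinv x hx => ?_⟩
  have h1 := hinv.le_good hK hC' hsub hM hCO hx
  have hn : (0 : ℝ) < (fib K x).ncard := by exact_mod_cast hK.fib_pos hx
  by_contra! hno
  have h2 : {k ∈ fib K x | rng k ∈ O} = ∅ := by
    refine eq_empty_of_forall_notMem fun k hk => ?_
    obtain ⟨⟨hkK, hks⟩, y, hy, e⟩ := hk
    refine hy ?_
    have : y = unitRng k := Subtype.ext e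
    rw [this]
    exact hno k hkK hks
  rw [h2, ncard_empty, Nat.cast_zero, zero_add] at h1
  have h3 : (M : ℝ) * (ε' * (fib K x).ncard) ≤ M * (1 / (M + 1) * (fib K x).ncard) := by gcongr
  have h4 : (M : ℝ) * (1 / (M + 1) * (fib K x).ncard) < (fib K x).ncard := by
    rw [← mul_assoc, mul_one_div]
    have : (M : ℝ) / (M + 1) < 1 := by
      rw [div_lt_one (by positivity)]
      linarith
    nlinarith
  linarith

/-- An element with functions on the unit space as left and right annihilators can be moved by
invertible elements to one annihilated by a clopen set. -/
theorem exists_clopen_annihilator (hmin : IsMinimal G) (haf : AlmostFinite G)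
    {a : reducedCStarAlgebra G} {h k : C((units : Set G), ℝ)}
    (hh : ∀ x, 0 ≤ h x ∧ h x ≤ 1) (hk : ∀ x, 0 ≤ k x ∧ k x ≤ 1) (hh0 : ∃ x, h x ≠ 0)
    (hk0 : ∃ x, k x ≠ 0) (hah : a * unitRep G (complexify h) = 0)
    (hka : unitRep G (complexify k) * a = 0) :
    ∃ (S T : reducedCStarAlgebra G) (K : Set G) (lev : G → ℕ) (hK : IsTower K lev) (t : ℕ),
      IsUnit S ∧ IsUnit T ∧ (∃ x ∈ (units : Set G), lev x = t) ∧
      S * a * T * unitRep G (hK.levelFn t) = 0 ∧ unitRep G (hK.levelFn t) * (S * a * T) = 0 := by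
  have hcov : HasCompactOpenCover G := haf.1
  obtain ⟨C₁, ε₁, hC₁, hε₁, H₁⟩ := exists_meeting_set hcov hmin hh0
  obtain ⟨C₂, ε₂, hC₂, hε₂, H₂⟩ := exists_meeting_set hcov hmin hk0
  obtain ⟨K, lev, hK, hinv⟩ := haf.exists_isTower (hC₁.union hC₂) (lt_min hε₁ hε₂)
  have m₁ := H₁ _ _ K lev (hC₁.union hC₂) subset_union_left (min_le_left _ _) hK hinv
  have m₂ := H₂ _ _ K lev (hC₁.union hC₂) subset_union_right (min_le_right _ _) hK hinv
  obtain ⟨x, -⟩ := hh0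
  -- Any occupied level serves; using the same one on both sides gives a single two-sided
  -- annihilator.
  obtain ⟨T, z, hT, hTz⟩ := hK.exists_isUnit_mul_level hcov (lev x) h hh m₁
  obtain ⟨S, y, hS, hSy⟩ := hK.exists_isUnit_mul_level hcov (lev x) k hk m₂
  have hks : star (complexify k) = complexify k := by
    ext x
    simp [complexify_apply]
  have hSy' : unitRep G (hK.levelFn (lev x)) * star S = star y * unitRep G (complexify k) := by
    have := congrArg star hSy
    rwa [star_mul, star_mul, ← map_star, ← map_star, hK.star_levelFn, hks] at this
  refine ⟨star S, T, K, lev, hK, lev x, hS.star, hT, ⟨x, x.2, rfl⟩, ?_, ?_⟩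
  · rw [mul_assoc, hTz, mul_assoc, ← mul_assoc a, hah, zero_mul, mul_zero]
  · rw [← mul_assoc, ← mul_assoc, hSy', mul_assoc (star y), hka, mul_zero, zero_mul]

end Level

/-! ### Counting with two scales of towers. -/

section Counting

variable {G : Type*} [TopologicalSpace G] [EtaleGroupoid G]

/-- A K-orbit is, apart from the excluded points, made of whole K₁-orbits, so a density bound for B
in K₁-orbits passes to K-orbits. The proof is a double count of pairs in a common K₁-orbit, weighted
by the inverse orbit size n. -/
theorem IsTower.sum_card_le {K K₁ B : Set G} {lev lev₁ : G → ℕ} (hK : IsTower K lev)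
    (hK₁ : IsTower K₁ lev₁) {θ : ℝ}
    (hθ : ∀ x ∈ (units : Set G), ({k ∈ fib K₁ x | rng k ∈ B}.ncard : ℝ) ≤ θ * (fib K₁ x).ncard)
    (x : G) :
    ({k ∈ fib K x | rng k ∈ B ∧ rng k ∉ src '' (K₁ \ K)}.ncard : ℝ) ≤ θ * (fib K x).ncard := by
  classical
  have hfin := finite_fib hK.isCompact x
  set S := hfin.toFinset with hS
  have hSm : ∀ k, k ∈ S ↔ k ∈ K ∧ src k = x := fun k => Finite.mem_toFinset _
  set P := S.filter fun k => rng k ∈ B ∧ rng k ∉ src '' (K₁ \ K) with hP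
  set n : G → ℕ := fun k => (fib K₁ (rng k)).ncard with hn
  have hn0 : ∀ k, (0 : ℝ) < n k := fun k => by exact_mod_cast hK₁.fib_pos (rng_mem k)
  have hcard : ({k ∈ fib K x | rng k ∈ B ∧ rng k ∉ src '' (K₁ \ K)}.ncard : ℝ) = P.card := by
    rw [← ncard_coe_finset]
    congr 2
    ext k
    simp [hP, hSm, fib]
  have hcardS : ((fib K x).ncard : ℝ) = S.card := by
    rw [ncard_eq_toFinset_card _ hfin]
  have hnn : ∀ k l, src l = src k → comp l (inver k) ∈ K₁ → n k ≤ n l := by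
    intro k l e hl
    refine ncard_le_ncard_of_injOn (fun a => comp a (inver (comp l (inver k)))) ?_ ?_
      (finite_fib hK₁.isCompact _)
    · rintro a ⟨ha, hs⟩
      have e1 : src a = src (comp l (inver k)) := by rw [hs, src_div e]
      exact ⟨hK₁.div_mem ha hl e1, by rw [src_div e1, rng_div e]⟩
    · rintro a ⟨_, hs⟩ b ⟨_, hs'⟩ hab
      exact comp_inver_left_inj (by rw [hs, src_div e]) (by rw [hs', src_div e]) hab
  -- The K₁-orbit of such a k stays inside K, so all its n k points occur among the l.
  have h1 : ∀ k ∈ P, (1 : ℝ) ≤ ∑ l ∈ S with comp l (inver k) ∈ K₁, (n k : ℝ)⁻¹ := by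
    intro k hk
    rw [hP, Finset.mem_filter, hSm] at hk
    rw [Finset.sum_const, nsmul_eq_mul, ← div_eq_mul_inv, one_le_div (hn0 k)]
    have : n k ≤ ((S.filter fun l => comp l (inver k) ∈ K₁ : Finset G) : Set G).ncard := by
      refine ncard_le_ncard_of_injOn (fun a => comp a k) ?_ ?_ (Finset.finite_toSet _)
      · rintro a ⟨ha, hs⟩
        have haK : a ∈ K := by
          by_contra hna
          exact hk.2.2 ⟨a, ⟨ha, hna⟩, hs⟩
        simp only [Finset.coe_filter, mem_ofPred_eq, hSm]
        refine ⟨⟨hK.comp_mem a haK k hk.1.1 hs, ?_⟩, ?_⟩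
        · rw [src_comp _ _ hs, hk.1.2]
        · rwa [comp_inver_cancel hs]
      · rintro a ⟨_, hs⟩ b ⟨_, hs'⟩ hab
        exact comp_right_cancel hs hs' hab
    rw [ncard_coe_finset] at this
    exact_mod_cast this
  -- Comparing n k with n l inside one K₁-orbit bounds this sum by the density of B in the K₁-orbit
  -- of l.
  have h2 : ∀ l ∈ S, ∑ k ∈ P with comp l (inver k) ∈ K₁, (n k : ℝ)⁻¹ ≤ θ := by
    intro l hl
    rw [hSm] at hl
    have hle : ∑ k ∈ P with comp l (inver k) ∈ K₁, (n k : ℝ)⁻¹ ≤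
        ∑ k ∈ P with comp l (inver k) ∈ K₁, (n l : ℝ)⁻¹ := by
      refine Finset.sum_le_sum fun k hk => ?_
      rw [Finset.mem_filter, hP, Finset.mem_filter, hSm] at hk
      have e : src k = src l := by rw [hk.1.1.2, hl.2]
      have : n l ≤ n k := hnn l k e (by
        rw [← inver_div e.symm]
        exact hK₁.inver_mem _ hk.2)
      exact inv_anti₀ (hn0 l) (by exact_mod_cast this)
    refine hle.trans ?_
    rw [Finset.sum_const, nsmul_eq_mul, ← div_eq_mul_inv, div_le_iff₀ (hn0 l)]
    refine le_trans ?_ (hθ (rng l) (rng_mem l))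
    have : ((P.filter fun k => comp l (inver k) ∈ K₁ : Finset G) : Set G).ncard ≤
        {k ∈ fib K₁ (rng l) | rng k ∈ B}.ncard := by
      refine ncard_le_ncard_of_injOn (fun k => comp k (inver l)) ?_ ?_
        ((finite_fib hK₁.isCompact _).subset (sep_subset _ _))
      · intro k hk
        simp only [Finset.coe_filter, mem_ofPred_eq, hP, Finset.mem_filter, hSm] at hk
        have e : src k = src l := by rw [hk.1.1.2, hl.2]
        refine ⟨⟨?_, src_div e⟩, ?_⟩
        · rw [← inver_div e.symm]
          exact hK₁.inver_mem _ hk.2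
        · rw [rng_div e]
          exact hk.1.2.1
      · intro k hk k' hk' hkk
        simp only [Finset.coe_filter, mem_ofPred_eq, hP, Finset.mem_filter, hSm] at hk hk'
        exact comp_inver_left_inj (by rw [hk.1.1.2, hl.2]) (by rw [hk'.1.1.2, hl.2]) hkk
    rw [ncard_coe_finset] at this
    exact_mod_cast this
  rw [hcard, hcardS]
  calc (P.card : ℝ) = ∑ k ∈ P, (1 : ℝ) := by simp
    _ ≤ ∑ k ∈ P, ∑ l ∈ S with comp l (inver k) ∈ K₁, (n k : ℝ)⁻¹ := Finset.sum_le_sum h1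
    _ = ∑ l ∈ S, ∑ k ∈ P with comp l (inver k) ∈ K₁, (n k : ℝ)⁻¹ := by
        refine Finset.sum_comm' fun k l => ?_
        simp only [Finset.mem_filter]
        tauto
    _ ≤ ∑ l ∈ S, θ := Finset.sum_le_sum h2
    _ = θ * S.card := by rw [Finset.sum_const, nsmul_eq_mul, mul_comm]

/-- In the unit r = n/(16M): good ≥ 15r, bad₂ ≤ r, bad₁ ≤ 2r and N + 1 ≤ 2r. -/
theorem count_inequality {m n M N ε M₂ good bad₁ bad₂ bad₁' : ℝ} (hM : 1 ≤ M) (hn : 0 < n)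
    (hM₂ : 0 ≤ M₂) (hε : ε * (16 * M * (M₂ + 1)) ≤ 1) (hε0 : 0 < ε) (hm : 8 * M * (N + 1) ≤ m)
    (hmn : m ≤ n)
    (hgood : n ≤ M * (good + ε * n)) (h₂ : bad₂ ≤ M₂ * (ε * n))
    (h₁' : bad₁' ≤ 1 / (16 * M) * n) (h₁ : bad₁ ≤ bad₁' + bad₂) : bad₁ + bad₂ + N < good := by
  have hM0 : 0 < M := by linarith
  set r := n / (16 * M) with hr
  have hr0 : 0 < r := by positivity
  have hnr : n = 16 * M * r := by rw [hr]; field_simp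
  have e1 : ε * (M₂ + 1) * n ≤ r := by
    rw [hnr]
    nlinarith
  have e2 : ε * n ≤ r := by nlinarith [mul_nonneg (mul_nonneg hε0.le hM₂) hn.le]
  have e3 : M₂ * (ε * n) ≤ r := by nlinarith [mul_pos hε0 hn]
  have e4 : 16 * r ≤ good + ε * n := by
    have : M * (16 * r) ≤ M * (good + ε * n) := by linarith
    exact le_of_mul_le_mul_left this hM0
  have e5 : N + 1 ≤ 2 * r := by
    have : 8 * M * (N + 1) ≤ 8 * M * (2 * r) := by linarith
    exact le_of_mul_le_mul_left this (by positivity)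
  have e6 : 1 / (16 * M) * n = r := by rw [hr]; ring
  linarith

variable [T2Space G] [CompactSpace (units : Set G)]

/-- Two scales of towers: arrows of `C` whose range avoids a small clopen set `B` belong to the
inner tower `K₁` and to the outer tower `K`, whose orbits contain many more points of `U` than
of `B`. -/
theorem exists_two_towers (hmin : IsMinimal G) (haf : AlmostFinite G)
    (hinf : ∀ x ∈ (units : Set G), {g : G | src g = x}.Infinite) {U : Set G} (hUo : IsOpen U)
    (hUu : U ⊆ units) (hUne : U.Nonempty) {C : Set G} (hC : IsCompact C) :
    ∃ (K₁ K B : Set G) (lev₁ lev : G → ℕ) (N : ℕ), IsTower K₁ lev₁ ∧ IsTower K lev ∧ IsClopen B ∧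
      (∀ g ∈ C, rng g ∉ B → g ∈ K₁ ∧ g ∈ K) ∧ (∀ x, (fib K₁ x).ncard ≤ N) ∧
      ∀ x ∈ (units : Set G), {k ∈ fib K x | rng k ∈ B}.ncard + N <
        {k ∈ fib K x | rng k ∈ U}.ncard := by
  have hcov : HasCompactOpenCover G := haf.1
  obtain ⟨C₁, hC₁, hC₁o, hCC₁, hC₁s⟩ := hcov.exists_compact_open hC
  -- C₁ is symmetric so that a condition on ranges of arrows of C becomes one on sources of their
  -- inverses, and open so that the bad sets are clopen.
  obtain ⟨C', hC', hC'U⟩ := exists_compact_translate hcov hmin hUo hUu hUne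
  obtain ⟨M₀, hM₀⟩ := exists_encard_rng_le hC'
  obtain ⟨M₁, hM₁⟩ := exists_encard_rng_le hC₁
  set M : ℕ := M₀ + 1 with hM
  have hMC : ∀ y, {g ∈ C' | rng g = y}.encard ≤ M := fun y =>
    (hM₀ y).trans (by rw [hM]; exact_mod_cast Nat.le_succ _)
  have hM1 : (1 : ℝ) ≤ M := by rw [hM]; push_cast; linarith [Nat.cast_nonneg (α := ℝ) M₀]
  obtain ⟨K₁, lev₁, hK₁, hinv₁⟩ := haf.exists_isTower hC₁
    (show (0 : ℝ) < 1 / (16 * M * (M₁ + 1)) by positivity)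
  have hθ : ∀ x ∈ (units : Set G), ({k ∈ fib K₁ x | rng k ∈ src '' (C₁ \ K₁)}.ncard : ℝ) ≤
      1 / (16 * M) * (fib K₁ x).ncard := by
    intro x hx
    refine (hinv₁.bad_le hK₁ hC₁ subset_rfl hM₁ hx).trans ?_
    rw [← mul_assoc]
    gcongr
    rw [mul_one_div, div_le_div_iff₀ (by positivity) (by positivity)]
    nlinarith
  obtain ⟨N, hN⟩ := exists_encard_src_le hK₁.isCompact
  have hN' : ∀ x, (fib K₁ x).ncard ≤ N := fun x => by
    have := hN x
    rw [show {g ∈ K₁ | src g = x} = fib K₁ x from rfl,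
      ← (finite_fib hK₁.isCompact x).cast_ncard_eq] at this
    exact_mod_cast this
  have hC₂ : IsCompact (C₁ ∪ K₁) := hC₁.union hK₁.isCompact
  obtain ⟨M₂, hM₂⟩ := exists_encard_rng_le hC₂
  -- The outer orbits must be large compared with the bound N on the inner ones; this is where
  -- infinite source fibres are needed.
  set m : ℕ := 8 * M * (N + 1) with hm
  obtain ⟨C'', hC'', hC''m⟩ := exists_compact_le_encard hcov hinf m
  -- The sum in the denominator serves both the density estimates and the lower bound m on the orbit
  -- size.
  set ε : ℝ := 1 / (16 * M * (M₂ + 1) + m) with hε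
  have hε0 : 0 < ε := by positivity
  have hCa : IsCompact ((C₁ ∪ K₁) ∪ C' ∪ C'') := (hC₂.union hC').union hC''
  obtain ⟨K, lev, hK, hinv⟩ := haf.exists_isTower hCa hε0
  have hε1 : ε * (16 * M * (M₂ + 1)) ≤ 1 := by
    rw [hε, one_div_mul_eq_div, div_le_one (by positivity)]
    linarith [Nat.cast_nonneg (α := ℝ) m]
  have hε2 : ε * m ≤ 1 := by
    rw [hε, one_div_mul_eq_div, div_le_one (by positivity)]
    have : (0 : ℝ) ≤ 16 * M * (M₂ + 1) := by positivity
    linarith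
  set B₁ : Set G := src '' (C₁ \ K₁) with hB₁
  -- B₁ collects the units where C₁ leaves K₁. B₂ also includes the units where K₁ leaves K, which
  -- are exactly the exceptions in `IsTower.sum_card_le`.
  set B₂ : Set G := src '' ((C₁ ∪ K₁) \ K) with hB₂
  have hB₁c : IsClopen B₁ := isClopen_image_src (hC₁.diff hK₁.isOpen)
    (hC₁o.sdiff hK₁.isCompact.isClosed)
  have hB₂c : IsClopen B₂ := isClopen_image_src (hC₂.diff hK.isOpen)
    ((hC₁o.union hK₁.isOpen).sdiff hK.isCompact.isClosed)
  refine ⟨K₁, K, B₁ ∪ B₂, lev₁, lev, N, hK₁, hK, hB₁c.union hB₂c, ?_, hN', ?_⟩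
  · intro g hg hgB
    have hgi : inver g ∈ C₁ := by
      have : g ∈ inver ⁻¹' C₁ := by rw [hC₁s]; exact hCC₁ hg
      exact this
    have h1 : inver g ∈ K₁ := by
      by_contra hn
      exact hgB (Or.inl ⟨inver g, ⟨hgi, hn⟩, src_inver g⟩)
    have h2 : inver g ∈ K := by
      by_contra hn
      exact hgB (Or.inr ⟨inver g, ⟨Or.inl hgi, hn⟩, src_inver g⟩)
    rw [← inver_inver g]
    exact ⟨hK₁.inver_mem _ h1, hK.inver_mem _ h2⟩
  · intro x hx
    have hfin := finite_fib hK.isCompact x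
    have hgood := hinv.le_good hK hCa (subset_union_right.trans subset_union_left) hMC hC'U hx
    have hbad := hinv.bad_le hK hCa (subset_union_left.trans subset_union_left) hM₂ hx
    have hsize := hinv.le_ncard_fib hK hCa subset_union_right hε2 hε0.le hx (hC''m x hx)
    have hmass := hK.sum_card_le hK₁ hθ x
    have hsplit : {k ∈ fib K x | rng k ∈ B₁}.ncard ≤
        {k ∈ fib K x | rng k ∈ B₁ ∧ rng k ∉ src '' (K₁ \ K)}.ncard +
          {k ∈ fib K x | rng k ∈ B₂}.ncard := by
      refine (ncard_le_ncard ?_ ?_).trans (ncard_union_le _ _)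
      · rintro k ⟨hk, hkB⟩
        by_cases h : rng k ∈ src '' (K₁ \ K)
        · exact Or.inr ⟨hk, image_mono (sdiff_subset_sdiff_left subset_union_right) h⟩
        · exact Or.inl ⟨hk, hkB, h⟩
      · exact (hfin.subset (sep_subset _ _)).union (hfin.subset (sep_subset _ _))
    have hunion : {k ∈ fib K x | rng k ∈ B₁ ∪ B₂}.ncard ≤
        {k ∈ fib K x | rng k ∈ B₁}.ncard + {k ∈ fib K x | rng k ∈ B₂}.ncard := by
      refine (ncard_le_ncard ?_ ?_).trans (ncard_union_le _ _)
      · rintro k ⟨hk, hkB | hkB⟩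
        · exact Or.inl ⟨hk, hkB⟩
        · exact Or.inr ⟨hk, hkB⟩
      · exact (hfin.subset (sep_subset _ _)).union (hfin.subset (sep_subset _ _))
    have key := count_inequality (m := m) (N := N)
      (bad₁ := ({k ∈ fib K x | rng k ∈ B₁}.ncard : ℝ)) hM1
      (by exact_mod_cast hK.fib_pos hx) (Nat.cast_nonneg M₂) hε1 hε0
      (by rw [hm]; push_cast; exact le_rfl) (by exact_mod_cast hsize) hgood hbad hmass
      (by exact_mod_cast hsplit)
    have key' : {k ∈ fib K x | rng k ∈ B₁}.ncard + {k ∈ fib K x | rng k ∈ B₂}.ncard + N <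
        {k ∈ fib K x | rng k ∈ U}.ncard := by exact_mod_cast key
    omega

end Counting

/-! ### Ranks in orbits, and bisections matching two orderings. -/

section Rank

/-- The rank of an element of `S`, the number of elements with smaller key, is less than `#S`. -/
theorem rank_lt_card {α : Type*} {S : Set α} (hS : S.Finite) (key : α → ℕ) {a : α} (ha : a ∈ S) :
    {b ∈ S | key b < key a}.ncard < S.ncard :=
  ncard_lt_ncard ⟨sep_subset _ _, fun h => (h ha).2.false⟩ hS

theorem rank_inj {α : Type*} {S : Set α} (hS : S.Finite) {key : α → ℕ} (hkey : InjOn key S) {a b : α}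
    (ha : a ∈ S) (hb : b ∈ S)
    (h : {c ∈ S | key c < key a}.ncard = {c ∈ S | key c < key b}.ncard) : a = b := by
  have aux : ∀ a ∈ S, ∀ b ∈ S, key a < key b →
      {c ∈ S | key c < key a}.ncard < {c ∈ S | key c < key b}.ncard := by
    intro a ha b _ hab
    refine ncard_lt_ncard ⟨fun c hc => ⟨hc.1, hc.2.trans hab⟩, fun h => ?_⟩
      (hS.subset (sep_subset _ _))
    exact (h (show a ∈ _ from ⟨ha, hab⟩)).2.false
  rcases lt_trichotomy (key a) (key b) with hlt | heq | hgt
  · exact absurd h (aux a ha b hb hlt).ne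
  · exact hkey ha hb heq
  · exact absurd h (aux b hb a ha hgt).ne'

theorem exists_rank_eq {α : Type*} {S : Set α} (hS : S.Finite) {key : α → ℕ} (hkey : InjOn key S)
    {n : ℕ} (hn : n < S.ncard) : ∃ a ∈ S, {b ∈ S | key b < key a}.ncard = n := by
  classical
  have himg : (fun a => {b ∈ S | key b < key a}.ncard) '' S = Iio S.ncard := by
    refine eq_of_subset_of_ncard_le ?_ ?_ (finite_Iio _)
    · rintro _ ⟨a, ha, rfl⟩
      exact rank_lt_card hS key ha
    · rw [InjOn.ncard_image fun a ha b hb h => rank_inj hS hkey ha hb h]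
      rw [ncard_eq_toFinset_card' (Iio S.ncard)]
      simp
  have : n ∈ (fun a => {b ∈ S | key b < key a}.ncard) '' S := by rw [himg]; exact hn
  exact this

variable {G : Type*} [TopologicalSpace G] [EtaleGroupoid G]

/-- The count is the convolution of 1_D with the constant 1: continuous and integer-valued. -/
theorem isLocallyConstant_ncard_rng [T2Space G] (hcov : HasCompactOpenCover G) {D : Set G}
    (hc : IsCompact D) (ho : IsOpen D) :
    IsLocallyConstant fun x : G => {h ∈ D | rng h = rng x}.ncard := by
  classical
  have hcl : IsClopen D := ⟨hc.isClosed, ho⟩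
  have h1 : ∀ x, convFun (indicatorCc hcl hc) 1 x = ({h ∈ D | rng h = rng x}.ncard : ℂ) := by
    intro x
    have hfin := finite_support_convKernel (indicatorCc hcl hc) x
    have hone : ∀ k ∈ hfin.toFinset, convKernel (indicatorCc hcl hc) x k * (1 : G → ℂ) k = 1 := by
      intro k hk
      rw [Finite.mem_toFinset] at hk
      obtain ⟨e, h⟩ := convKernel_ne_zero hk
      rw [convKernel_of_eq e, indicatorCc_apply, indicator_of_mem]
      · simp
      · by_contra hn
        exact h (indicator_of_notMem hn _)
    unfold convFun
    rw [tsum_eq_sum (s := hfin.toFinset), Finset.sum_congr rfl hone, Finset.sum_const, nsmul_eq_mul,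
      mul_one]
    · rw [← ncard_eq_toFinset_card _ hfin]
      congr 1
      refine ncard_congr (fun k _ => comp x (inver k)) ?_ ?_ ?_
      · intro k hk
        obtain ⟨e, h⟩ := convKernel_ne_zero hk
        refine ⟨?_, rng_div e⟩
        by_contra hn
        exact h (indicator_of_notMem hn _)
      · intro k l hk hl e
        exact comp_inver_right_inj (convKernel_ne_zero hk).1 (convKernel_ne_zero hl).1 e
      · rintro h ⟨hD, hr⟩
        have e1 : src (inver h) = rng x := by rw [src_inver, hr]
        have e2 : src x = src (comp (inver h) x) := (src_comp _ _ e1).symm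
        have e3 : comp x (inver (comp (inver h) x)) = h := by
          rw [inver_comp e1, inver_inver, ← assoc _ _ _ (by rw [rng_inver])
            (by rw [src_inver, hr]), mul_inver, ← hr, rng_mul_self]
        refine ⟨comp (inver h) x, ?_, e3⟩
        show convKernel _ _ _ ≠ 0
        rw [convKernel_of_eq e2, e3, indicatorCc_apply, indicator_of_mem hD]
        exact one_ne_zero
    · intro k hk
      rw [Finite.mem_toFinset] at hk
      by_contra hne
      exact hk (left_ne_zero_of_mul hne)
  have h2 : Continuous fun x : G => ({h ∈ D | rng h = rng x}.ncard : ℝ) := by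
    have := Complex.continuous_re.comp (continuous_convFun hcov (indicatorCc hcl hc)
      (continuous_const (y := (1 : ℂ))))
    refine this.congr fun x => ?_
    have h3 := h1 x
    simp only [Function.comp_apply]
    rw [show (fun _ : G => (1 : ℂ)) = 1 from rfl, h3, Complex.natCast_re]
  rw [IsLocallyConstant.iff_continuous]
  exact Nat.isClosedEmbedding_coe_real.isInducing.continuous_iff.2 h2

/-- The rank of (the range of) `x` in its `K`-orbit, with respect to a key on the unit space. -/
noncomputable def orbitRank (K : Set G) (key : G → ℕ) (x : G) : ℕ :=
  {h ∈ {h ∈ K | key (src h) < key (rng h)} | rng h = rng x}.ncard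

theorem isLocallyConstant_orbitRank [T2Space G] (hcov : HasCompactOpenCover G) {K : Set G}
    {lev key : G → ℕ} (hK : IsTower K lev) (hkey : IsLocallyConstant key) :
    IsLocallyConstant (orbitRank K key) := by
  have h1 : IsClopen {h : G | key (src h) < key (rng h)} := by
    have h2 := ((hkey.comp_continuous continuous_src).prodMk
      (hkey.comp_continuous continuous_rng)).comp fun p : ℕ × ℕ => p.1 < p.2
    have h3 := h2.isClopen_fiber True
    convert h3 using 2
    ext h
    simp
  exact isLocallyConstant_ncard_rng hcov (hK.isCompact.inter_right h1.isClosed)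
    (hK.isOpen.inter h1.isOpen)

theorem orbitRank_rng (K : Set G) (key : G → ℕ) (x : G) :
    orbitRank K key (rng x) = orbitRank K key x := by
  unfold orbitRank
  rw [rng_rng]

/-- The bijection h ↦ h⁻¹k moves the base point of the orbit from r(k) to x. -/
theorem IsTower.orbitRank_eq {K : Set G} {lev : G → ℕ} (hK : IsTower K lev) (key : G → ℕ) {x k : G}
    (hk : k ∈ fib K x) :
    orbitRank K key k = {l ∈ fib K x | key (rng l) < key (rng k)}.ncard := by
  refine ncard_congr (fun h _ => comp (inver h) k) ?_ ?_ ?_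
  · rintro h ⟨⟨hh, hlt⟩, hr⟩
    have e : src (inver h) = rng k := by rw [src_inver, hr]
    refine ⟨⟨hK.comp_mem _ (hK.inver_mem _ hh) _ hk.1 e, by rw [src_comp _ _ e, hk.2]⟩, ?_⟩
    rw [rng_comp _ _ e, rng_inver, ← hr]
    exact hlt
  · rintro h h' ⟨_, hr⟩ ⟨_, hr'⟩ e
    exact inver_injective (comp_right_cancel (by rw [src_inver, hr]) (by rw [src_inver, hr']) e)
  · rintro l ⟨⟨hl, hs⟩, hlt⟩
    have e : src k = src l := by rw [hk.2, hs]
    refine ⟨comp k (inver l), ⟨⟨hK.div_mem hk.1 hl e, ?_⟩, rng_div e⟩, ?_⟩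
    · rw [src_div e, rng_div e]
      exact hlt
    · rw [inver_div e, comp_inver_comp_cancel e.symm]

theorem IsTower.self_mem_fib {K : Set G} {lev : G → ℕ} (hK : IsTower K lev) {x : G}
    (hx : x ∈ (units : Set G)) : x ∈ fib K x := ⟨hK.units_subset hx, src_unit x hx⟩

/-- Two keys which are injective on the orbits of `K` give a full bisection matching the ranks. -/
theorem IsTower.exists_matching [T2Space G] (hcov : HasCompactOpenCover G) {K : Set G}
    {lev key key' : G → ℕ} (hK : IsTower K lev) (hkey : IsLocallyConstant key)
    (hkey' : IsLocallyConstant key')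
    (hinj : ∀ x, InjOn (fun k => key (rng k)) (fib K x))
    (hinj' : ∀ x, InjOn (fun k => key' (rng k)) (fib K x)) :
    ∃ W : Set G, IsCompact W ∧ IsOpen W ∧ IsGSet W ∧ src '' W = units ∧ rng '' W = units ∧
      W ⊆ K ∧ ∀ w ∈ W, orbitRank K key w = orbitRank K key' (src w) := by
  have hloc := isLocallyConstant_orbitRank hcov hK hkey
  have hloc' := isLocallyConstant_orbitRank hcov hK hkey'
  have hcl : IsClopen {w : G | orbitRank K key w = orbitRank K key' (src w)} := by
    have h2 := (hloc.prodMk (hloc'.comp_continuous continuous_src)).comp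
      fun p : ℕ × ℕ => p.1 = p.2
    have h3 := h2.isClopen_fiber True
    convert h3 using 2
    ext h
    simp
  -- Each admissible rank is taken exactly once per orbit by either key, so exactly one such arrow
  -- leaves and exactly one enters each unit.
  refine ⟨K ∩ {w : G | orbitRank K key w = orbitRank K key' (src w)},
    hK.isCompact.inter_right hcl.isClosed, hK.isOpen.inter hcl.isOpen, ⟨?_, ?_⟩, ?_, ?_,
    inter_subset_left, fun w hw => hw.2⟩
  · rintro w ⟨hw, hwr⟩ w' ⟨hw', hwr'⟩ e
    have m : inver w ∈ fib K (rng w) := ⟨hK.inver_mem _ hw, src_inver w⟩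
    have m' : inver w' ∈ fib K (rng w) := ⟨hK.inver_mem _ hw', by rw [src_inver, e]⟩
    refine inver_injective (rank_inj (finite_fib hK.isCompact (rng w)) (hinj' (rng w)) m m' ?_)
    rw [← hK.orbitRank_eq key' m, ← hK.orbitRank_eq key' m', ← orbitRank_rng, rng_inver, ← hwr,
      ← orbitRank_rng K key' (inver w'), rng_inver, ← hwr', ← orbitRank_rng, e, orbitRank_rng]
  · rintro w ⟨hw, hwr⟩ w' ⟨hw', hwr'⟩ e
    have m : w ∈ fib K (src w) := ⟨hw, rfl⟩
    have m' : w' ∈ fib K (src w) := ⟨hw', e.symm⟩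
    refine rank_inj (finite_fib hK.isCompact (src w)) (hinj (src w)) m m' ?_
    rw [← hK.orbitRank_eq key m, ← hK.orbitRank_eq key m', hwr, hwr', e]
  · refine Subset.antisymm (by rintro _ ⟨w, -, rfl⟩; exact src_mem w) fun x hx => ?_
    have hfin := finite_fib hK.isCompact x
    have hm := hK.self_mem_fib hx
    obtain ⟨k, hk, hkr⟩ := exists_rank_eq hfin (hinj x)
      (n := orbitRank K key' x) (by rw [hK.orbitRank_eq key' hm]; exact rank_lt_card hfin _ hm)
    refine ⟨k, ⟨hk.1, ?_⟩, hk.2⟩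
    rw [mem_ofPred_eq, hK.orbitRank_eq key hk, hkr, hk.2]
  · refine Subset.antisymm (by rintro _ ⟨w, -, rfl⟩; exact rng_mem w) fun x hx => ?_
    have hfin := finite_fib hK.isCompact x
    have hm := hK.self_mem_fib hx
    obtain ⟨k, hk, hkr⟩ := exists_rank_eq hfin (hinj' x)
      (n := orbitRank K key x) (by rw [hK.orbitRank_eq key hm]; exact rank_lt_card hfin _ hm)
    refine ⟨inver k, ⟨hK.inver_mem _ hk.1, ?_⟩, by rw [rng_inver, hk.2]⟩
    rw [mem_ofPred_eq, src_inver, orbitRank_rng, hK.orbitRank_eq key' hk, hkr,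
      ← orbitRank_rng K key (inver k), rng_inver, hk.2]

end Rank

/-! ### The two orderings of orbits and the lowering bisection. -/

section Keys

variable {G : Type*} [TopologicalSpace G] [EtaleGroupoid G]

/-- The lowest level of the class of (the range of) `x` under the subgroupoid `D`. -/
noncomputable def classMin (D : Set G) (lev : G → ℕ) (x : G) : ℕ :=
  sInf (lev '' fib D (rng x))

variable {K K₁ : Set G} {lev lev₁ : G → ℕ}

theorem exists_classMin (hK : IsTower K lev) (hK₁ : IsTower K₁ lev₁) (x : G) :
    ∃ a ∈ fib (K₁ ∩ K) (rng x), lev a = classMin (K₁ ∩ K) lev x := by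
  have : (lev '' fib (K₁ ∩ K) (rng x)).Nonempty :=
    ⟨_, rng x, ⟨⟨hK₁.units_subset (rng_mem x), hK.units_subset (rng_mem x)⟩, src_rng x⟩, rfl⟩
  exact Nat.sInf_mem this

theorem classMin_rng (D : Set G) (lev : G → ℕ) (x : G) :
    classMin D lev (rng x) = classMin D lev x := by
  unfold classMin
  rw [rng_rng]

/-- The sublevel set for n is the preimage under r of the source image of a compact open set of
arrows, hence clopen. -/
theorem isLocallyConstant_classMin [T2Space G] (hK : IsTower K lev) (hK₁ : IsTower K₁ lev₁) :
    IsLocallyConstant (classMin (K₁ ∩ K) lev) := by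
  have hle : ∀ n, IsClopen {x : G | classMin (K₁ ∩ K) lev x ≤ n} := by
    intro n
    have hlev : IsClopen {g : G | lev g ≤ n} := by
      have h3 := (hK.lev_loc.comp fun m => m ≤ n).isClopen_fiber True
      convert h3 using 2
      ext h
      simp
    have h1 : IsClopen (src '' ((K₁ ∩ K) ∩ {g : G | lev g ≤ n})) :=
      isClopen_image_src ((hK₁.isCompact.inter hK.isCompact).inter_right hlev.isClosed)
        ((hK₁.isOpen.inter hK.isOpen).inter hlev.isOpen)
    have h2 : {x : G | classMin (K₁ ∩ K) lev x ≤ n} =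
        rng ⁻¹' (src '' ((K₁ ∩ K) ∩ {g : G | lev g ≤ n})) := by
      ext x
      constructor
      · intro hx
        obtain ⟨a, ha, e⟩ := exists_classMin hK hK₁ x
        exact ⟨a, ⟨ha.1, by rw [mem_ofPred_eq, e]; exact hx⟩, ha.2⟩
      · rintro ⟨a, ⟨ha, hn⟩, e⟩
        exact (Nat.sInf_le (show lev a ∈ lev '' fib (K₁ ∩ K) (rng x) from ⟨a, ⟨ha, e⟩, rfl⟩)).trans hn
    rw [h2]
    exact h1.preimage continuous_rng
  rw [IsLocallyConstant.iff_isOpen_fiber]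
  intro n
  have : classMin (K₁ ∩ K) lev ⁻¹' {n} =
      {x : G | classMin (K₁ ∩ K) lev x ≤ n} \ ⋃ m ∈ Finset.range n,
        {x : G | classMin (K₁ ∩ K) lev x ≤ m} := by
    ext x
    simp only [mem_preimage, mem_singleton_iff, Set.mem_sdiff, mem_ofPred_eq, mem_iUnion,
      Finset.mem_range, exists_prop, not_exists, not_and, not_le]
    constructor
    · intro h
      exact ⟨h.le, fun m hm => by omega⟩
    · rintro ⟨h1, h2⟩
      by_contra hne
      have := h2 _ (lt_of_le_of_ne h1 hne)
      omega
  rw [this]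
  exact (hle n).isOpen.sdiff ((Finset.range n).finite_toSet.isClosed_biUnion
    fun m _ => (hle m).isClosed)

theorem classMin_eq (hK : IsTower K lev) (hK₁ : IsTower K₁ lev₁) {g : G} (hg : g ∈ K) (hg₁ : g ∈ K₁) :
    classMin (K₁ ∩ K) lev g = classMin (K₁ ∩ K) lev (src g) := by
  unfold classMin
  congr 1
  rw [rng_src]
  ext n
  constructor
  · rintro ⟨a, ⟨⟨ha₁, ha⟩, hs⟩, rfl⟩
    refine ⟨comp a g, ⟨⟨hK₁.comp_mem _ ha₁ _ hg₁ hs, hK.comp_mem _ ha _ hg hs⟩, src_comp _ _ hs⟩, ?_⟩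
    rw [← hK.lev_rng, rng_comp _ _ hs, hK.lev_rng]
  · rintro ⟨a, ⟨⟨ha₁, ha⟩, hs⟩, rfl⟩
    refine ⟨comp a (inver g), ⟨⟨hK₁.div_mem ha₁ hg₁ hs, hK.div_mem ha hg hs⟩, src_div hs⟩, ?_⟩
    rw [← hK.lev_rng, rng_div hs, hK.lev_rng]

/-- Levels are distinct within a K-orbit, so the lowest point of a class identifies the class; the
minimum can thus serve as its label in the keys. -/
theorem mem_of_classMin_eq (hK : IsTower K lev) (hK₁ : IsTower K₁ lev₁) {k : G} (hk : k ∈ K)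
    (h : classMin (K₁ ∩ K) lev k = classMin (K₁ ∩ K) lev (src k)) : k ∈ K₁ := by
  obtain ⟨a, ⟨⟨ha₁, ha⟩, has⟩, hal⟩ := exists_classMin hK hK₁ k
  obtain ⟨b, ⟨⟨hb₁, hb⟩, hbs⟩, hbl⟩ := exists_classMin hK hK₁ (src k)
  rw [rng_src] at hbs
  have e : comp a k = b := by
    refine hK.inj _ (hK.comp_mem _ ha _ hk has) _ hb (by rw [src_comp _ _ has, hbs]) ?_
    rw [← hK.lev_rng, rng_comp _ _ has, hK.lev_rng, hal, hbl, h]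
  rw [← inver_comp_cancel has, e]
  refine hK₁.comp_mem _ (hK₁.inver_mem _ ha₁) _ hb₁ ?_
  rw [src_inver, ← e, rng_comp _ _ has]

theorem classMin_lt (hK : IsTower K lev) (hK₁ : IsTower K₁ lev₁) {L : ℕ} (hL : ∀ g, lev g < L)
    (x : G) : classMin (K₁ ∩ K) lev x < L := by
  obtain ⟨a, -, h⟩ := exists_classMin hK hK₁ x
  rw [← h]
  exact hL a

open Classical in
/-- The key which puts `U` first and keeps the classes of `D` together on the complement. -/
noncomputable def keyU (D U : Set G) (lev : G → ℕ) (L : ℕ) (x : G) : ℕ :=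
  if rng x ∈ U then lev x else L + classMin D lev x * L + lev x

open Classical in
/-- The key which puts `B` first, `U` last, and agrees with `keyU` on the remaining units. -/
noncomputable def keyB (D U B : Set G) (lev : G → ℕ) (L : ℕ) (x : G) : ℕ :=
  if rng x ∈ U then L + L * L + lev x
  else if rng x ∈ B then lev x else L + classMin D lev x * L + lev x

theorem eventually_mem_rng_iff {U : Set G} (hU : IsClopen U) (x : G) :
    ∀ᶠ y in 𝓝 x, (rng y ∈ U ↔ rng x ∈ U) := by
  have hcl : IsClopen (rng ⁻¹' U : Set G) := hU.preimage continuous_rng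
  by_cases hx : rng x ∈ U
  · filter_upwards [hcl.isOpen.mem_nhds hx] with y hy
    exact ⟨fun _ => hx, fun _ => hy⟩
  · filter_upwards [hcl.compl.isOpen.mem_nhds hx] with y hy
    exact ⟨fun h => absurd h hy, fun h => absurd h hx⟩

theorem isLocallyConstant_keyU [T2Space G] (hK : IsTower K lev) (hK₁ : IsTower K₁ lev₁) {U : Set G}
    (hU : IsClopen U) (L : ℕ) : IsLocallyConstant (keyU (K₁ ∩ K) U lev L) := by
  rw [IsLocallyConstant.iff_eventually_eq]
  intro x
  filter_upwards [eventually_mem_rng_iff hU x, hK.lev_loc.eventually_eq x,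
    (isLocallyConstant_classMin hK hK₁).eventually_eq x] with y h1 h2 h3
  unfold keyU
  rw [h2, h3]
  classical
  exact if_congr h1 rfl rfl

theorem isLocallyConstant_keyB [T2Space G] (hK : IsTower K lev) (hK₁ : IsTower K₁ lev₁) {U B : Set G}
    (hU : IsClopen U) (hB : IsClopen B) (L : ℕ) :
    IsLocallyConstant (keyB (K₁ ∩ K) U B lev L) := by
  rw [IsLocallyConstant.iff_eventually_eq]
  intro x
  filter_upwards [eventually_mem_rng_iff hU x, eventually_mem_rng_iff hB x,
    hK.lev_loc.eventually_eq x,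
    (isLocallyConstant_classMin hK hK₁).eventually_eq x] with y h1 h1' h2 h3
  unfold keyB
  rw [h2, h3]
  classical
  exact if_congr h1 rfl (if_congr h1' rfl rfl)

/-- Every summand of the key except the level is a multiple of L. So the key recovers the level and
is injective on orbits. -/
theorem keyU_mod {D U : Set G} {L : ℕ} (hL : ∀ g, lev g < L) (x : G) :
    keyU D U lev L x % L = lev x := by
  unfold keyU
  split_ifs
  · exact Nat.mod_eq_of_lt (hL x)
  · rw [show L + classMin D lev x * L + lev x = lev x + (1 + classMin D lev x) * L by ring,
      Nat.add_mul_mod_self_right, Nat.mod_eq_of_lt (hL x)]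

theorem keyB_mod {D U B : Set G} {L : ℕ} (hL : ∀ g, lev g < L) (x : G) :
    keyB D U B lev L x % L = lev x := by
  unfold keyB
  split_ifs
  · rw [show L + L * L + lev x = lev x + (1 + L) * L by ring,
      Nat.add_mul_mod_self_right, Nat.mod_eq_of_lt (hL x)]
  · exact Nat.mod_eq_of_lt (hL x)
  · rw [show L + classMin D lev x * L + lev x = lev x + (1 + classMin D lev x) * L by ring,
      Nat.add_mul_mod_self_right, Nat.mod_eq_of_lt (hL x)]

theorem injOn_key (hK : IsTower K lev) {key : G → ℕ} {L : ℕ} (hmod : ∀ x, key x % L = lev x) (x : G) :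
    InjOn (fun k => key (rng k)) (fib K x) := by
  intro k hk l hl e
  refine hK.inj k hk.1 l hl.1 (by rw [hk.2, hl.2]) ?_
  rw [← hK.lev_rng k, ← hK.lev_rng l, ← hmod, ← hmod (rng l)]
  exact congrArg (· % L) e

theorem le_orbitRank_of_notMem (hK : IsTower K lev) {D U : Set G} {L : ℕ} (hL : ∀ g, lev g < L)
    {x k : G} (hk : k ∈ fib K x) (hkU : rng k ∉ U) :
    {l ∈ fib K x | rng l ∈ U}.ncard ≤ orbitRank K (keyU D U lev L) k := by
  rw [hK.orbitRank_eq _ hk]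
  refine ncard_le_ncard ?_ ((finite_fib hK.isCompact x).subset (sep_subset _ _))
  rintro l ⟨hl, hlU⟩
  refine ⟨hl, ?_⟩
  unfold keyU
  rw [rng_rng, rng_rng, if_pos hlU, if_neg hkU]
  have := hL (rng l)
  omega

theorem orbitRank_keyB_lt (hK : IsTower K lev) {D U B : Set G} {L : ℕ} (hL : ∀ g, lev g < L)
    {x k : G} (hk : k ∈ fib K x) (hkU : rng k ∉ U) (hkB : rng k ∈ B) :
    orbitRank K (keyB D U B lev L) k < {l ∈ fib K x | rng l ∈ B}.ncard := by
  rw [hK.orbitRank_eq _ hk]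
  refine ncard_lt_ncard ⟨?_, fun h => ?_⟩ ((finite_fib hK.isCompact x).subset (sep_subset _ _))
  · rintro l ⟨hl, hlt⟩
    refine ⟨hl, ?_⟩
    unfold keyB at hlt
    rw [rng_rng, rng_rng, if_neg hkU, if_pos hkB] at hlt
    have := hL (rng k)
    split_ifs at hlt with h1 h2
    · omega
    · exact h2
    · omega
  · exact (h (show k ∈ _ from ⟨hk, hkB⟩)).2.false

/-- A point before r(g) in the B-first order lies in B, or lies outside U and precedes s(g) in the
U-first order, or is in the common class of s(g) and r(g), which has at most N points. The U-first
order has all of U before s(g) instead, and #B + N < #U. -/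
theorem orbitRank_keyB_lt_orbitRank_keyU (hK : IsTower K lev) (hK₁ : IsTower K₁ lev₁) {U B : Set G}
    {L N : ℕ} (hL : ∀ g, lev g < L) {g : G} (hg : g ∈ K) (hg₁ : g ∈ K₁) (hrU : rng g ∉ U)
    (hsU : src g ∉ U) (hrB : rng g ∉ B) (hN : (fib K₁ (src g)).ncard ≤ N)
    (hcount : {k ∈ fib K (src g) | rng k ∈ B}.ncard + N < {k ∈ fib K (src g) | rng k ∈ U}.ncard) :
    orbitRank K (keyB (K₁ ∩ K) U B lev L) g < orbitRank K (keyU (K₁ ∩ K) U lev L) (src g) := by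
  set x := src g with hx
  have hfin := finite_fib hK.isCompact x
  have hgf : g ∈ fib K x := ⟨hg, rfl⟩
  have hxf : x ∈ fib K x := hK.self_mem_fib (src_mem g)
  have hrx : rng x = x := rng_src g
  have hm : classMin (K₁ ∩ K) lev g = classMin (K₁ ∩ K) lev x := classMin_eq hK hK₁ hg hg₁
  rw [hK.orbitRank_eq _ hgf, hK.orbitRank_eq _ hxf, hrx]
  set m := classMin (K₁ ∩ K) lev x with hmdef
  set A : Set G := {l ∈ fib K x | keyU (K₁ ∩ K) U lev L (rng l) < keyU (K₁ ∩ K) U lev L x} with hA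
  have hUA : {l ∈ fib K x | rng l ∈ U} ⊆ A := by
    rintro l ⟨hl, hlU⟩
    refine ⟨hl, ?_⟩
    unfold keyU
    rw [rng_rng, hrx, if_pos hlU, if_neg hsU]
    have := hL (rng l)
    omega
  have hsub : {l ∈ fib K x | keyB (K₁ ∩ K) U B lev L (rng l) < keyB (K₁ ∩ K) U B lev L (rng g)} ⊆
      {l ∈ fib K x | rng l ∈ B} ∪ (A \ {l ∈ fib K x | rng l ∈ U}) ∪ fib K₁ x := by
    rintro l ⟨hl, hlt⟩
    unfold keyB at hlt
    rw [rng_rng, rng_rng, if_neg hrU, if_neg hrB, classMin_rng _ _ g, hm] at hlt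
    have h1 := hL (rng g)
    have hmL : m < L := classMin_lt hK hK₁ hL x
    split_ifs at hlt with hlU hlB
    · exfalso
      -- A class label is at most L − 1, so the offset L + L² really places U after all other
      -- points.
      have : m * L ≤ (L - 1) * L := Nat.mul_le_mul_right _ (by omega)
      have h2 : (L - 1) * L + L = L * L := by
        rw [← Nat.succ_mul]
        congr 1
        omega
      omega
    · exact Or.inl (Or.inl ⟨hl, hlB⟩)
    · rw [classMin_rng] at hlt
      by_cases hkey : keyU (K₁ ∩ K) U lev L (rng l) < keyU (K₁ ∩ K) U lev L x
      · exact Or.inl (Or.inr ⟨⟨hl, hkey⟩, fun h => hlU h.2⟩)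
      · refine Or.inr ⟨?_, hl.2⟩
        refine mem_of_classMin_eq hK hK₁ hl.1 ?_
        rw [hl.2, ← hmdef]
        unfold keyU at hkey
        rw [rng_rng, hrx, if_neg hlU, if_neg hsU, classMin_rng, ← hmdef] at hkey
        have h2 := hL (rng l)
        have h3 := hL x
        set m' := classMin (K₁ ∩ K) lev l
        rcases lt_trichotomy m' m with h | h | h
        · exfalso
          have : (m' + 1) * L ≤ m * L := Nat.mul_le_mul_right _ h
          rw [Nat.succ_mul] at this
          omega
        · exact h
        · exfalso
          have : (m + 1) * L ≤ m' * L := Nat.mul_le_mul_right _ h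
          rw [Nat.succ_mul] at this
          omega
  have hAfin : A.Finite := hfin.subset (sep_subset _ _)
  have h1 := ncard_le_ncard hsub
    (((hfin.subset (sep_subset _ _)).union (hAfin.subset sdiff_subset)).union
      (finite_fib hK₁.isCompact x))
  have h2 := ncard_union_le ({l ∈ fib K x | rng l ∈ B} ∪ (A \ {l ∈ fib K x | rng l ∈ U})) (fib K₁ x)
  have h3 := ncard_union_le {l ∈ fib K x | rng l ∈ B} (A \ {l ∈ fib K x | rng l ∈ U})
  have h4 := ncard_sdiff_add_ncard_of_subset hUA hAfin
  omega

/-- A full bisection `W` and a potential on the unit space which is lowered by `W C`. -/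
theorem exists_lowering_bisection [T2Space G] [CompactSpace (units : Set G)] (hmin : IsMinimal G)
    (haf : AlmostFinite G)
    (hinf : ∀ x ∈ (units : Set G), {g : G | src g = x}.Infinite) {U : Set G} (hU : IsClopen U)
    (hUu : U ⊆ units) (hUne : U.Nonempty) {C : Set G} (hC : IsCompact C) :
    ∃ (W : Set G) (pot : G → ℕ) (n : ℕ), IsCompact W ∧ IsOpen W ∧ IsGSet W ∧ src '' W = units ∧
      rng '' W = units ∧ (∀ x, pot x < n) ∧
      ∀ w ∈ W, ∀ g ∈ C, src w = rng g → rng g ∉ U → src g ∉ U → pot (rng w) < pot (src g) := by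
  classical
  have hcov : HasCompactOpenCover G := haf.1
  obtain ⟨K₁, K, B, lev₁, lev, N, hK₁, hK, hB, hBC, hN, hcount⟩ :=
    exists_two_towers hmin haf hinf hU.isOpen hUu hUne hC
  obtain ⟨L, -, hL⟩ := hK.exists_lev_lt
  obtain ⟨W, hWc, hWo, hWg, hWs, hWr, hWK, hW⟩ := hK.exists_matching hcov
    (isLocallyConstant_keyU hK hK₁ hU L) (isLocallyConstant_keyB hK hK₁ hU hB L)
    (injOn_key hK (keyU_mod hL)) (injOn_key hK (keyB_mod hL))
  set key := keyU (K₁ ∩ K) U lev L with hkey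
  obtain ⟨n, hn⟩ := exists_encard_src_le hK.isCompact
  have hrank : ∀ x, orbitRank K key x < n + 1 := by
    intro x
    have hm := hK.self_mem_fib (rng_mem x)
    have h1 : orbitRank K key x < (fib K (rng x)).ncard := by
      rw [← orbitRank_rng, hK.orbitRank_eq key hm]
      exact rank_lt_card (finite_fib hK.isCompact _) _ hm
    have h2 := hn (rng x)
    rw [show {g ∈ K | src g = rng x} = fib K (rng x) from rfl,
      ← (finite_fib hK.isCompact _).cast_ncard_eq] at h2
    have h3 : (fib K (rng x)).ncard ≤ n := by exact_mod_cast h2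
    omega
  -- Off U the potential is the U-first rank, hence at least the positive number of points of U in
  -- the orbit; landing in U therefore always lowers it.
  refine ⟨W, fun x => if x ∈ U then 0 else orbitRank K key x, n + 1, hWc, hWo, hWg, hWs, hWr, ?_, ?_⟩
  · intro x
    simp only
    split_ifs
    · omega
    · exact hrank x
  · intro w hw g hg e hrU hsU
    simp only
    rw [if_neg hsU]
    have hpos : ∀ x ∈ (units : Set G), 0 < {k ∈ fib K x | rng k ∈ U}.ncard := fun x hx => by
      have := hcount x hx
      omega
    have hsg : {k ∈ fib K (src g) | rng k ∈ U}.ncard ≤ orbitRank K key (src g) :=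
      le_orbitRank_of_notMem hK hL (hK.self_mem_fib (src_mem g)) (by rwa [rng_src])
    have hsg0 := hpos _ (src_mem g)
    have hwr := hW w hw
    rw [e, orbitRank_rng] at hwr
    split_ifs with hwU
    · omega
    -- For r(g) in B the B-first rank is below #B < #U, which forces W to carry r(g) into U.
    by_cases hgB : rng g ∈ B
    · exfalso
      have hwf : w ∈ fib K (rng g) := ⟨hWK hw, e⟩
      have h1 : {k ∈ fib K (rng g) | rng k ∈ U}.ncard ≤ orbitRank K key w :=
        le_orbitRank_of_notMem hK hL hwf hwU
      have h2 := orbitRank_keyB_lt hK (D := K₁ ∩ K) hL (hK.self_mem_fib (rng_mem g))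
        (by rwa [rng_rng]) (by rwa [rng_rng] : rng (rng g) ∈ B)
      rw [orbitRank_rng] at h2
      have h3 := hcount _ (rng_mem g)
      omega
    · obtain ⟨hg₁, hgK⟩ := hBC g hg hgB
      have h1 := orbitRank_keyB_lt_orbitRank_keyU hK hK₁ hL hgK hg₁ hrU hsU hgB (hN _)
        (hcount _ (src_mem g))
      rw [← hkey] at h1
      rw [orbitRank_rng]
      omega

end Keys

end EtaleGroupoid

namespace EtaleGroupoid
open ArrowGroupoid Set Filter Topology
open scoped CompactlySupported

/-! ### Density of the invertibles when source fibres are infinite. -/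

section StableRankOne

variable {G : Type*} [TopologicalSpace G] [EtaleGroupoid G] [T2Space G]

/-- A function supported on arrows along which a bounded potential strictly increases from range to
source acts by a nilpotent operator. -/
theorem isNilpotent_lam (hcov : HasCompactOpenCover G) {pot : G → ℕ} {n : ℕ} (hn : ∀ x, pot x < n)
    {f : C_c(G, ℂ)} (hf : ∀ g, f g ≠ 0 → pot (rng g) < pot (src g)) : IsNilpotent (lam f) := by
  have key : ∀ m : ℕ, ∃ p : C_c(G, ℂ), lam p = lam f ^ (m + 1) ∧
      ∀ g, p g ≠ 0 → pot (rng g) + (m + 1) ≤ pot (src g) := by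
    intro m
    induction m with
    | zero => exact ⟨f, (pow_one _).symm, hf⟩
    | succ m ih =>
      obtain ⟨p, hp, hpot⟩ := ih
      refine ⟨conv hcov p f, by rw [lam_conv, hp, ← pow_succ], fun g hg => ?_⟩
      obtain ⟨k, e, h1, h2⟩ := exists_of_convFun_ne_zero hg
      have h3 := hpot _ h1
      have h4 := hf _ h2
      rw [rng_div e, src_div e] at h3
      rw [e]
      omega
  obtain ⟨p, hp, hpot⟩ := key n
  refine ⟨n + 1, ?_⟩
  rw [← hp]
  have h0 : p = 0 := by
    ext g
    by_contra hg
    have h1 := hpot g hg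
    have h2 := hn (src g)
    omega
  refine Subtype.ext (ext_entries fun k x => ?_)
  rw [coe_lam, regularRep_delta, h0]
  unfold convKernel
  split_ifs <;> rfl

variable [CompactSpace (units : Set G)]

/-- For a bisection, W W⁻¹ = r(W), here the whole unit space. -/
theorem lam_indicator_mul_star (hcov : HasCompactOpenCover G) {W : Set G} (ho : IsClopen W)
    (hc : IsCompact W) (hW : IsGSet W) (hr : rng '' W = units) :
    lam (indicatorCc ho hc) * star (lam (indicatorCc ho hc)) = 1 := by
  rw [← lam_adj, ← lam_conv hcov, ← map_one (unitRep G), unitRep_apply]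
  congr 1
  ext x
  obtain ⟨v, hv, e⟩ : rng x ∈ rng '' W := hr ▸ rng_mem x
  have e1 : src (inver v) = rng x := by rw [src_inver, e]
  have h1 : conv hcov (indicatorCc ho hc) (adj (indicatorCc ho hc)) x =
      indicatorCc ho hc v * adj (indicatorCc ho hc) (comp (inver v) x) :=
    convFun_of_mem hW.1 (fun y hy => indicator_of_notMem hy _) hv e
  have e2 : src (inver x) = rng v := by rw [src_inver, e]
  rw [h1, adj_apply, indicatorCc_apply, indicator_of_mem hv, Pi.one_apply, one_mul, inver_comp e1,
    inver_inver, indicatorCc_apply, ofUnits_apply]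
  by_cases hx : x ∈ (units : Set G)
  · have e3 : comp (inver x) v = v := by
      rw [inver_unit hx, ← rng_unit x hx, ← e, rng_mul_self]
    rw [e3, indicator_of_mem hv, indicator_of_mem hx]
    simp
  · rw [indicator_of_notMem hx, indicator_of_notMem, star_zero]
    intro hm
    refine hx ?_
    have e3 : comp (inver x) v = v := hW.2 hm hv (src_comp _ _ e2)
    have e4 : inver x = rng v := by
      rw [← comp_inver_cancel e2, e3, mul_inver]
    rw [← inver_inver x, e4, inver_unit (rng_mem v)]
    exact rng_mem v

theorem isUnit_lam_indicator (hmin : IsMinimal G) (haf : AlmostFinite G) {W : Set G}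
    (ho : IsClopen W) (hc : IsCompact W) (hW : IsGSet W) (hr : rng '' W = units) :
    IsUnit (lam (indicatorCc ho hc)) := by
  have h := lam_indicator_mul_star haf.1 ho hc hW hr
  have h' := mul_star_self_eq_one hmin haf (star (lam (indicatorCc ho hc))) (by rwa [star_star])
  rw [star_star] at h'
  exact ⟨⟨_, _, h, h'⟩, rfl⟩

/-- Multiplying by the unitary of the lowering bisection for the support of f makes the potential
rise from range to source on every arrow of the support, so the product is nilpotent. -/
theorem lam_mem_closure_isUnit (hmin : IsMinimal G) (haf : AlmostFinite G)
    (hinf : ∀ x ∈ (units : Set G), {g : G | src g = x}.Infinite) {U : Set G} (hU : IsClopen U)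
    (hUu : U ⊆ units) (hUne : U.Nonempty) {f : C_c(G, ℂ)}
    (hf : ∀ g, f g ≠ 0 → rng g ∉ U ∧ src g ∉ U) :
    lam f ∈ closure {a : reducedCStarAlgebra G | IsUnit a} := by
  obtain ⟨W, pot, n, hWc, hWo, hWg, -, hWr, hn, hpot⟩ :=
    exists_lowering_bisection hmin haf hinf hU hUu hUne f.hasCompactSupport.isCompact
  have ho : IsClopen W := ⟨hWc.isClosed, hWo⟩
  refine mem_closure_isUnit_of_isNilpotent (isUnit_lam_indicator hmin haf ho hWc hWg hWr) ?_
  rw [← lam_conv haf.1]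
  refine isNilpotent_lam haf.1 hn fun g hg => ?_
  obtain ⟨k, e, h1, h2⟩ := exists_of_convFun_ne_zero hg
  have hm : comp g (inver k) ∈ W := by
    by_contra hm
    exact h1 (indicator_of_notMem hm _)
  have := hpot _ hm k (subset_tsupport _ h2) (src_div e) (hf k h2).1 (hf k h2).2
  rwa [rng_div e, ← e] at this

/-- With p the complementary projection, a = p a p, so an approximation λ(f) may be replaced by p
λ(f) p, whose function vanishes on arrows touching U. -/
theorem mem_closure_isUnit_of_annihilator (hmin : IsMinimal G) (haf : AlmostFinite G)
    (hinf : ∀ x ∈ (units : Set G), {g : G | src g = x}.Infinite) {K : Set G} {lev : G → ℕ}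
    (hK : IsTower K lev) {t : ℕ} (ht : ∃ x ∈ (units : Set G), lev x = t) {a : reducedCStarAlgebra G}
    (ha : a * unitRep G (hK.levelFn t) = 0) (ha' : unitRep G (hK.levelFn t) * a = 0) :
    a ∈ closure {a : reducedCStarAlgebra G | IsUnit a} := by
  have hU : IsClopen {x ∈ (units : Set G) | lev x = t} :=
    (isClopen_units G).inter (hK.lev_loc.isClopen_fiber t)
  obtain ⟨x₀, hx₀, hx₀t⟩ := ht
  rw [← closure_closure, Metric.mem_closure_iff]
  intro ε hε
  set p := unitRep G (1 - hK.levelFn t) with hp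
  have hp' : p = 1 - unitRep G (hK.levelFn t) := by rw [hp, map_sub, map_one]
  have hpn : ‖p‖ ≤ 1 := by
    refine (norm_unitRep_le _).trans ((ContinuousMap.norm_le _ zero_le_one).2 fun x => ?_)
    rw [ContinuousMap.sub_apply, hK.levelFn_apply]
    split_ifs <;> simp
  obtain ⟨f, hf⟩ := exists_lam_near haf.1 a hε
  refine ⟨lam (cutoff (1 - hK.levelFn t) f (1 - hK.levelFn t)), ?_, ?_⟩
  · refine lam_mem_closure_isUnit hmin haf hinf hU (sep_subset _ _) ⟨x₀, hx₀, hx₀t⟩ fun g hg => ?_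
    rw [cutoff_apply] at hg
    constructor
    · rintro ⟨-, h⟩
      refine left_ne_zero_of_mul (left_ne_zero_of_mul hg) ?_
      rw [ContinuousMap.sub_apply, hK.levelFn_apply,
        if_pos (show lev (unitRng g : G) = t from h)]
      simp
    · rintro ⟨-, h⟩
      refine right_ne_zero_of_mul hg ?_
      rw [ContinuousMap.sub_apply, hK.levelFn_apply,
        if_pos (show lev (unitSrc g : G) = t from h)]
      simp
  · have e : a = p * a * p := by
      rw [hp', sub_mul, one_mul, ha', sub_zero, mul_sub, mul_one, ha, sub_zero]
    rw [lam_cutoff, ← hp, dist_comm, dist_eq_norm]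
    calc ‖p * lam f * p - a‖ = ‖p * (lam f - a) * p‖ := by
          rw [mul_sub, sub_mul, ← e]
      _ ≤ ‖p‖ * ‖lam f - a‖ * ‖p‖ := (norm_mul_le _ _).trans (by gcongr; exact norm_mul_le _ _)
      _ ≤ 1 * ‖lam f - a‖ * 1 := by gcongr
      _ < ε := by rwa [one_mul, mul_one]

theorem star_unitRep_complexify (h : C((units : Set G), ℝ)) :
    star (unitRep G (complexify h)) = unitRep G (complexify h) := by
  rw [← map_star]
  congr 1
  ext x
  rw [ContinuousMap.star_apply, complexify_apply]
  exact Complex.conj_ofReal _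

/-- Only the first step, from a to b, is a perturbation of a; passing to functions and then to a
clopen level uses invertible factors, which preserve the closure of the invertibles. -/
theorem dense_isUnit_of_infinite (hmin : IsMinimal G) (haf : AlmostFinite G)
    (hinf : ∀ x ∈ (units : Set G), {g : G | src g = x}.Infinite) :
    Dense {a : reducedCStarAlgebra G | IsUnit a} := by
  intro a
  by_cases ha : IsUnit a
  · exact subset_closure ha
  rw [← closure_closure, Metric.mem_closure_iff]
  intro ε hε
  obtain ⟨b, d, e, hb, hd, he, hbd, heb⟩ :=
    exists_near_zero_divisor (mul_star_self_eq_one hmin haf) ha (half_pos hε)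
  refine ⟨b, ?_, by rw [dist_comm, dist_eq_norm]; linarith⟩
  obtain ⟨u, h, hu, hh, hh0, hud⟩ := exists_isUnit_mul_unitRep hmin haf hd
  obtain ⟨v, k, hv, hk, hk0, hve⟩ := exists_isUnit_mul_unitRep hmin haf he
  have h1 : star v * b * u * unitRep G (complexify h) = 0 := by
    rw [mul_assoc, hud, ← mul_assoc, mul_assoc (star v), hbd, mul_zero, zero_mul]
  have hve' : unitRep G (complexify k) * star v = unitRep G (complexify k) * (star e * e) := by
    have := congrArg star hve
    simpa only [star_mul, star_star, star_unitRep_complexify, mul_assoc] using this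
  have h2 : unitRep G (complexify k) * (star v * b * u) = 0 := by
    rw [← mul_assoc, ← mul_assoc, hve', mul_assoc _ _ b, heb, mul_zero, zero_mul]
  obtain ⟨S, T, K, lev, hK, t, hS, hT, ht, h3, h4⟩ :=
    exists_clopen_annihilator hmin haf hh hk hh0 hk0 h1 h2
  exact mem_closure_isUnit_of_mul hv.star hu (mem_closure_isUnit_of_mul hS hT
    (mem_closure_isUnit_of_annihilator hmin haf hinf hK ht h3 h4))

end StableRankOne

/-! ### The case of a finite source fibre. -/

section FiniteDimensional

/-- The orbit of x is finite, hence closed, and its complement is open and invariant, so the orbit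
is the whole unit space. Every arrow is then a quotient of two arrows from the finite fibre. -/
theorem finite_of_finite_src_fiber {G : Type*} [TopologicalSpace G] [EtaleGroupoid G] [T2Space G]
    (hmin : IsMinimal G) {x : G} (hx : x ∈ (units : Set G))
    (hfin : {g : G | src g = x}.Finite) : Finite G := by
  set F : Set G := {g : G | src g = x} with hF
  have hcl : IsClosed (rng '' F) := (hfin.image _).isClosed
  have hinv : IsInvariant ((units : Set G) \ rng '' F) := by
    refine Subset.antisymm ?_ fun y hy =>
      ⟨y, ⟨y, mem_univ _, y, hy, by rw [src_unit y hy.1, rng_unit y hy.1], ?_⟩, rng_unit y hy.1⟩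
    · rintro _ ⟨_, ⟨v, -, w, ⟨hw, hwF⟩, e, rfl⟩, rfl⟩
      rw [rng_comp _ _ e]
      refine ⟨rng_mem v, ?_⟩
      rintro ⟨g, hg, hgv⟩
      have e1 : src (inver v) = rng g := by rw [src_inver, hgv]
      refine hwF ⟨comp (inver v) g, (src_comp _ _ e1).trans hg, ?_⟩
      rw [rng_comp _ _ e1, rng_inver, e, rng_unit w hw]
    · have := rng_mul_self y
      rwa [rng_unit y hy.1] at this
  have hxF : x ∈ rng '' F := ⟨x, src_unit x hx, rng_unit x hx⟩
  have hsub : (units : Set G) ⊆ rng '' F := by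
    rcases hmin _ sdiff_subset (((isOpen_units G).sdiff hcl).preimage continuous_subtype_val) hinv
      with h | h
    · exact sdiff_eq_empty.1 h
    · exact absurd hxF (h.ge hx).2
  refine Set.finite_univ_iff.1 ((hfin.image2 (fun a b => comp a (inver b)) hfin).subset
    fun g _ => ?_)
  obtain ⟨b, hb, hbg⟩ := hsub (src_mem g)
  exact ⟨comp g b, (src_comp _ _ hbg.symm).trans hb, b, hb, comp_inver_cancel hbg.symm⟩

theorem finiteDimensional_ell2 (X : Type*) [Finite X] : FiniteDimensional ℂ (Ell2 X) :=
  FiniteDimensional.of_injective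
    ({ toFun := fun ξ => ξ
       map_add' := fun _ _ => rfl
       map_smul' := fun _ _ => rfl } : Ell2 X →ₗ[ℂ] (X → ℂ)) fun _ _ h => lp.ext h

theorem finiteDimensional_reducedCStarAlgebra (G : Type*) [TopologicalSpace G] [EtaleGroupoid G]
    [Finite G] : FiniteDimensional ℂ (reducedCStarAlgebra G) := by
  have := finiteDimensional_ell2 G
  refine FiniteDimensional.of_injective (V₂ := Ell2 G →ₗ[ℂ] Ell2 G)
    ((ContinuousLinearMap.coeLM ℂ).comp (reducedCStarAlgebra G).toSubalgebra.val.toLinearMap)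
    fun a b h => Subtype.ext (ContinuousLinearMap.coe_injective h)

end FiniteDimensional

end EtaleGroupoid

theorem mainTheorem1 (G : Type*) [TopologicalSpace G] [LocallyCompactSpace G] [T2Space G]
    [EtaleGroupoid G] [CompactSpace (ArrowGroupoid.units : Set G)]
    (hmin : EtaleGroupoid.IsMinimal G) (haf : EtaleGroupoid.AlmostFinite G) :
    EtaleGroupoid.stableRank (EtaleGroupoid.reducedCStarAlgebra G) = 1 := by
  refine EtaleGroupoid.stableRank_eq_one ?_
  by_cases hinf : ∀ x ∈ (ArrowGroupoid.units : Set G), {g : G | ArrowGroupoid.src g = x}.Infinite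
  · exact EtaleGroupoid.dense_isUnit_of_infinite hmin haf hinf
  · push Not at hinf
    obtain ⟨x, hx, hfin⟩ := hinf
    have := EtaleGroupoid.finite_of_finite_src_fiber hmin hx hfin
    have := EtaleGroupoid.finiteDimensional_reducedCStarAlgebra G
    exact EtaleGroupoid.dense_isUnit_of_finiteDimensional
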